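/- Let $p>3$ be a prime, let $E$ and $E'$ be supersingular elliptic curves over $\mathbb F_p$ (that is, $E(\overline{\mathbb F}_p)$ and $E'(\overline{\mathbb F}_p)$ contain no point of order $p$), and let $\phi\colon E\to E'$ be an isogeny defined over $\mathbb F_p$. Let $\operatorname{End}_{\mathbb F_p}(E)$ and $\operatorname{End}_{\mathbb F_p}(E')$ denote the rings of endomorphisms defined over $\mathbb F_p$. If $\phi$ is non-horizontal, i.e. if the rings $\operatorname{End}_{\mathbb F_p}(E)$ and $\operatorname{End}_{\mathbb F_p}(E')$ are not isomorphic, then the degree $\deg\phi=[\mathbb F_p(E):\phi^*\mathbb F_p(E')]$ is divisible by $2$. -/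

import Mathlib

namespace IsogenyGraph

noncomputable section

open Polynomial Filter
open scoped Polynomial.Bivariate

universe u

variable {F : Type u} [Field F]

instance : DecidableEq (AlgebraicClosure F) := Classical.decEq _

/-- The base change of `E` to the algebraic closure of `F`. -/
abbrev geom (E : WeierstrassCurve.Affine F) : WeierstrassCurve.Affine (AlgebraicClosure F) :=
  E.map (algebraMap F (AlgebraicClosure F))

/-- The group `E(F̄)` of geometric points of a Weierstrass curve `E` over `F`. -/
abbrev GeomPoint (E : WeierstrassCurve.Affine F) : Type u :=
  (geom E).Point

/-- Selects the additive structure that comes from the group law. -/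
instance (priority := high) (E : WeierstrassCurve.Affine F) : AddZeroClass (GeomPoint E) :=
  AddMonoid.toAddZeroClass

/-- Evaluation of regular functions at an affine point over the base field. -/
def evalPt {K : Type*} [Field K] (V : WeierstrassCurve.Affine K) {x y : K}
    (h : V.Nonsingular x y) : V.CoordinateRing →+* K :=
  AdjoinRoot.evalEval h.1

/-- Evaluation of elements of the affine coordinate ring `F[E]` at an affine geometric point. -/
def evalGeom (E : WeierstrassCurve.Affine F) {x y : AlgebraicClosure F}
    (h : (geom E).Nonsingular x y) :
    E.CoordinateRing →+* AlgebraicClosure F :=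
  (evalPt (geom E) h).comp
    (WeierstrassCurve.Affine.CoordinateRing.map E (algebraMap F (AlgebraicClosure F)))

/-- `HasValueAt E u P c`: the geometric point `P` of `E` is affine, the rational function
`u ∈ F(E)` is regular at `P`, and its value there is `c`; that is, `u = a / d` with
`a, d ∈ F[E]`, `d(P) ≠ 0` and `c = a(P) / d(P)`. -/
def HasValueAt (E : WeierstrassCurve.Affine F) (u : E.FunctionField) :
    GeomPoint E → AlgebraicClosure F → Prop
  | .zero, _ => False
  | .some _ _ h, c => ∃ a d : E.CoordinateRing, evalGeom E h d ≠ 0 ∧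
      u * algebraMap _ E.FunctionField d = algebraMap _ E.FunctionField a ∧
      c * evalGeom E h d = evalGeom E h a

/-- Outside finitely many points, the map `f : E(F̄) → E'(F̄)` is given by `P ↦ (x(P), y(P))`. -/
def IsGivenBy (E E' : WeierstrassCurve.Affine F) (f : GeomPoint E → GeomPoint E')
    (x y : E.FunctionField) : Prop :=
  ∀ᶠ P in cofinite, ∃ a b, ∃ h, f P = .some a b h ∧ HasValueAt E x P a ∧ HasValueAt E y P b

/-- An isogeny `E → E'` defined over `F`: a homomorphism `E(F̄) → E'(F̄)` which, outside finitely
many points, is `P ↦ (x(P), y(P))` for two rational functions `x, y ∈ F(E)`, the pullbacks of the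
coordinate functions of `E'`. It is automatically not the zero map, which has no affine values. -/
def Isogeny (E E' : WeierstrassCurve.Affine F) : Type u :=
  {φ : (GeomPoint E →+ GeomPoint E') × E.FunctionField × E.FunctionField //
    IsGivenBy E E' φ.1 φ.2.1 φ.2.2}

/-- The map on geometric points. -/
def Isogeny.toHom {E E' : WeierstrassCurve.Affine F} (φ : Isogeny E E') :
    GeomPoint E →+ GeomPoint E' :=
  φ.1.1

/-- The pullback of the coordinate function `X` of `E'`. -/
def Isogeny.x {E E' : WeierstrassCurve.Affine F} (φ : Isogeny E E') : E.FunctionField :=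
  φ.1.2.1

/-- The pullback of the coordinate function `Y` of `E'`. -/
def Isogeny.y {E E' : WeierstrassCurve.Affine F} (φ : Isogeny E E') : E.FunctionField :=
  φ.1.2.2

lemma Isogeny.eventually_eq {E E' : WeierstrassCurve.Affine F} (φ : Isogeny E E') :
    ∀ᶠ P in cofinite, ∃ a b, ∃ h, φ.toHom P = .some a b h ∧
      HasValueAt E φ.x P a ∧ HasValueAt E φ.y P b :=
  φ.2

/-- The degree `[F(E) : φ^* F(E')]`; the image `φ^* F(E')` is the subfield `F(x, y)` generated by
the pullbacks of the two coordinate functions. -/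
def Isogeny.degree {E E' : WeierstrassCurve.Affine F} (φ : Isogeny E E') : ℕ :=
  Module.finrank (IntermediateField.adjoin F {φ.x, φ.y}) E.FunctionField

/-- Homomorphisms `E → E'` defined over `F`, as maps on geometric points: zero and the isogenies. -/
def IsHomOver (E E' : WeierstrassCurve.Affine F) (f : GeomPoint E →+ GeomPoint E') : Prop :=
  f = 0 ∨ ∃ φ : Isogeny E E', φ.toHom = f

/-! ### Homomorphisms over `F` are closed under the ring operations -/

section values

variable {E : WeierstrassCurve.Affine F} {u v : E.FunctionField} {P : GeomPoint E}
  {c d : AlgebraicClosure F}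

lemma HasValueAt.add (hu : HasValueAt E u P c) (hv : HasValueAt E v P d) :
    HasValueAt E (u + v) P (c + d) := by
  rcases P with _ | ⟨x, y, h⟩
  · exact hu
  obtain ⟨a, s, hs, h1, h2⟩ := hu
  obtain ⟨b, t, ht, h3, h4⟩ := hv
  refine ⟨a * t + b * s, s * t, by simp [hs, ht], ?_, ?_⟩
  · simp only [map_add, map_mul, ← h1, ← h3]; ring
  · simp only [map_add, map_mul, ← h2, ← h4]; ring

lemma HasValueAt.mul (hu : HasValueAt E u P c) (hv : HasValueAt E v P d) :
    HasValueAt E (u * v) P (c * d) := by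
  rcases P with _ | ⟨x, y, h⟩
  · exact hu
  obtain ⟨a, s, hs, h1, h2⟩ := hu
  obtain ⟨b, t, ht, h3, h4⟩ := hv
  refine ⟨a * b, s * t, by simp [hs, ht], ?_, ?_⟩
  · simp only [map_mul, ← h1, ← h3]; ring
  · simp only [map_mul, ← h2, ← h4]; ring

lemma HasValueAt.neg (hu : HasValueAt E u P c) : HasValueAt E (-u) P (-c) := by
  rcases P with _ | ⟨x, y, h⟩
  · exact hu
  obtain ⟨a, s, hs, h1, h2⟩ := hu
  exact ⟨-a, s, hs, by simp [← h1], by simp [← h2]⟩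

lemma HasValueAt.sub (hu : HasValueAt E u P c) (hv : HasValueAt E v P d) :
    HasValueAt E (u - v) P (c - d) := by
  simpa only [sub_eq_add_neg] using hu.add hv.neg

lemma HasValueAt.inv (hu : HasValueAt E u P c) (hc : c ≠ 0) : HasValueAt E u⁻¹ P c⁻¹ := by
  rcases P with _ | ⟨x, y, h⟩
  · exact hu
  obtain ⟨a, s, hs, h1, h2⟩ := hu
  have ha : evalGeom E h a ≠ 0 := by rw [← h2]; exact mul_ne_zero hc hs
  have hu0 : u ≠ 0 := by
    rintro rfl
    rw [zero_mul, eq_comm, IsFractionRing.to_map_eq_zero_iff] at h1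
    exact ha (by rw [h1, map_zero])
  exact ⟨s, a, ha, by rw [← h1, inv_mul_cancel_left₀ hu0], by rw [← h2, inv_mul_cancel_left₀ hc]⟩

lemma HasValueAt.div (hu : HasValueAt E u P c) (hv : HasValueAt E v P d) (hd : d ≠ 0) :
    HasValueAt E (u / v) P (c / d) := by
  simpa only [div_eq_mul_inv] using hu.mul (hv.inv hd)

lemma HasValueAt.unique (hu : HasValueAt E u P c) (hv : HasValueAt E u P d) : c = d := by
  rcases P with _ | ⟨x, y, h⟩
  · exact hu.elim
  obtain ⟨a, s, hs, h1, h2⟩ := hu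
  obtain ⟨b, t, ht, h3, h4⟩ := hv
  have : a * t = b * s := by
    apply IsFractionRing.injective _ E.FunctionField
    simp only [map_mul, ← h1, ← h3]; ring
  have := congrArg (evalGeom E h) this
  simp only [map_mul, ← h2, ← h4] at this
  have h0 : (c - d) * (evalGeom E h s * evalGeom E h t) = 0 := by linear_combination this
  exact sub_eq_zero.mp ((mul_eq_zero.mp h0).resolve_right (mul_ne_zero hs ht))

lemma evalGeom_mk {x y : AlgebraicClosure F}
    (h : (geom E).Nonsingular x y) (A : F[X][Y]) :
    evalGeom E h (WeierstrassCurve.Affine.CoordinateRing.mk E A) =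
      (A.map (mapRingHom (algebraMap F (AlgebraicClosure F)))).evalEval x y := by
  rw [evalGeom, RingHom.comp_apply, WeierstrassCurve.Affine.CoordinateRing.map_mk, evalPt]
  exact AdjoinRoot.evalEval_mk _ _

lemma hasValueAt_coe {x y : AlgebraicClosure F}
    (h : (geom E).Nonsingular x y)
    (a : E.CoordinateRing) :
    HasValueAt E (algebraMap _ E.FunctionField a) (.some x y h) (evalGeom E h a) :=
  ⟨a, 1, by simp, by simp, by simp⟩

lemma hasValueAt_const (hu : HasValueAt E u P c) (r : F) :
    HasValueAt E (algebraMap F E.FunctionField r) P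
      (algebraMap F (AlgebraicClosure F) r) := by
  rcases P with _ | ⟨x, y, h⟩
  · exact hu
  · have := hasValueAt_coe h (WeierstrassCurve.Affine.CoordinateRing.mk E (C (C r)))
    rw [evalGeom_mk] at this
    have e : algebraMap F E.FunctionField r = algebraMap E.CoordinateRing E.FunctionField
        (WeierstrassCurve.Affine.CoordinateRing.mk E (C (C r))) := by
      rw [IsScalarTower.algebraMap_apply F E.CoordinateRing E.FunctionField]; rfl
    rw [e]
    simpa only [Polynomial.map_C, coe_mapRingHom, evalEval_C, eval_C] using this

/-- Substitution of two rational functions into a bivariate polynomial. -/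
lemma HasValueAt.poly (hu : HasValueAt E u P c) (hv : HasValueAt E v P d) (A : F[X][Y]) :
    HasValueAt E (aevalAeval u v A) P
      ((A.map (mapRingHom (algebraMap F (AlgebraicClosure F)))).evalEval c d) := by
  have key : ∀ q : F[X], HasValueAt E (aeval u q) P
      ((q.map (algebraMap F (AlgebraicClosure F))).eval c) := by
    intro q
    induction q using Polynomial.induction_on' with
    | add p q hp hq => simpa using hp.add hq
    | monomial n r =>
      have : ∀ n : ℕ, HasValueAt E (u ^ n) P (c ^ n) := by
        intro n
        induction n with
        | zero => simpa using hasValueAt_const hu 1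
        | succ n ih => simpa only [pow_succ] using ih.mul hu
      simpa using (hasValueAt_const hu r).mul (this n)
  induction A using Polynomial.induction_on' with
  | add p q hp hq => simpa using hp.add hq
  | monomial n r =>
    have : ∀ n : ℕ, HasValueAt E (v ^ n) P (d ^ n) := by
      intro n
      induction n with
      | zero => simpa using hasValueAt_const hu 1
      | succ n ih => simpa only [pow_succ] using ih.mul hv
    have h2 := (key r).mul (this n)
    rw [← C_mul_X_pow_eq_monomial]
    simpa [evalEval] using h2

end values

section finiteness

lemma finite_zeros {K : Type*} [Field K] (V : WeierstrassCurve.Affine K) {a : V.CoordinateRing}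
    (ha : a ≠ 0) :
    {P : V.Point | ∀ x y, ∀ h, P = .some x y h → evalPt V h a = 0}.Finite := by
  classical
  obtain ⟨p, q, rfl⟩ := WeierstrassCurve.Affine.CoordinateRing.exists_smul_basis_eq a
  set N : K[X] := Algebra.norm K[X] (p • (1 : V.CoordinateRing) +
    q • WeierstrassCurve.Affine.CoordinateRing.mk V Y) with hN
  have : Module.Finite K[X] V.CoordinateRing :=
    .of_basis (WeierstrassCurve.Affine.CoordinateRing.basis V)
  have hN0 : N ≠ 0 := by rwa [hN, Ne, Algebra.norm_eq_zero_iff]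
  have hroot : ∀ x y, ∀ h : V.Nonsingular x y, evalPt V h
      (p • (1 : V.CoordinateRing) +
        q • WeierstrassCurve.Affine.CoordinateRing.mk V Y) = 0 → N.eval x = 0 := by
    intro x y h h0
    have e1 : evalPt V h (algebraMap K[X] _ N) = N.eval x := by
      refine (AdjoinRoot.evalEval_mk (p := V.polynomial) h.1 (C N)).trans ?_
      rw [evalEval_C]
    have e2 := WeierstrassCurve.Affine.CoordinateRing.coe_norm_smul_basis (W' := V) p q
    have e3 : evalPt V h (WeierstrassCurve.Affine.CoordinateRing.mk V
        (C p + C q * X)) = 0 := by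
      rw [← h0, WeierstrassCurve.Affine.CoordinateRing.smul,
        WeierstrassCurve.Affine.CoordinateRing.smul]
      simp
    rw [← e1]
    refine (congrArg (evalPt V h) e2).trans ?_
    rw [map_mul, map_mul, e3, zero_mul]
  let g : K × K → V.Point := fun z =>
    if h : V.Nonsingular z.1 z.2 then .some _ _ h else 0
  let S : Set (K × K) := {z | z.1 ∈ N.roots.toFinset ∧
    z.2 ∈ (V.polynomial.map (evalRingHom z.1)).roots.toFinset}
  have hS : S.Finite := by
    have : S ⊆ ⋃ x ∈ N.roots.toFinset, (fun y => (x, y)) ''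
        ((V.polynomial.map (evalRingHom x)).roots.toFinset : Set K) := by
      rintro ⟨x, y⟩ ⟨h1, h2⟩
      simp only [Set.mem_iUnion]
      exact ⟨x, h1, y, h2, rfl⟩
    refine Set.Finite.subset ?_ this
    exact Set.Finite.biUnion (Finset.finite_toSet _) fun x _ => (Finset.finite_toSet _).image _
  refine ((hS.image g).union (Set.finite_singleton 0)).subset ?_
  rintro (_ | ⟨x, y, h⟩) hP
  · exact Or.inr rfl
  · left
    refine ⟨(x, y), ⟨?_, ?_⟩, by simp [g, h]⟩
    · rw [Multiset.mem_toFinset, mem_roots hN0]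
      exact hroot x y h (hP x y h rfl)
    · rw [Multiset.mem_toFinset, mem_roots (Monic.map _
        WeierstrassCurve.Affine.monic_polynomial).ne_zero]
      have := h.1
      rw [WeierstrassCurve.Affine.Equation] at this
      rw [IsRoot, ← this, eval_map, eval₂_evalRingHom]

variable {E E' E'' : WeierstrassCurve.Affine F}

lemma eventually_affine_ne_zero {a : E.CoordinateRing} (ha : a ≠ 0) :
    ∀ᶠ P : GeomPoint E in cofinite, ∃ x y, ∃ h, P = .some x y h ∧ evalGeom E h a ≠ 0 := by
  have ha' := (map_ne_zero_iff _ (WeierstrassCurve.Affine.CoordinateRing.map_injective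
    (W' := E) (algebraMap F (AlgebraicClosure F)).injective)).mpr ha
  refine (finite_zeros _ ha').subset ?_
  intro P hP x y h hxy
  by_contra h0
  exact hP ⟨x, y, h, hxy, h0⟩

lemma eventually_hasValueAt (u : E.FunctionField) :
    ∀ᶠ P : GeomPoint E in cofinite, ∃ c, HasValueAt E u P c := by
  obtain ⟨a, d, hd, rfl⟩ := IsFractionRing.div_surjective (A := E.CoordinateRing) u
  have hd0 := nonZeroDivisors.ne_zero hd
  filter_upwards [eventually_affine_ne_zero hd0] with P hP
  obtain ⟨x, y, h, rfl, hx⟩ := hP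
  exact ⟨_, (hasValueAt_coe h a).div (hasValueAt_coe h d) hx⟩

lemma eventually_ne_zero {u : E.FunctionField} (hu : u ≠ 0) :
    ∀ᶠ P : GeomPoint E in cofinite, ∀ c, HasValueAt E u P c → c ≠ 0 := by
  filter_upwards [eventually_hasValueAt u⁻¹] with P hP c hc h0
  obtain ⟨d, hd⟩ := hP
  have h1 := hc.mul hd
  rw [mul_inv_cancel₀ hu] at h1
  have h2 := hasValueAt_const hc 1
  simp only [map_one] at h2
  have := h1.unique h2
  rw [h0, zero_mul] at this
  exact zero_ne_one this

/-- A rational function that takes a value infinitely often is constant. -/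
lemma eventually_eq_or_ne (u : E.FunctionField) (c : AlgebraicClosure F) :
    (∀ᶠ P : GeomPoint E in cofinite, HasValueAt E u P c) ∨
      ∀ᶠ P : GeomPoint E in cofinite, ¬ HasValueAt E u P c := by
  obtain ⟨a, d, hd, rfl⟩ := IsFractionRing.div_surjective (A := E.CoordinateRing) u
  have hd0 := nonZeroDivisors.ne_zero hd
  let m := WeierstrassCurve.Affine.CoordinateRing.map E
    (algebraMap F (AlgebraicClosure F))
  let k : (geom E).CoordinateRing :=
    WeierstrassCurve.Affine.CoordinateRing.mk _ (C (C c))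
  have hk : ∀ x y, ∀ h : (geom E).Nonsingular x y,
      evalPt (geom E) h (m a - k * m d) =
        evalGeom E h a - c * evalGeom E h d := by
    intro x y h
    have : evalPt (geom E) h k = c := by
      refine (AdjoinRoot.evalEval_mk _ _).trans ?_
      simp
    rw [map_sub, map_mul, this]; rfl
  by_cases h0 : m a - k * m d = 0
  · left
    filter_upwards [eventually_affine_ne_zero hd0] with P hP
    obtain ⟨x, y, h, rfl, hx⟩ := hP
    have h1 := hk x y h
    rw [h0, map_zero, eq_comm, sub_eq_zero] at h1
    convert (hasValueAt_coe h a).div (hasValueAt_coe h d) hx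
    rw [h1, mul_div_cancel_right₀ _ hx]
  · right
    have h2 : ∀ᶠ P : GeomPoint E in cofinite, ¬ ∀ x y, ∀ h, P = .some x y h →
        evalPt (geom E) h (m a - k * m d) = 0 := by
      have := finite_zeros _ h0
      simpa only [Filter.eventually_cofinite, not_not] using this
    filter_upwards [h2, eventually_affine_ne_zero hd0] with P hP hd hc
    apply hP
    intro x y h hxy
    obtain ⟨x', y', h', e, hx⟩ := hd
    subst hxy
    obtain ⟨rfl, rfl⟩ := WeierstrassCurve.Affine.Point.some.inj e
    have h1 := hc.unique ((hasValueAt_coe h a).div (hasValueAt_coe h d) hx)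
    rw [hk, h1, div_mul_cancel₀ _ hx, sub_self]

instance [E.IsElliptic] : Infinite (GeomPoint E) := by
  let V := geom E
  have : ∀ x : AlgebraicClosure F, ∃ P : V.Point, ∃ y h, P = .some x y h := by
    intro x
    obtain ⟨y, hy⟩ := IsAlgClosed.exists_root (V.polynomial.map (evalRingHom x)) (by
      rw [Monic.degree_map WeierstrassCurve.Affine.monic_polynomial,
        WeierstrassCurve.Affine.degree_polynomial]
      decide)
    have h : V.Equation x y := by
      rw [WeierstrassCurve.Affine.Equation, ← hy, eval_map, eval₂_evalRingHom]
    exact ⟨_, y, WeierstrassCurve.Affine.equation_iff_nonsingular.mp h, rfl⟩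
  choose f y h hf using this
  refine Infinite.of_injective f fun a b hab => ?_
  rw [hf a, hf b] at hab
  exact (WeierstrassCurve.Affine.Point.some.inj hab).1

/-- A homomorphism that is constant outside finitely many points is zero. -/
lemma eq_zero_of_eventually_const [E.IsElliptic] {f : GeomPoint E →+ GeomPoint E'}
    {Q : GeomPoint E'} (h : ∀ᶠ P in cofinite, f P = Q) : f = 0 := by
  ext1 P
  have h' : ∀ᶠ R in cofinite, f (P + R) = Q := (add_right_injective P).tendsto_cofinite.eventually h
  obtain ⟨R, h1, h2⟩ := (h'.and h).exists
  rw [map_add, h2] at h1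
  simpa using h1

/-- An isogeny has finite fibres. -/
lemma Isogeny.tendsto_cofinite [E.IsElliptic] (φ : Isogeny E E') :
    Tendsto φ.toHom cofinite cofinite := by
  have hne : φ.toHom ≠ 0 := by
    intro h0
    obtain ⟨P, a, b, h, hP, -⟩ := φ.eventually_eq.exists
    rw [h0] at hP
    exact WeierstrassCurve.Affine.Point.some_ne_zero h hP.symm
  refine Tendsto.cofinite_of_finite_preimage_singleton fun Q => ?_
  suffices h : ∀ᶠ P in cofinite, φ.toHom P ≠ Q by
    simp only [Filter.eventually_cofinite, not_not] at h
    exact h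
  rcases Q with _ | ⟨a, b, hab⟩
  · filter_upwards [φ.eventually_eq] with P hP h0
    obtain ⟨a, b, h, hP, -⟩ := hP
    rw [hP] at h0
    exact WeierstrassCurve.Affine.Point.some_ne_zero h h0
  · rcases eventually_eq_or_ne φ.x a with hx | hx
    · rcases eventually_eq_or_ne φ.y b with hy | hy
      · refine (hne (eq_zero_of_eventually_const (Q := .some a b hab) ?_)).elim
        filter_upwards [φ.eventually_eq, hx, hy] with P hP hx hy
        obtain ⟨a', b', h, hP, h1, h2⟩ := hP
        obtain rfl := hx.unique h1
        obtain rfl := hy.unique h2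
        exact hP
      · filter_upwards [φ.eventually_eq, hy] with P hP hy h0
        obtain ⟨a', b', h, hP, h1, h2⟩ := hP
        rw [hP] at h0
        obtain ⟨rfl, rfl⟩ := WeierstrassCurve.Affine.Point.some.inj h0
        exact hy h2
    · filter_upwards [φ.eventually_eq, hx] with P hP hx h0
      obtain ⟨a', b', h, hP, h1, h2⟩ := hP
      rw [hP] at h0
      obtain ⟨rfl, rfl⟩ := WeierstrassCurve.Affine.Point.some.inj h0
      exact hx h1

lemma isHomOver_id (E : WeierstrassCurve.Affine F) : IsHomOver E E (AddMonoidHom.id (GeomPoint E)) := by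
  let m := WeierstrassCurve.Affine.CoordinateRing.mk E
  refine Or.inr ⟨⟨⟨_, algebraMap _ _ (m (C X)), algebraMap _ _ (m Y)⟩, ?_⟩, rfl⟩
  filter_upwards [eventually_affine_ne_zero (E := E) one_ne_zero] with P hP
  obtain ⟨x, y, h, rfl, -⟩ := hP
  refine ⟨x, y, h, rfl, ?_, ?_⟩
  · have := hasValueAt_coe h (m (C X))
    rw [evalGeom_mk] at this
    simpa only [map_C, coe_mapRingHom, map_X, evalEval_C, eval_X] using this
  · have := hasValueAt_coe h (m Y)
    rw [evalGeom_mk] at this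
    simpa only [map_X, evalEval_X] using this

lemma IsHomOver.neg {f : GeomPoint E →+ GeomPoint E'} (hf : IsHomOver E E' f) :
    IsHomOver E E' (-f) := by
  rcases hf with rfl | ⟨φ, rfl⟩
  · exact Or.inl neg_zero
  refine Or.inr ⟨⟨⟨_, φ.x, -φ.y - algebraMap F _ E'.a₁ * φ.x - algebraMap F _ E'.a₃⟩, ?_⟩, rfl⟩
  filter_upwards [φ.eventually_eq] with P hP
  obtain ⟨a, b, h, hP, h1, h2⟩ := hP
  refine ⟨a, _, _, by
    rw [AddMonoidHom.neg_apply, hP, WeierstrassCurve.Affine.Point.neg_some], h1, ?_⟩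
  exact (h2.neg.sub ((hasValueAt_const h1 _).mul h1)).sub (hasValueAt_const h1 _)

lemma IsHomOver.comp [E.IsElliptic] {g : GeomPoint E' →+ GeomPoint E''}
    {f : GeomPoint E →+ GeomPoint E'} (hg : IsHomOver E' E'' g) (hf : IsHomOver E E' f) :
    IsHomOver E E'' (g.comp f) := by
  rcases hf with rfl | ⟨φ, rfl⟩
  · exact Or.inl (AddMonoidHom.comp_zero g)
  rcases hg with rfl | ⟨ψ, rfl⟩
  · exact Or.inl (AddMonoidHom.zero_comp _)
  have key : ∀ w : E'.FunctionField, ∃ w' : E.FunctionField,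
      ∀ᶠ P in cofinite, ∀ c, HasValueAt E' w (φ.toHom P) c → HasValueAt E w' P c := by
    intro w
    obtain ⟨a, d, hd, rfl⟩ := IsFractionRing.div_surjective (A := E'.CoordinateRing) w
    have hd0 := nonZeroDivisors.ne_zero hd
    obtain ⟨A, rfl⟩ := AdjoinRoot.mk_surjective a
    obtain ⟨D, rfl⟩ := AdjoinRoot.mk_surjective d
    refine ⟨aevalAeval φ.x φ.y A / aevalAeval φ.x φ.y D, ?_⟩
    filter_upwards [φ.eventually_eq,
      φ.tendsto_cofinite.eventually (eventually_affine_ne_zero hd0)] with P hP hD c hc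
    obtain ⟨a, b, h, hP, h1, h2⟩ := hP
    obtain ⟨a', b', h', hP', hne⟩ := hD
    rw [hP] at hP' hc
    obtain ⟨rfl, rfl⟩ := WeierstrassCurve.Affine.Point.some.inj hP'
    have h3 := hc.unique ((hasValueAt_coe h _).div (hasValueAt_coe h _) hne)
    rw [evalGeom_mk] at hne
    rw [h3, evalGeom_mk, evalGeom_mk]
    exact (h1.poly h2 A).div (h1.poly h2 D) hne
  obtain ⟨x', hx'⟩ := key ψ.x
  obtain ⟨y', hy'⟩ := key ψ.y
  refine Or.inr ⟨⟨⟨_, x', y'⟩, ?_⟩, rfl⟩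
  filter_upwards [hx', hy', φ.tendsto_cofinite.eventually ψ.eventually_eq] with P hx hy hP
  obtain ⟨a, b, h, hP, h1, h2⟩ := hP
  exact ⟨a, b, h, hP, hx _ h1, hy _ h2⟩

lemma IsHomOver.add [E.IsElliptic] {f g : GeomPoint E →+ GeomPoint E'}
    (hf : IsHomOver E E' f) (hg : IsHomOver E E' g) : IsHomOver E E' (f + g) := by
  classical
  rcases hf with rfl | ⟨φ, rfl⟩
  · rwa [zero_add]
  rcases hg with rfl | ⟨ψ, rfl⟩
  · rw [add_zero]; exact Or.inr ⟨φ, rfl⟩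
  let V : WeierstrassCurve.Affine (AlgebraicClosure F) := geom E'
  let k : F → E.FunctionField := algebraMap F _
  -- a rational function that eventually gives the slope gives the sum
  have key : ∀ s : E.FunctionField, (∀ᶠ P in cofinite, ∀ a b a' b',
      ∀ h : V.Nonsingular a b, ∀ h' : V.Nonsingular a' b',
      φ.toHom P = .some a b h → ψ.toHom P = .some a' b' h' →
      HasValueAt E φ.x P a → HasValueAt E φ.y P b →
      HasValueAt E ψ.x P a' → HasValueAt E ψ.y P b' →
      ¬ (a = a' ∧ b = V.negY a' b') ∧
        HasValueAt E s P (V.slope a a' b b')) →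
      IsHomOver E E' (φ.toHom + ψ.toHom) := by
    intro s hs
    let X₃ := s ^ 2 + k E'.a₁ * s - k E'.a₂ - φ.x - ψ.x
    refine Or.inr ⟨⟨⟨_, X₃, -(s * (X₃ - φ.x) + φ.y) - k E'.a₁ * X₃ - k E'.a₃⟩, ?_⟩, rfl⟩
    filter_upwards [hs, φ.eventually_eq, ψ.eventually_eq] with P hs h1 h2
    obtain ⟨a, b, h, hP, hx, hy⟩ := h1
    obtain ⟨a', b', h', hP', hx', hy'⟩ := h2
    obtain ⟨hne, hs⟩ := hs a b a' b' h h' hP hP' hx hy hx' hy'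
    have hk := hasValueAt_const hx
    have hX : HasValueAt E X₃ P (V.addX a a' (V.slope a a' b b')) := by
      have hs2 := hs.mul hs
      rw [← pow_two, ← pow_two] at hs2
      exact (((hs2.add ((hk _).mul hs)).sub (hk _)).sub hx).sub hx'
    refine ⟨_, _, _, by
      rw [AddMonoidHom.add_apply, hP, hP', WeierstrassCurve.Affine.Point.add_some hne], hX, ?_⟩
    exact ((((hs.mul (hX.sub hx)).add hy).neg).sub ((hk _).mul hX)).sub (hk _)
  by_cases hxx : φ.x = ψ.x
  · let w := φ.y - (-ψ.y - k E'.a₁ * ψ.x - k E'.a₃)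
    by_cases hw : w = 0
    · left
      refine eq_zero_of_eventually_const (Q := 0) ?_
      filter_upwards [φ.eventually_eq, ψ.eventually_eq] with P h1 h2
      obtain ⟨a, b, h, hP, hx, hy⟩ := h1
      obtain ⟨a', b', h', hP', hx', hy'⟩ := h2
      have hk := hasValueAt_const hx
      rw [AddMonoidHom.add_apply, hP, hP']
      refine WeierstrassCurve.Affine.Point.add_of_Y_eq ((hxx ▸ hx).unique hx') ?_
      rw [sub_eq_zero] at hw
      rw [hw] at hy
      exact hy.unique ((hy'.neg.sub ((hk _).mul hx')).sub (hk _))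
    · refine key ((3 * φ.x ^ 2 + 2 * k E'.a₂ * φ.x + k E'.a₄ - k E'.a₁ * φ.y) /
        (φ.y - (-φ.y - k E'.a₁ * φ.x - k E'.a₃))) ?_
      filter_upwards [eventually_ne_zero hw] with P hw a b a' b' h h' hP hP' hx hy hx' hy'
      have hk := hasValueAt_const hx
      have ha : a = a' := (hxx ▸ hx).unique hx'
      have hb : b ≠ V.negY a' b' := by
        have := hw _ (hy.sub ((hy'.neg.sub ((hk E'.a₁).mul hx')).sub (hk E'.a₃)))
        exact sub_ne_zero.mp this
      have hb' : b = b' := WeierstrassCurve.Affine.Y_eq_of_Y_ne h.1 h'.1 ha hb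
      refine ⟨fun H => hb H.2, ?_⟩
      rw [WeierstrassCurve.Affine.slope_of_Y_ne ha hb]
      have h3 : HasValueAt E (3 : E.FunctionField) P 3 := by
        simpa only [map_ofNat] using hk 3
      have h2 : HasValueAt E (2 : E.FunctionField) P 2 := by
        simpa only [map_ofNat] using hk 2
      have hx2 := hx.mul hx
      rw [← pow_two, ← pow_two] at hx2
      refine HasValueAt.div
        ((((h3.mul hx2).add ((h2.mul (hk _)).mul hx)).add (hk _)).sub ((hk _).mul hy))
        (hy.sub ((hy.neg.sub ((hk _).mul hx)).sub (hk _))) ?_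
      rw [← ha, ← hb'] at hb
      exact sub_ne_zero.mpr hb
  · refine key ((φ.y - ψ.y) / (φ.x - ψ.x)) ?_
    filter_upwards [eventually_ne_zero (sub_ne_zero.mpr hxx)] with
      P hne a b a' b' h h' hP hP' hx hy hx' hy'
    have ha := hne _ (hx.sub hx')
    refine ⟨fun H => ha (sub_eq_zero.mpr H.1), ?_⟩
    rw [WeierstrassCurve.Affine.slope_of_X_ne (sub_ne_zero.mp ha)]
    exact (hy.sub hy').div (hx.sub hx') ha

end finiteness

/-- The ring `End_F(E)` of endomorphisms of `E` defined over `F`, with pointwise addition and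
composition, as a subring of the endomorphism ring of the group `E(F̄)`. -/
def EndOver (E : WeierstrassCurve.Affine F) [E.IsElliptic] : Subring (AddMonoid.End (GeomPoint E)) where
  carrier := {f | IsHomOver E E f}
  zero_mem' := Or.inl rfl
  one_mem' := isHomOver_id E
  add_mem' := IsHomOver.add
  mul_mem' := IsHomOver.comp
  neg_mem' := IsHomOver.neg

/-- An isogeny over `F` is horizontal if `End_F(E)` and `End_F(E')` are isomorphic rings. -/
def Isogeny.IsHorizontal {E E' : WeierstrassCurve.Affine F} [E.IsElliptic] [E'.IsElliptic]
    (_φ : Isogeny E E') : Prop :=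
  Nonempty (EndOver E ≃+* EndOver E')

/-- A curve over a field of characteristic `p > 0` is supersingular if it has no geometric point
of order `p`. -/
def IsSupersingular (p : ℕ) [CharP F p] (E : WeierstrassCurve.Affine F) : Prop :=
  ∀ P : GeomPoint E, p • P = 0 → P = 0

end

end IsogenyGraph

/-! For a supersingular curve over 𝔽_p with p > 3, the Frobenius π satisfies π² = -p, and the
endomorphisms over 𝔽_p form a ring that contains ℤ[π] with index at most two (`exists_isQuadOrder`).
Up to isomorphism such a ring is determined by whether 1 + π is divisible by two in it, and this
happens exactly when π fixes the 2-torsion pointwise (`exists_two_mul_eq_iff`). An isogeny over 𝔽_p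
whose kernel has no point of order two identifies the 2-torsion groups compatibly with Frobenius, so
it is horizontal (`Isogeny.isHorizontal_of_ker`). A non-horizontal isogeny therefore kills a point
of order two, and this makes its degree even (`Isogeny.two_dvd_degree`).

Degrees are measured by `hdeg`, the height of the x-coordinate as a rational function of x over the
algebraic closure. Heights multiply under composition. The symmetric functions of x(P + Q) and x(P -
Q) are quadratic forms without common zero in those of x(P) and x(Q), which yields the parallelogram
law. So `hdeg` is a multiplicative positive definite quadratic form on the endomorphism ring;
polarization produces traces, characteristic equations (`IsNormForm.mul_self`) and the bound t² ≤ 4p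
for the trace t of π.

Supersingularity enters through V = t - π. As πV = p, the map V is injective on points, hence
inseparable; so is π, hence so is their sum t, and p divides t² (`dvd_trace`). With the bound, t =
0.

To halve 1 + π when the 2-torsion is rational (`exists_half`), one uses that x - eᵢ becomes a square
at P + π(P), as in a 2-descent: these square roots express the half as a pair of rational functions
over 𝔽_p.

For the parity, translation by a point of order two acts on x as an involution with two fixed
points, and a rational function invariant under it has even height. The degree [F(E) : F(x)] = 2
relates heights to field degrees. -/

namespace IsogenyGraph

noncomputable section

open Polynomial Filter
open scoped Polynomial.Bivariate

universe u

/-! ### Heights of tuples of polynomials in one variable. -/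

section heights

variable {k : Type*} [Field k] {ι κ : Type*}

/-- A tuple of polynomials of height `m`: the degrees are at most `m`, and neither at a point of
the affine line nor at infinity do all members vanish. -/
structure IsPrim (v : ι → k[X]) (m : ℕ) : Prop where
  natDegree_le : ∀ i, (v i).natDegree ≤ m
  coeff_ne : ∃ i, (v i).coeff m ≠ 0
  eval_ne : ∀ z, ∃ i, (v i).eval z ≠ 0

lemma IsPrim.span_eq_top [IsAlgClosed k] {v : ι → k[X]} {m : ℕ} (hv : IsPrim v m) :
    Ideal.span (Set.range v) = ⊤ := by
  obtain ⟨g, hg⟩ := (IsPrincipalIdealRing.principal (Ideal.span (Set.range v))).principal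
  have hdvd : ∀ i, g ∣ v i := fun i => by
    have : v i ∈ Ideal.span (Set.range v) := Ideal.subset_span ⟨i, rfl⟩
    rw [hg] at this
    exact Ideal.mem_span_singleton.mp this
  have hunit : IsUnit g := by
    by_contra h
    have hdeg : g.degree ≠ 0 := by
      intro h0
      exact h (isUnit_iff_degree_eq_zero.mpr h0)
    obtain ⟨z, hz⟩ := IsAlgClosed.exists_root g hdeg
    obtain ⟨i, hi⟩ := hv.eval_ne z
    exact hi (eval_eq_zero_of_dvd_of_eval_eq_zero (hdvd i) hz)
  rw [hg]
  exact Ideal.span_singleton_eq_top.mpr hunit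

/-- The members of `v` generate the unit ideal, and `v i` divides `v j * w i` for every `j`; a
combination with sum 1 gives the claim. This replaces gcd arguments for tuples. -/
lemma IsPrim.dvd_of_proportional [IsAlgClosed k] {v w : ι → k[X]} {m : ℕ} (hv : IsPrim v m)
    (h : ∀ i j, v i * w j = v j * w i) (i : ι) : v i ∣ w i := by
  have key : ∀ r ∈ Ideal.span (Set.range v), v i ∣ r * w i := by
    intro r hr
    induction hr using Submodule.span_induction with
    | mem x hx =>
      obtain ⟨j, rfl⟩ := hx
      exact ⟨w j, (h i j).symm⟩
    | zero => simp
    | add x y _ _ hx hy => rw [add_mul]; exact dvd_add hx hy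
    | smul a x _ hx => rw [smul_eq_mul, mul_assoc]; exact hx.mul_left a
  simpa using key 1 (hv.span_eq_top ▸ Submodule.mem_top)

lemma IsPrim.le_of_proportional [IsAlgClosed k] {v w : ι → k[X]} {m m' : ℕ} (hv : IsPrim v m)
    (hw : IsPrim w m') (h : ∀ i j, v i * w j = v j * w i) : m ≤ m' := by
  obtain ⟨i, hi⟩ := hv.coeff_ne
  have h1 := hv.dvd_of_proportional h i
  have h2 := hw.dvd_of_proportional (w := v) (fun i j => by rw [mul_comm, h j i, mul_comm]) i
  have hv0 : v i ≠ 0 := by rintro h0; simp [h0] at hi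
  have hw0 : w i ≠ 0 := by rintro h0; rw [h0] at h2; exact hv0 (zero_dvd_iff.mp h2)
  calc m ≤ (v i).natDegree := le_natDegree_of_ne_zero hi
    _ ≤ (w i).natDegree := natDegree_le_of_dvd h1 hw0
    _ ≤ m' := hw.natDegree_le i

/-- Proportional primitive tuples have the same height. -/
lemma IsPrim.height_eq_of_proportional [IsAlgClosed k] {v w : ι → k[X]} {m m' : ℕ}
    (hv : IsPrim v m) (hw : IsPrim w m') (h : ∀ i j, v i * w j = v j * w i) : m = m' :=
  le_antisymm (hv.le_of_proportional hw h)
    (hw.le_of_proportional hv fun i j => by rw [mul_comm, h j i, mul_comm])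

/-- The coefficients of the product of two linear forms. -/
def sym2 {R : Type*} [CommRing R] (v w : Fin 2 → R) : Fin 3 → R :=
  ![v 0 * w 0, v 0 * w 1 + v 1 * w 0, v 1 * w 1]

lemma sym2_ne_zero {R : Type*} [CommRing R] [IsDomain R] {v w : Fin 2 → R} (hv : ∃ i, v i ≠ 0)
    (hw : ∃ i, w i ≠ 0) : ∃ i, sym2 v w i ≠ 0 := by
  by_contra! h
  have h0 : v 0 * w 0 = 0 := h 0
  have h1 : v 0 * w 1 + v 1 * w 0 = 0 := h 1
  have h2 : v 1 * w 1 = 0 := h 2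
  obtain ⟨i, hi⟩ := hv
  obtain ⟨j, hj⟩ := hw
  rw [mul_eq_zero] at h0 h2
  rcases h0 with h0 | h0 <;> rcases h2 with h2 | h2 <;> rw [h0, h2] at h1 <;>
    fin_cases i <;> fin_cases j <;> simp_all

/-- Evaluation at a point and taking the coefficient at the height (the value at infinity) both
commute with `sym2`, so everything reduces to `sym2_ne_zero` over the field. -/
lemma IsPrim.sym2 {v w : Fin 2 → k[X]} {m m' : ℕ} (hv : IsPrim v m) (hw : IsPrim w m') :
    IsPrim (sym2 v w) (m + m') where
  natDegree_le i := by
    have hm : ∀ i j, (v i * w j).natDegree ≤ m + m' := fun i j =>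
      natDegree_mul_le_of_le (hv.natDegree_le i) (hw.natDegree_le j)
    fin_cases i
    · exact hm 0 0
    · exact natDegree_add_le_of_degree_le (hm 0 1) (hm 1 0)
    · exact hm 1 1
  coeff_ne := by
    obtain ⟨i, hi⟩ := sym2_ne_zero hv.coeff_ne hw.coeff_ne
    have hm : ∀ i j, (v i * w j).coeff (m + m') = (v i).coeff m * (w j).coeff m' := fun i j =>
      coeff_mul_add_eq_of_natDegree_le (hv.natDegree_le i) (hw.natDegree_le j)
    refine ⟨i, ?_⟩
    fin_cases i <;> simpa [IsogenyGraph.sym2, hm] using hi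
  eval_ne z := by
    obtain ⟨i, hi⟩ := sym2_ne_zero (hv.eval_ne z) (hw.eval_ne z)
    refine ⟨i, ?_⟩
    fin_cases i <;> simpa [IsogenyGraph.sym2] using hi

section forms

open MvPolynomial (IsHomogeneous)

lemma natDegree_prod_pow_le {v : ι → k[X]} {m : ℕ} (hv : ∀ i, (v i).natDegree ≤ m)
    (s : Finset ι) (e : ι → ℕ) :
    (∏ i ∈ s, v i ^ e i).natDegree ≤ (∑ i ∈ s, e i) * m := by
  refine (natDegree_prod_le _ _).trans ?_
  rw [Finset.sum_mul]
  exact Finset.sum_le_sum fun i _ => natDegree_pow_le_of_le _ (hv i)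

lemma coeff_prod_pow {v : ι → k[X]} {m : ℕ} (hv : ∀ i, (v i).natDegree ≤ m)
    (s : Finset ι) (e : ι → ℕ) :
    (∏ i ∈ s, v i ^ e i).coeff ((∑ i ∈ s, e i) * m) = ∏ i ∈ s, (v i).coeff m ^ e i := by
  classical
  induction s using Finset.induction_on with
  | empty => simp
  | insert a s ha ih =>
    rw [Finset.prod_insert ha, Finset.sum_insert ha, Finset.prod_insert ha, add_mul,
      coeff_mul_add_eq_of_natDegree_le (natDegree_pow_le_of_le _ (hv a))
        (natDegree_prod_pow_le hv s e), coeff_pow_of_natDegree_le (hv a), ih]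

/-- Each monomial of degree `N` in the `v i` has degree at most `N * m`, and its coefficient there
is the same monomial in the coefficients at `m`. This is evaluation at infinity. -/
lemma aeval_form {v : ι → k[X]} {m N : ℕ} (hv : ∀ i, (v i).natDegree ≤ m)
    {q : MvPolynomial ι k} (hq : q.IsHomogeneous N) :
    (MvPolynomial.aeval v q).natDegree ≤ N * m ∧
      (MvPolynomial.aeval v q).coeff (N * m) = MvPolynomial.eval (fun i => (v i).coeff m) q := by
  have hs : ∀ s ∈ q.support, ∑ i ∈ s.support, s i = N := fun s hs => by
    have := hq (MvPolynomial.mem_support_iff.mp hs)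
    simpa [Finsupp.weight_apply, Finsupp.sum] using this
  rw [MvPolynomial.aeval_def, MvPolynomial.eval₂_eq, MvPolynomial.eval_eq]
  constructor
  · refine natDegree_sum_le_of_forall_le _ _ fun s h => ?_
    refine (natDegree_C_mul_le _ _).trans ?_
    rw [← hs s h]
    exact natDegree_prod_pow_le hv _ _
  · rw [finsetSum_coeff]
    refine Finset.sum_congr rfl fun s h => ?_
    rw [algebraMap_eq, coeff_C_mul, ← coeff_prod_pow hv, hs s h]

lemma eval_aeval_form (v : ι → k[X]) (q : MvPolynomial ι k) (z : k) :
    (MvPolynomial.aeval v q).eval z = MvPolynomial.eval (fun i => (v i).eval z) q := by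
  rw [MvPolynomial.aeval_def, MvPolynomial.eval₂_eq, MvPolynomial.eval_eq, eval_finsetSum]
  simp [eval_prod]

/-- Forms of degree `N` without a common zero multiply heights by `N`. -/
lemma IsPrim.forms {v : ι → k[X]} {m N : ℕ} (hv : IsPrim v m) {q : κ → MvPolynomial ι k}
    (hq : ∀ j, (q j).IsHomogeneous N)
    (hne : ∀ x : ι → k, (∃ i, x i ≠ 0) → ∃ j, MvPolynomial.eval x (q j) ≠ 0) :
    IsPrim (fun j => MvPolynomial.aeval v (q j)) (N * m) where
  natDegree_le j := (aeval_form hv.natDegree_le (hq j)).1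
  coeff_ne := by
    obtain ⟨j, hj⟩ := hne _ hv.coeff_ne
    exact ⟨j, by rwa [(aeval_form hv.natDegree_le (hq j)).2]⟩
  eval_ne z := by
    obtain ⟨j, hj⟩ := hne _ (hv.eval_ne z)
    exact ⟨j, by rwa [eval_aeval_form]⟩

lemma eval_homogenize_eq_sum (p : k[X]) (n : ℕ) (x : Fin 2 → k) :
    MvPolynomial.eval x (p.homogenize n) =
      ∑ ij ∈ Finset.HasAntidiagonal.antidiagonal n, p.coeff ij.1 * (x 0 ^ ij.1 * x 1 ^ ij.2) := by
  rw [homogenize, map_sum]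
  refine Finset.sum_congr rfl fun ij _ => ?_
  rw [MvPolynomial.eval_monomial, Finsupp.prod_fintype _ _ (by simp)]
  simp [Fin.prod_univ_two]

lemma eval_homogenize_smul (p : k[X]) (n : ℕ) (x : Fin 2 → k) (c : k) :
    MvPolynomial.eval (fun i => c * x i) (p.homogenize n) =
      c ^ n * MvPolynomial.eval x (p.homogenize n) := by
  rw [eval_homogenize_eq_sum, eval_homogenize_eq_sum, Finset.mul_sum]
  refine Finset.sum_congr rfl fun ij h => ?_
  rw [← Finset.HasAntidiagonal.mem_antidiagonal.mp h, pow_add]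
  ring

lemma eval_homogenize_of_one {p : k[X]} {n : ℕ} (hp : p.natDegree ≤ n) (z : k) :
    MvPolynomial.eval ![z, 1] (p.homogenize n) = p.eval z := by
  rw [eval_homogenize hp _ (by simp)]
  simp

lemma eval_homogenize_of_zero (p : k[X]) (n : ℕ) (z : k) :
    MvPolynomial.eval ![z, 0] (p.homogenize n) = p.coeff n * z ^ n := by
  rw [eval_homogenize_eq_sum, Finset.sum_eq_single (n, 0)]
  · simp
  · rintro ⟨i, j⟩ h hne
    have hj : j ≠ 0 := by rintro rfl; simp at h; simp [h] at hne
    simp [hj]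
  · simp

/-- The height of a composition of rational functions is the product of the heights. -/
lemma IsPrim.homogenize {u v : Fin 2 → k[X]} {m N : ℕ} (hu : IsPrim u N) (hv : IsPrim v m) :
    IsPrim (fun j => MvPolynomial.aeval v ((u j).homogenize N)) (N * m) := by
  refine hv.forms (fun j => isHomogeneous_homogenize _) fun x hx => ?_
  -- The point at infinity needs the coefficient condition on `u`; every other point is scaled to
  -- the affine line.
  by_cases h1 : x 1 = 0
  · obtain ⟨j, hj⟩ := hu.coeff_ne
    have h0 : x 0 ≠ 0 := by
      obtain ⟨i, hi⟩ := hx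
      fin_cases i
      · exact hi
      · exact absurd h1 hi
    refine ⟨j, ?_⟩
    have e : x = ![x 0, 0] := by ext i; fin_cases i <;> simp [h1]
    rw [e, eval_homogenize_of_zero]
    exact mul_ne_zero hj (pow_ne_zero _ h0)
  · obtain ⟨j, hj⟩ := hu.eval_ne (x 0 / x 1)
    refine ⟨j, ?_⟩
    rw [eval_homogenize (hu.natDegree_le j) _ h1]
    exact mul_ne_zero hj (pow_ne_zero _ h1)

end forms

end heights

end

end IsogenyGraph

namespace IsogenyGraph

noncomputable section

open Polynomial Filter
open scoped Polynomial.Bivariate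

universe u

/-! ### The x-coordinates of the sum and the difference of two points. -/

section points

open WeierstrassCurve WeierstrassCurve.Affine

variable {k : Type*} [Field k]

lemma addSubMap_eval_cons (W : WeierstrassCurve k) (s t u : k) :
    (fun i => MvPolynomial.eval ![s, t, u] (addSubMap W i)) =
      ![s ^ 2 - W.b₄ * s * u - W.b₆ * t * u - W.b₈ * u ^ 2,
        2 * t * s + W.b₂ * s * u + W.b₄ * t * u + W.b₆ * u ^ 2,
        t ^ 2 - 4 * s * u] := by
  ext i
  fin_cases i <;> simp [addSubMap]

variable [DecidableEq k] {W : WeierstrassCurve.Affine k}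

/-- The sum of the `x`-coordinates of the sum and the difference of two points. -/
lemma addX_add_addX {x₁ x₂ y₁ y₂ : k} (h₁ : W.Equation x₁ y₁) (h₂ : W.Equation x₂ y₂)
    (hx : x₁ ≠ x₂) :
    (x₁ - x₂) ^ 2 * (W.addX x₁ x₂ (W.slope x₁ x₂ y₁ y₂) +
      W.addX x₁ x₂ (W.slope x₁ x₂ y₁ (W.negY x₂ y₂))) =
      2 * (x₁ + x₂) * (x₁ * x₂) + W.b₂ * (x₁ * x₂) + W.b₄ * (x₁ + x₂) + W.b₆ := by
  rw [equation_iff] at h₁ h₂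
  rw [slope_of_X_ne hx, slope_of_X_ne hx]
  have hx' : x₁ - x₂ ≠ 0 := sub_ne_zero.mpr hx
  simp only [addX, negY, b₂, b₄, b₆]
  field_simp
  linear_combination 2 * h₁ + 2 * h₂

lemma addX_mul_addX {x₁ x₂ y₁ y₂ : k} (h₁ : W.Equation x₁ y₁) (h₂ : W.Equation x₂ y₂)
    (hx : x₁ ≠ x₂) :
    (x₁ - x₂) ^ 2 * (W.addX x₁ x₂ (W.slope x₁ x₂ y₁ y₂) *
      W.addX x₁ x₂ (W.slope x₁ x₂ y₁ (W.negY x₂ y₂))) =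
      (x₁ * x₂) ^ 2 - W.b₄ * (x₁ * x₂) - W.b₆ * (x₁ + x₂) - W.b₈ := by
  rw [equation_iff] at h₁ h₂
  rw [slope_of_X_ne hx, slope_of_X_ne hx]
  have hx' : x₁ - x₂ ≠ 0 := sub_ne_zero.mpr hx
  simp only [addX, negY, b₄, b₆, b₈]
  field_simp
  grind

lemma addX_self {x y : k} (h : W.Equation x y) (hy : y ≠ W.negY x y) :
    (4 * x ^ 3 + W.b₂ * x ^ 2 + 2 * W.b₄ * x + W.b₆) * W.addX x x (W.slope x x y y) =
      x ^ 4 - W.b₄ * x ^ 2 - 2 * W.b₆ * x - W.b₈ := by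
  rw [equation_iff] at h
  rw [slope_of_Y_ne rfl hy]
  have hy' : y - W.negY x y ≠ 0 := sub_ne_zero.mpr hy
  have e : 4 * x ^ 3 + W.b₂ * x ^ 2 + 2 * W.b₄ * x + W.b₆ = (y - W.negY x y) ^ 2 := by
    simp only [b₂, b₄, b₆, negY]
    linear_combination -4 * h
  rw [e]
  simp only [addX, negY, b₄, b₆, b₈] at hy' ⊢
  field_simp
  grind

lemma addSubMap_sym2x_self (A : W.Point) :
    ∃ c : k, (fun i => MvPolynomial.eval (A.sym2x A) (addSubMap W i)) =
      c • (A + A).sym2x (A - A) := by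
  rw [sub_self]
  rcases A with _ | ⟨x, y, h⟩
  · refine ⟨1, ?_⟩
    rw [← Point.zero_def, add_zero, Point.sym2x_zero_zero, addSubMap_eval_cons]
    ext i
    fin_cases i <;> simp
  · rw [Point.sym2x_some_some, addSubMap_eval_cons]
    by_cases hy : y = W.negY x y
    · refine ⟨(x * x) ^ 2 - W.b₄ * (x * x) * 1 - W.b₆ * (x + x) * 1 - W.b₈ * 1 ^ 2, ?_⟩
      · rw [Point.add_self_of_Y_eq hy, Point.sym2x_zero_zero]
        have h1 := (equation_iff ..).mp h.1
        rw [negY] at hy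
        ext i
        fin_cases i
        · simp
        · simp [b₂, b₄, b₆]
          linear_combination -4 * h1 + (2 * y + W.a₁ * x + W.a₃) * hy
        · simp
          ring
    · refine ⟨4 * x ^ 3 + W.b₂ * x ^ 2 + 2 * W.b₄ * x + W.b₆, ?_⟩
      rw [Point.add_self_of_Y_ne hy, Point.sym2x_some_zero]
      ext i
      fin_cases i
      · have := addX_self h.1 hy
        simp only [Fin.zero_eta, Matrix.cons_val_zero, Pi.smul_apply, smul_eq_mul, this]
        ring
      · simp
        ring
      · simp
        ring

/-- The quadratic map `addSubMap` describes the `x`-coordinates of the sum and the difference of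
two points in terms of those of the points. -/
theorem addSubMap_sym2x (A B : W.Point) :
    ∃ c : k, (fun i => MvPolynomial.eval (A.sym2x B) (addSubMap W i)) =
      c • (A + B).sym2x (A - B) := by
  by_cases hAB : A = B
  · subst hAB
    exact addSubMap_sym2x_self A
  -- Replacing B by -B swaps sum and difference, and `sym2x` is symmetric, so this reduces to the
  -- duplication case.
  by_cases hAB' : A = -B
  · obtain ⟨c, hc⟩ := addSubMap_sym2x_self A
    refine ⟨c, ?_⟩
    have e : B = -A := by rw [hAB', neg_neg]
    rw [e, Point.sym2x_neg_right, hc, sub_neg_eq_add, ← sub_eq_add_neg, Point.sym2x_comm]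
  rcases A with _ | ⟨x₁, y₁, h₁⟩
  · refine ⟨1, ?_⟩
    rw [← Point.zero_def, zero_add, zero_sub, Point.sym2x_neg_right]
    rcases B with _ | ⟨x₂, y₂, h₂⟩
    · exact absurd rfl hAB
    · rw [Point.sym2x_zero_some, Point.sym2x_some_some, addSubMap_eval_cons]
      ext i
      fin_cases i <;> simp <;> ring
  rcases B with _ | ⟨x₂, y₂, h₂⟩
  · refine ⟨1, ?_⟩
    rw [← Point.zero_def, add_zero, sub_zero, Point.sym2x_some_zero, Point.sym2x_some_some,
      addSubMap_eval_cons]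
    ext i
    fin_cases i <;> simp <;> ring
  have hx : x₁ ≠ x₂ := fun hx => by
    rcases Point.X_eq_iff.mp hx with h | h
    · exact hAB h
    · exact hAB' h
  -- The scalar is read off from the third form: t² - 4su = (x₁ + x₂)² - 4x₁x₂.
  refine ⟨(x₁ - x₂) ^ 2, ?_⟩
  rw [sub_eq_add_neg (Point.some x₁ y₁ h₁), Point.neg_some, Point.add_of_X_ne hx,
    Point.add_of_X_ne hx,
    Point.sym2x_some_some, Point.sym2x_some_some, addSubMap_eval_cons]
  ext i
  fin_cases i
  · simpa using (addX_mul_addX h₁.1 h₂.1 hx).symm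
  · simpa using (addX_add_addX h₁.1 h₂.1 hx).symm
  · simp
    ring

end points

end

end IsogenyGraph

namespace IsogenyGraph

noncomputable section

open Polynomial Filter
open scoped Polynomial.Bivariate

universe u

variable {F : Type u} [Field F]

/-! ### Representing homomorphisms by their x-coordinates. -/

section sections

lemma exists_section (E : WeierstrassCurve.Affine F) [E.IsElliptic] :
    ∃ s : AlgebraicClosure F → GeomPoint E, Function.Injective s ∧
      ∀ x, ∃ y h, s x = .some x y h := by
  let V := geom E
  have : ∀ x : AlgebraicClosure F, ∃ P : V.Point, ∃ y h, P = .some x y h := by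
    intro x
    obtain ⟨y, hy⟩ := IsAlgClosed.exists_root (V.polynomial.map (evalRingHom x)) (by
      rw [Monic.degree_map WeierstrassCurve.Affine.monic_polynomial,
        WeierstrassCurve.Affine.degree_polynomial]
      decide)
    have h : V.Equation x y := by
      rw [WeierstrassCurve.Affine.Equation, ← hy, eval_map, eval₂_evalRingHom]
    exact ⟨_, y, WeierstrassCurve.Affine.equation_iff_nonsingular.mp h, rfl⟩
  choose f y h hf using this
  refine ⟨f, fun a b hab => ?_, fun x => ⟨y x, h x, hf x⟩⟩
  rw [hf a, hf b] at hab
  exact (WeierstrassCurve.Affine.Point.some.inj hab).1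

variable {E : WeierstrassCurve.Affine F} [E.IsElliptic]

/-- A property of the `x`-coordinates of almost all points holds for almost all elements. -/
lemma eventually_x {Q : AlgebraicClosure F → Prop}
    (hQ : ∀ᶠ P : GeomPoint E in cofinite, ∃ x y, ∃ h, P = .some x y h ∧ Q x) :
    ∀ᶠ x in cofinite, Q x := by
  obtain ⟨s, hs, hs'⟩ := exists_section E
  filter_upwards [hs.tendsto_cofinite.eventually hQ] with x hx
  obtain ⟨x', y, h, he, hq⟩ := hx
  obtain ⟨y', h', he'⟩ := hs' x
  rw [he'] at he
  obtain ⟨rfl, rfl⟩ := WeierstrassCurve.Affine.Point.some.inj he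
  exact hq

lemma poly_eq_zero_of_eventually {k : Type*} [Field k] [Infinite k] {r : k[X]}
    (h : ∀ᶠ x in cofinite, r.eval x = 0) : r = 0 := by
  by_contra hr
  have h' : ∀ᶠ x in cofinite, r.eval x ≠ 0 := by
    rw [eventually_cofinite]
    refine (r.rootSet_finite k).subset fun x hx => ?_
    simpa [mem_rootSet, hr] using hx
  obtain ⟨x, h1, h2⟩ := (h.and h').exists
  exact h2 h1

end sections

section representations

variable {E E' E'' : WeierstrassCurve.Affine F}

open WeierstrassCurve.Affine (Point)

/-- For almost all points `P`, the `x`-coordinate of `f P` is `[v₀ : v₁]`, evaluated at the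
`x`-coordinate of `P`. -/
def XRep (f : GeomPoint E → GeomPoint E') (v : Fin 2 → (AlgebraicClosure F)[X]) : Prop :=
  ∀ᶠ P : GeomPoint E in cofinite, ∃ x y, ∃ h, P = .some x y h ∧
    ∃ c : AlgebraicClosure F, c ≠ 0 ∧ ∀ i, (v i).eval x = c * (f P).xRep i

/-- `xRep` is normalized to (x, 1) or (1, 0), so proportional vectors agree. -/
lemma xRep_eq_of_proportional {k : Type*} [Field k] {W : WeierstrassCurve.Affine k}
    {P Q : W.Point} {a b : k} (ha : a ≠ 0) (h : ∀ i, a * P.xRep i = b * Q.xRep i) :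
    P.xRep = Q.xRep := by
  have h0 := h 0
  have h1 := h 1
  rcases P with _ | ⟨x, y, hP⟩ <;> rcases Q with _ | ⟨x', y', hQ⟩
  · rfl
  · simp [← Point.zero_def] at h0 h1
    simp [← h1, ha] at h0
  · simp [← Point.zero_def] at h0 h1
    exact absurd h1 ha
  · simp at h0 h1
    subst h1
    simp [mul_left_cancel₀ ha h0]

lemma XRep.proportional [E.IsElliptic] {f : GeomPoint E → GeomPoint E'}
    {v w : Fin 2 → (AlgebraicClosure F)[X]} (hv : XRep f v) (hw : XRep f w) (i j : Fin 2) :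
    v i * w j = v j * w i := by
  rw [← sub_eq_zero]
  refine poly_eq_zero_of_eventually (eventually_x (E := E) ?_)
  filter_upwards [hv, hw] with P h1 h2
  obtain ⟨x, y, h, rfl, c, -, hc⟩ := h1
  obtain ⟨x', y', h', he, c', -, hc'⟩ := h2
  obtain ⟨rfl, rfl⟩ := Point.some.inj he
  refine ⟨x, y, h, rfl, ?_⟩
  rw [eval_sub, eval_mul, eval_mul, hc, hc, hc', hc']
  ring

/-- The height of the `x`-coordinate of a map, as a rational function of `x`. -/
def hdeg (f : GeomPoint E → GeomPoint E') : ℕ :=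
  sInf {m | ∃ v, IsPrim v m ∧ XRep f v}

/-- All representations of `f` are proportional, and proportional primitive tuples have equal
height, so the infimum in `hdeg` runs over one element. Without a primitive representation `hdeg`
takes the default value 0. -/
lemma hdeg_eq [E.IsElliptic] {f : GeomPoint E → GeomPoint E'}
    {v : Fin 2 → (AlgebraicClosure F)[X]} {m : ℕ} (hv : IsPrim v m) (hf : XRep f v) :
    hdeg f = m := by
  have : {m | ∃ v, IsPrim v m ∧ XRep f v} = {m} := by
    ext m'
    constructor
    · rintro ⟨w, hw, hf'⟩
      exact hw.height_eq_of_proportional hv (hf'.proportional hf)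
    · rintro rfl
      exact ⟨v, hv, hf⟩
  rw [hdeg, this, csInf_singleton]

lemma eventually_affine (E : WeierstrassCurve.Affine F) :
    ∀ᶠ P : GeomPoint E in cofinite, ∃ x y, ∃ h, P = .some x y h := by
  filter_upwards [eventually_affine_ne_zero (E := E) one_ne_zero] with P hP
  obtain ⟨x, y, h, rfl, -⟩ := hP
  exact ⟨x, y, h, rfl⟩

lemma isPrim_one_zero {k : Type*} [Field k] : IsPrim (k := k) ![1, 0] 0 where
  natDegree_le i := by fin_cases i <;> simp
  coeff_ne := ⟨0, by simp⟩
  eval_ne z := ⟨0, by simp⟩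

lemma xRep_zero_hom : XRep (0 : GeomPoint E →+ GeomPoint E') ![1, 0] := by
  filter_upwards [eventually_affine E] with P hP
  obtain ⟨x, y, h, rfl⟩ := hP
  exact ⟨x, y, h, rfl, 1, one_ne_zero, fun i => by fin_cases i <;> simp⟩

lemma isPrim_X_one {k : Type*} [Field k] : IsPrim (k := k) ![X, 1] 1 where
  natDegree_le i := by fin_cases i <;> simp
  coeff_ne := ⟨0, by simp⟩
  eval_ne z := ⟨1, by simp⟩

lemma xRep_id : XRep (AddMonoidHom.id (GeomPoint E)) ![X, 1] := by
  filter_upwards [eventually_affine E] with P hP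
  obtain ⟨x, y, h, rfl⟩ := hP
  exact ⟨x, y, h, rfl, 1, one_ne_zero, fun i => by fin_cases i <;> simp⟩

lemma addSubMap_eval_smul {k : Type*} [Field k] (W : WeierstrassCurve k) (c : k)
    (x : Fin 3 → k) (i : Fin 3) :
    MvPolynomial.eval (fun j => c * x j) (W.addSubMap i) =
      c ^ 2 * MvPolynomial.eval x (W.addSubMap i) := by
  have e : ∀ z : Fin 3 → k, z = ![z 0, z 1, z 2] := fun z => by
    ext i; fin_cases i <;> rfl
  have h1 := congrFun (addSubMap_eval_cons W (c * x 0) (c * x 1) (c * x 2)) i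
  have h2 := congrFun (addSubMap_eval_cons W (x 0) (x 1) (x 2)) i
  rw [e (fun j => c * x j)]
  conv_rhs => rw [e x]
  refine h1.trans ?_
  rw [h2]
  fin_cases i <;> simp <;> ring

/-- The quadratic forms `addSubMap` have no common zero because `E'` is nonsingular, so they double
the height m₁ + m₂ of the symmetric functions. -/
lemma isPrim_addSubMap [E'.IsElliptic] {v₁ v₂ : Fin 2 → (AlgebraicClosure F)[X]} {m₁ m₂ : ℕ}
    (h₁ : IsPrim v₁ m₁) (h₂ : IsPrim v₂ m₂) :
    IsPrim (fun j => MvPolynomial.aeval (sym2 v₁ v₂)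
      (WeierstrassCurve.addSubMap (geom E') j)) (2 * (m₁ + m₂)) := by
  refine (h₁.sym2 h₂).forms (fun j => WeierstrassCurve.isHomogeneous_addSubMap _ j) ?_
  rintro x ⟨i, hi⟩
  have := WeierstrassCurve.addSubMap_ne_zero (geom E') (x := x)
    (fun h => hi (by rw [h]; rfl))
  exact Function.ne_iff.mp this

/-- At almost every point both sides are scalar multiples of the same vector, by `addSubMap_sym2x`;
cross-multiplying avoids any control of the scalar there. -/
lemma sym2_proportional [E.IsElliptic] {f g : GeomPoint E →+ GeomPoint E'}
    {v₁ v₂ v₃ v₄ : Fin 2 → (AlgebraicClosure F)[X]}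
    (hf : XRep f v₁) (hg : XRep g v₂) (hs : XRep (f + g : GeomPoint E →+ GeomPoint E') v₃)
    (hd : XRep (f - g : GeomPoint E →+ GeomPoint E') v₄) (i j : Fin 3) :
    sym2 v₃ v₄ i * MvPolynomial.aeval (sym2 v₁ v₂) (WeierstrassCurve.addSubMap (geom E') j) =
      sym2 v₃ v₄ j * MvPolynomial.aeval (sym2 v₁ v₂)
        (WeierstrassCurve.addSubMap (geom E') i) := by
  rw [← sub_eq_zero]
  refine poly_eq_zero_of_eventually (eventually_x (E := E) ?_)
  filter_upwards [hf, hg, hs, hd] with P p1 p2 p3 p4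
  obtain ⟨x, y, h, rfl, c₁, -, e₁⟩ := p1
  obtain ⟨x', y', h', he, c₂, -, e₂⟩ := p2
  obtain ⟨rfl, rfl⟩ := Point.some.inj he
  obtain ⟨x', y', h', he, c₃, -, e₃⟩ := p3
  obtain ⟨rfl, rfl⟩ := Point.some.inj he
  obtain ⟨x', y', h', he, c₄, -, e₄⟩ := p4
  obtain ⟨rfl, rfl⟩ := Point.some.inj he
  refine ⟨x, y, h, rfl, ?_⟩
  set A := f (.some x y h) with hA
  set B := g (.some x y h) with hB
  obtain ⟨c, hc⟩ := addSubMap_sym2x A B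
  have hsym : ∀ i, (sym2 v₃ v₄ i).eval x = c₃ * c₄ * (A + B).sym2x (A - B) i := by
    intro i
    have e₃' : ∀ i, (v₃ i).eval x = c₃ * (A + B).xRep i := e₃
    have e₄' : ∀ i, (v₄ i).eval x = c₄ * (A - B).xRep i := e₄
    fin_cases i <;> simp [sym2, Point.sym2x, e₃', e₄'] <;> ring
  have hsym' : (fun i => (sym2 v₁ v₂ i).eval x) = fun i => c₁ * c₂ * A.sym2x B i := by
    ext i
    fin_cases i <;> simp [sym2, Point.sym2x, e₁, e₂] <;> ring
  have hq : ∀ j, (MvPolynomial.aeval (sym2 v₁ v₂)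
      (WeierstrassCurve.addSubMap (geom E') j)).eval x =
      (c₁ * c₂) ^ 2 * (c * (A + B).sym2x (A - B) j) := by
    intro j
    rw [eval_aeval_form, hsym', addSubMap_eval_smul]
    congr 1
    exact congrFun hc j
  rw [eval_sub, eval_mul, eval_mul, hsym, hsym, hq, hq]
  ring

/-- The parallelogram law for the heights of the `x`-coordinates. -/
lemma parallelogram [E.IsElliptic] [E'.IsElliptic] {f g : GeomPoint E →+ GeomPoint E'}
    {v₁ v₂ v₃ v₄ : Fin 2 → (AlgebraicClosure F)[X]} {m₁ m₂ m₃ m₄ : ℕ}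
    (h₁ : IsPrim v₁ m₁) (h₂ : IsPrim v₂ m₂) (h₃ : IsPrim v₃ m₃) (h₄ : IsPrim v₄ m₄)
    (hf : XRep f v₁) (hg : XRep g v₂) (hs : XRep (f + g : GeomPoint E →+ GeomPoint E') v₃)
    (hd : XRep (f - g : GeomPoint E →+ GeomPoint E') v₄) :
    m₃ + m₄ = 2 * (m₁ + m₂) :=
  (h₃.sym2 h₄).height_eq_of_proportional (isPrim_addSubMap h₁ h₂) (sym2_proportional hf hg hs hd)

/-- The height of the `x`-coordinate is multiplicative. -/
lemma xRep_comp [E.IsElliptic] {g : GeomPoint E' →+ GeomPoint E''} (f : Isogeny E E')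
    {u v : Fin 2 → (AlgebraicClosure F)[X]} {N : ℕ} (hu : IsPrim u N)
    (hg : XRep g u) (hf : XRep f.toHom v) :
    XRep (g.comp f.toHom) (fun j => MvPolynomial.aeval v ((u j).homogenize N)) := by
  filter_upwards [hf, f.tendsto_cofinite.eventually hg] with P h1 h2
  obtain ⟨x, y, h, rfl, c, hc, e⟩ := h1
  obtain ⟨x', y', h', he, c', hc', e'⟩ := h2
  refine ⟨x, y, h, rfl, c ^ N * c', mul_ne_zero (pow_ne_zero _ hc) hc', fun j => ?_⟩
  have h3 : (fun i => (v i).eval x) = fun i => c * (![x', 1] : Fin 2 → AlgebraicClosure F) i := by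
    ext i
    rw [e, he, Point.xRep_some]
  rw [eval_aeval_form, h3, eval_homogenize_smul, eval_homogenize_of_one (hu.natDegree_le j), e',
    mul_assoc]
  rfl

end representations

end

end IsogenyGraph

namespace IsogenyGraph

noncomputable section

open Polynomial Filter
open scoped Polynomial.Bivariate

universe u

variable {F : Type u} [Field F]

/-! ### The height as a positive definite quadratic form. -/

section existence

open WeierstrassCurve.Affine (Point CoordinateRing)

variable {E E' : WeierstrassCurve.Affine F}

/-- A polynomial in `x` as a rational function on `E`. -/
def ofX (E : WeierstrassCurve.Affine F) : F[X] →+* E.FunctionField :=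
  (algebraMap E.CoordinateRing E.FunctionField).comp ((CoordinateRing.mk E).comp C)

lemma ofX_apply (p : F[X]) :
    ofX E p = algebraMap E.CoordinateRing E.FunctionField (CoordinateRing.mk E (C p)) := rfl

/-- The coordinate function `y`. -/
def coordY (E : WeierstrassCurve.Affine F) : E.FunctionField :=
  algebraMap E.CoordinateRing E.FunctionField (CoordinateRing.mk E Y)

lemma mk_C_injective : Function.Injective ((CoordinateRing.mk E).comp C : F[X] →+* _) := by
  rw [injective_iff_map_eq_zero]
  intro p hp
  refine (CoordinateRing.smul_basis_eq_zero (W' := E) (p := p) (q := 0) ?_).1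
  rw [zero_smul, add_zero, CoordinateRing.smul, mul_one]
  exact hp

lemma ofX_injective : Function.Injective (ofX E) :=
  (IsFractionRing.injective E.CoordinateRing E.FunctionField).comp mk_C_injective

lemma hasValueAt_ofX {x y : AlgebraicClosure F} (h : (geom E).Nonsingular x y) (p : F[X]) :
    HasValueAt E (ofX E p) (.some x y h)
      ((p.map (algebraMap F (AlgebraicClosure F))).eval x) := by
  have := hasValueAt_coe h (CoordinateRing.mk E (C p))
  rw [evalGeom_mk] at this
  simp only [map_C, coe_mapRingHom, evalEval_C] at this
  exact this

lemma hasValueAt_coordY {x y : AlgebraicClosure F} (h : (geom E).Nonsingular x y) :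
    HasValueAt E (coordY E) (.some x y h) y := by
  have := hasValueAt_coe h (CoordinateRing.mk E Y)
  rw [evalGeom_mk] at this
  simp only [map_X, evalEval_X] at this
  exact this

lemma hasValueAt_algebraMap {x y : AlgebraicClosure F} (h : (geom E).Nonsingular x y) (r : F) :
    HasValueAt E (algebraMap F E.FunctionField r) (.some x y h)
      (algebraMap F (AlgebraicClosure F) r) :=
  hasValueAt_const (hasValueAt_coordY h) r

/-- The function field is spanned by `1` and `y` over the rational functions in `x`. -/
lemma exists_ofX_mul_eq (u : E.FunctionField) :
    ∃ p q N : F[X], N ≠ 0 ∧ u * ofX E N = ofX E p + ofX E q * coordY E := by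
  obtain ⟨a, d, hd, rfl⟩ := IsFractionRing.div_surjective (A := E.CoordinateRing) u
  have hd0 := nonZeroDivisors.ne_zero hd
  have hd1 : algebraMap E.CoordinateRing E.FunctionField d ≠ 0 := by
    rwa [Ne, IsFractionRing.to_map_eq_zero_iff]
  obtain ⟨p, q, rfl⟩ := CoordinateRing.exists_smul_basis_eq d
  have : Module.Finite F[X] E.CoordinateRing := .of_basis (CoordinateRing.basis E)
  set N : F[X] := Algebra.norm F[X] (p • (1 : E.CoordinateRing) + q • CoordinateRing.mk E Y)
    with hN
  have hN0 : N ≠ 0 := by rwa [hN, Ne, Algebra.norm_eq_zero_iff]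
  have e := CoordinateRing.coe_norm_smul_basis (W' := E) p q
  rw [← hN, map_mul] at e
  -- `b` is the conjugate of the denominator under y ↦ -y - a₁x - a₃; multiplying by it turns the
  -- denominator into its norm, a polynomial in x.
  set b := CoordinateRing.mk E (C p + C q * (-(Y : F[X][Y]) - C (C E.a₁ * X + C E.a₃))) with hb
  have e' : CoordinateRing.mk E (C N) =
      (p • (1 : E.CoordinateRing) + q • CoordinateRing.mk E Y) * b := by
    rw [CoordinateRing.smul, CoordinateRing.smul, mul_one, ← map_mul, ← map_add]
    exact e
  obtain ⟨p', q', hpq⟩ := CoordinateRing.exists_smul_basis_eq (a * b)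
  refine ⟨p', q', N, hN0, ?_⟩
  rw [ofX_apply, e', map_mul, ← mul_assoc, div_mul_cancel₀ _ hd1, ← map_mul, ← hpq,
    CoordinateRing.smul, CoordinateRing.smul, mul_one, map_add, map_mul]
  rfl

/-- The denominator of the tangent slope does not vanish. -/
lemma two_mul_Y_add_ne_zero (h2 : (2 : F) ≠ 0) :
    2 * coordY E + ofX E (C E.a₁ * X + C E.a₃) ≠ 0 := by
  intro h
  have h' : CoordinateRing.mk E (2 * Y + C (C E.a₁ * X + C E.a₃)) = 0 := by
    rw [← IsFractionRing.to_map_eq_zero_iff (K := E.FunctionField), ← h]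
    simp only [map_add, map_mul, map_ofNat]
    rfl
  have := (CoordinateRing.smul_basis_eq_zero (W' := E) (p := C E.a₁ * X + C E.a₃) (q := C 2) (by
    rw [CoordinateRing.smul, CoordinateRing.smul, mul_one, ← h', map_add, map_mul, add_comm]
    simp only [map_ofNat, map_add, map_mul])).2
  rw [C_eq_zero] at this
  exact h2 this

lemma tendsto_neg_cofinite : Tendsto (fun P : GeomPoint E => -P) cofinite cofinite :=
  (neg_injective).tendsto_cofinite

/-- A rational function which is invariant under negation is a rational function of `x`. -/
lemma exists_ofX_mul_eq_ofX [E.IsElliptic] (h2 : (2 : F) ≠ 0) {u : E.FunctionField}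
    (hu : ∀ᶠ P : GeomPoint E in cofinite, ∃ c, HasValueAt E u P c ∧ HasValueAt E u (-P) c) :
    ∃ n d : F[X], IsCoprime n d ∧ d ≠ 0 ∧ u * ofX E d = ofX E n := by
  obtain ⟨p, q, N, hN, e⟩ := exists_ofX_mul_eq u
  -- Comparing the values at P and -P gives q(x)(2y + a₁x + a₃) = 0 at infinitely many points.
  have hq : q = 0 := by
    by_contra hq
    have h0 : ofX E q * (2 * coordY E + ofX E (C E.a₁ * X + C E.a₃)) ≠ 0 :=
      mul_ne_zero ((map_ne_zero_iff _ ofX_injective).mpr hq) (two_mul_Y_add_ne_zero h2)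
    obtain ⟨P, ⟨c, h3, h4⟩, ⟨x, y, h, rfl⟩, h5⟩ :=
      (hu.and ((eventually_affine E).and (eventually_ne_zero h0))).exists
    rw [Point.neg_some] at h4
    set φ := algebraMap F (AlgebraicClosure F)
    have v2 : HasValueAt E 2 (.some x y h) 2 := by
      simpa only [map_ofNat] using hasValueAt_algebraMap h 2
    refine h5 _ ((hasValueAt_ofX h q).mul ((v2.mul (hasValueAt_coordY h)).add
      (hasValueAt_ofX h _))) ?_
    have h6 := (h3.mul (hasValueAt_ofX h N))
    rw [e] at h6
    have h7 := h6.unique ((hasValueAt_ofX h p).add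
      ((hasValueAt_ofX h q).mul (hasValueAt_coordY h)))
    have h8 := (h4.mul (hasValueAt_ofX _ N))
    rw [e] at h8
    have h9 := h8.unique ((hasValueAt_ofX _ p).add
      ((hasValueAt_ofX _ q).mul (hasValueAt_coordY _)))
    rw [WeierstrassCurve.Affine.negY] at h9
    simp only [Polynomial.map_add, Polynomial.map_mul, map_C, map_X, eval_add, eval_mul, eval_C,
      eval_X]
    simp only [WeierstrassCurve.map_a₁, WeierstrassCurve.map_a₃] at h9
    linear_combination h9 - h7
  rw [hq, map_zero, zero_mul, add_zero] at e
  classical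
  let _ := EuclideanDomain.gcdMonoid F[X]
  set g := GCDMonoid.gcd p N with hg
  have hg0 : g ≠ 0 := gcd_ne_zero_of_right hN
  have hn : p = g * (p / g) := (EuclideanDomain.mul_div_cancel' hg0
    (GCDMonoid.gcd_dvd_left p N)).symm
  have hd : N = g * (N / g) := (EuclideanDomain.mul_div_cancel' hg0
    (GCDMonoid.gcd_dvd_right p N)).symm
  refine ⟨p / g, N / g, isCoprime_div_gcd_div_gcd hN, ?_, ?_⟩
  · intro h
    exact hN (by rw [hd, h, mul_zero])
  · refine mul_left_cancel₀ ((map_ne_zero_iff _ (ofX_injective (E := E))).mpr hg0) ?_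
    rw [← map_mul, ← hn, ← e, mul_left_comm, ← map_mul, ← hd]

/-- Since φ(-P) = -φ(P), the pullback of x is invariant under negation. -/
lemma Isogeny.exists_fraction [E.IsElliptic] (h2 : (2 : F) ≠ 0) (φ : Isogeny E E') :
    ∃ n d : F[X], IsCoprime n d ∧ d ≠ 0 ∧ φ.x * ofX E d = ofX E n := by
  refine exists_ofX_mul_eq_ofX h2 ?_
  filter_upwards [φ.eventually_eq, tendsto_neg_cofinite.eventually φ.eventually_eq] with P h1 h2
  obtain ⟨a, b, h, hP, ha, -⟩ := h1
  obtain ⟨a', b', h', hP', ha', -⟩ := h2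
  refine ⟨a, ha, ?_⟩
  rw [map_neg, hP, Point.neg_some] at hP'
  obtain ⟨rfl, rfl⟩ := Point.some.inj hP'
  exact ha'

/-- A Bézout relation excludes common zeros also over the algebraic closure; at infinity the member
of larger degree does not vanish. -/
lemma isPrim_of_isCoprime {n d : F[X]} (h : IsCoprime n d) :
    IsPrim ![n.map (algebraMap F (AlgebraicClosure F)), d.map (algebraMap F (AlgebraicClosure F))]
      (max n.natDegree d.natDegree) where
  natDegree_le i := by fin_cases i <;> simp
  coeff_ne := by
    have key : ∀ q : F[X], q ≠ 0 → (q.map (algebraMap F (AlgebraicClosure F))).coeff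
        q.natDegree ≠ 0 := fun q hq => by simpa using hq
    by_cases hd : d = 0
    · refine ⟨0, ?_⟩
      rw [hd, natDegree_zero, max_eq_left (Nat.zero_le _)]
      refine key n ?_
      rintro rfl
      rw [hd] at h
      exact not_isCoprime_zero_zero h
    rcases le_or_gt n.natDegree d.natDegree with hle | hlt
    · exact ⟨1, by rw [max_eq_right hle]; exact key d hd⟩
    · refine ⟨0, ?_⟩
      rw [max_eq_left hlt.le]
      refine key n ?_
      rintro rfl
      simp at hlt
  eval_ne z := by
    by_contra! h0
    obtain ⟨a, b, hab⟩ := h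
    have := congrArg (fun q => (q.map (algebraMap F (AlgebraicClosure F))).eval z) hab
    have h1 := h0 0
    have h2 := h0 1
    simp at h1 h2
    simp [h1, h2] at this

lemma Isogeny.xRep_of_fraction [E.IsElliptic] (φ : Isogeny E E') {n d : F[X]} (hd : d ≠ 0)
    (h : φ.x * ofX E d = ofX E n) :
    XRep φ.toHom ![n.map (algebraMap F (AlgebraicClosure F)),
      d.map (algebraMap F (AlgebraicClosure F))] := by
  filter_upwards [φ.eventually_eq, eventually_affine E,
    eventually_ne_zero ((map_ne_zero_iff _ (ofX_injective (E := E))).mpr hd)] with P h1 h2 h3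
  obtain ⟨x, y, hxy, rfl⟩ := h2
  obtain ⟨a, b, hab, hP, ha, -⟩ := h1
  have h4 := ha.mul (hasValueAt_ofX hxy d)
  rw [h] at h4
  refine ⟨x, y, hxy, rfl, _, h3 _ (hasValueAt_ofX hxy d), fun i => ?_⟩
  rw [hP, Point.xRep_some]
  fin_cases i
  · simpa [mul_comm] using (hasValueAt_ofX hxy n).unique h4
  · simp

/-- A homomorphism over `F` has a well-defined height. -/
lemma IsHomOver.exists_xRep [E.IsElliptic] (h2 : (2 : F) ≠ 0) {f : GeomPoint E →+ GeomPoint E'}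
    (hf : IsHomOver E E' f) : ∃ v m, IsPrim v m ∧ XRep f v := by
  rcases hf with rfl | ⟨φ, rfl⟩
  · exact ⟨_, _, isPrim_one_zero, xRep_zero_hom⟩
  · obtain ⟨n, d, hnd, hd, h⟩ := φ.exists_fraction h2
    exact ⟨_, _, isPrim_of_isCoprime hnd, φ.xRep_of_fraction hd h⟩

lemma hdeg_zero [E.IsElliptic] : hdeg (0 : GeomPoint E →+ GeomPoint E') = 0 :=
  hdeg_eq isPrim_one_zero xRep_zero_hom

lemma hdeg_id [E.IsElliptic] : hdeg (AddMonoidHom.id (GeomPoint E)) = 1 :=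
  hdeg_eq isPrim_X_one xRep_id

lemma hdeg_add_add_hdeg_sub [E.IsElliptic] [E'.IsElliptic] (h2 : (2 : F) ≠ 0)
    {f g : GeomPoint E →+ GeomPoint E'} (hf : IsHomOver E E' f) (hg : IsHomOver E E' g) :
    hdeg (f + g : GeomPoint E →+ GeomPoint E') + hdeg (f - g : GeomPoint E →+ GeomPoint E') =
      2 * (hdeg f + hdeg g) := by
  obtain ⟨v₁, m₁, p₁, r₁⟩ := hf.exists_xRep h2
  obtain ⟨v₂, m₂, p₂, r₂⟩ := hg.exists_xRep h2
  obtain ⟨v₃, m₃, p₃, r₃⟩ := (hf.add hg).exists_xRep h2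
  have hd : IsHomOver E E' (f - g) := by rw [sub_eq_add_neg]; exact hf.add hg.neg
  obtain ⟨v₄, m₄, p₄, r₄⟩ := hd.exists_xRep h2
  rw [hdeg_eq p₁ r₁, hdeg_eq p₂ r₂, hdeg_eq p₃ r₃, hdeg_eq p₄ r₄]
  exact parallelogram p₁ p₂ p₃ p₄ r₁ r₂ r₃ r₄

lemma hdeg_comp {E'' : WeierstrassCurve.Affine F} [E.IsElliptic] [E'.IsElliptic]
    (h2 : (2 : F) ≠ 0) {g : GeomPoint E' →+ GeomPoint E''} {f : GeomPoint E →+ GeomPoint E'}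
    (hg : IsHomOver E' E'' g) (hf : IsHomOver E E' f) :
    hdeg (g.comp f) = hdeg g * hdeg f := by
  rcases hf with rfl | ⟨φ, rfl⟩
  · rw [AddMonoidHom.comp_zero, hdeg_zero, hdeg_zero, mul_zero]
  · obtain ⟨v₁, m₁, p₁, r₁⟩ := hg.exists_xRep h2
    obtain ⟨v₂, m₂, p₂, r₂⟩ := IsHomOver.exists_xRep h2 (Or.inr ⟨φ, rfl⟩ : IsHomOver E E' φ.toHom)
    rw [hdeg_eq p₁ r₁, hdeg_eq p₂ r₂, hdeg_eq (p₁.homogenize p₂) (xRep_comp φ p₁ r₁ r₂)]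

/-- Height zero makes the x-coordinate of the image constant, so almost all points map to one pair
±Q; an isogeny has finite fibres. -/
lemma hdeg_eq_zero [E.IsElliptic] (h2 : (2 : F) ≠ 0) {f : GeomPoint E →+ GeomPoint E'}
    (hf : IsHomOver E E' f) (h0 : hdeg f = 0) : f = 0 := by
  obtain ⟨v, m, p, r⟩ := hf.exists_xRep h2
  rcases hf with rfl | ⟨φ, rfl⟩
  · rfl
  exfalso
  rw [hdeg_eq p r] at h0
  subst h0
  have hv : ∀ i z z', (v i).eval z = (v i).eval z' := fun i z z' => by
    rw [eq_C_of_natDegree_le_zero (p.natDegree_le i), eval_C, eval_C]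
  obtain ⟨P₀, x₀, y₀, -, -, c₀, hc₀, e₀⟩ := r.exists
  have hQ : ∀ Q, ∀ᶠ P in cofinite, φ.toHom P ≠ Q := fun Q =>
    φ.tendsto_cofinite.eventually ((Set.finite_singleton Q).eventually_cofinite_notMem)
  obtain ⟨P, ⟨x, y, -, -, c, hc, e⟩, h1, h2⟩ :=
    (r.and ((hQ (φ.toHom P₀)).and (hQ (-φ.toHom P₀)))).exists
  have := xRep_eq_of_proportional (Q := φ.toHom P₀) (b := c₀) hc
    (fun i => by rw [← e, hv i x x₀, e₀])
  rcases Point.eq_or_eq_neg_of_xRep_eq_xRep this with h | h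
  · exact h1 h
  · exact h2 h

end existence

end

end IsogenyGraph

namespace IsogenyGraph

noncomputable section

/-! ### Norm forms on rings, and orders in ℚ(√-p). -/

section normForm

variable {R : Type*} [Ring R]

/-- A multiplicative positive definite integral quadratic form on a ring. -/
structure IsNormForm (q : R → ℤ) : Prop where
  map_mul : ∀ a b, q (a * b) = q a * q b
  parallelogram : ∀ a b, q (a + b) + q (a - b) = 2 * (q a + q b)
  map_one : q 1 = 1
  nonneg : ∀ a, 0 ≤ q a
  eq_zero : ∀ a, q a = 0 → a = 0

namespace IsNormForm

variable {q : R → ℤ}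

/-- The Jordan–von Neumann argument: four instances of the parallelogram law combine to additivity
of the polar form. -/
lemma polar_add (hq : IsNormForm q) (a b c : R) :
    q (a + b + c) - q (a + b) - q c = (q (a + c) - q a - q c) + (q (b + c) - q b - q c) := by
  have h1 := hq.parallelogram (a + b) c
  have h2 := hq.parallelogram a (b - c)
  have h3 := hq.parallelogram (a + c) b
  have h4 := hq.parallelogram b c
  rw [show a + (b - c) = a + b - c by abel, show a - (b - c) = a + c - b by abel] at h2
  rw [show a + c + b = a + b + c by abel] at h3
  linarith

end IsNormForm

/-- The polar form of a norm form. -/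
def IsNormForm.polar {q : R → ℤ} (hq : IsNormForm q) : R →+ R →+ ℤ :=
  AddMonoidHom.mk' (fun a => AddMonoidHom.mk' (fun b => q (a + b) - q a - q b) fun b c => by
    have h := hq.polar_add b c a
    rw [add_comm (b + c) a, add_comm b a, add_comm c a] at h
    linarith) fun a b => by
      ext c
      exact hq.polar_add a b c

namespace IsNormForm

variable {q : R → ℤ} (hq : IsNormForm q)

lemma polar_apply (a b : R) : hq.polar a b = q (a + b) - q a - q b := rfl

lemma map_add (a b : R) : q (a + b) = q a + q b + hq.polar a b := by
  rw [hq.polar_apply]; ring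

lemma polar_comm (a b : R) : hq.polar a b = hq.polar b a := by
  rw [hq.polar_apply, hq.polar_apply, add_comm]; ring

lemma map_zero (hq : IsNormForm q) : q 0 = 0 := by
  have := hq.parallelogram 0 0
  simp at this
  linarith

lemma polar_self (a : R) : hq.polar a a = 2 * q a := by
  have := hq.parallelogram a a
  rw [sub_self, hq.map_zero] at this
  rw [hq.polar_apply]
  linarith

lemma map_zsmul (hq : IsNormForm q) (n : ℤ) (a : R) : q (n • a) = n ^ 2 * q a := by
  have h := hq.polar_self (n • a)
  rw [_root_.map_zsmul, _root_.map_zsmul, AddMonoidHom.zsmul_apply, hq.polar_self] at h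
  simp only [smul_eq_mul] at h
  linarith

lemma zsmul_eq_zero (hq : IsNormForm q) {n : ℤ} (hn : n ≠ 0) {a : R} (h : n • a = 0) : a = 0 := by
  refine hq.eq_zero a ?_
  have := hq.map_zsmul n a
  rw [h, hq.map_zero, eq_comm, mul_eq_zero] at this
  exact this.resolve_left (pow_ne_zero 2 hn)

lemma polar_mul_mul (c a b : R) : hq.polar (c * a) (c * b) = q c * hq.polar a b := by
  rw [hq.polar_apply, hq.polar_apply, ← mul_add, hq.map_mul, hq.map_mul, hq.map_mul]
  ring

/-- Polarizes `polar_mul_mul` in its left factor, replacing it by a + c. -/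
lemma polar_linearized (a b c d : R) :
    hq.polar (a * b) (c * d) + hq.polar (c * b) (a * d) = hq.polar a c * hq.polar b d := by
  have h := hq.polar_mul_mul (a + c) b d
  simp only [add_mul, _root_.map_add, AddMonoidHom.add_apply, hq.polar_mul_mul, hq.map_add a c] at h
  linarith

/-- Every element satisfies its characteristic equation. -/
lemma mul_self (f : R) : f * f = hq.polar f 1 • f - q f • (1 : R) := by
  rw [← sub_eq_zero]
  set c := f * f - (hq.polar f 1 • f - q f • (1 : R)) with hc
  -- With B the polar form, B(ff, h) + B(f, fh) = B(f, 1)B(f, h) and B(f, fh) = q(f)B(1, h). So c is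
  -- orthogonal to everything, in particular to itself, and definiteness gives c = 0.
  have key : ∀ h, hq.polar c h = 0 := by
    intro h
    have h1 := hq.polar_linearized f f 1 h
    have h2 := hq.polar_mul_mul f 1 h
    rw [one_mul, one_mul] at h1
    rw [mul_one] at h2
    simp only [hc, map_sub, _root_.map_zsmul, AddMonoidHom.sub_apply, AddMonoidHom.zsmul_apply,
      smul_eq_mul]
    linarith
  have := key c
  rw [hq.polar_self] at this
  exact hq.eq_zero c (by linarith)

lemma map_combination (a k : ℤ) (f : R) :
    q (a • (1 : R) + k • f) = a ^ 2 + a * k * hq.polar f 1 + k ^ 2 * q f := by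
  rw [hq.map_add, hq.map_zsmul, hq.map_zsmul, hq.map_one, _root_.map_zsmul, _root_.map_zsmul,
    AddMonoidHom.zsmul_apply, hq.polar_comm 1 f]
  simp only [smul_eq_mul]
  ring

/-- With T the trace of f, the norm of T - 2f is 4q(f) - T². -/
lemma polar_sq_le (f : R) : hq.polar f 1 ^ 2 ≤ 4 * q f := by
  have h := hq.nonneg (hq.polar f 1 • (1 : R) + (-2 : ℤ) • f)
  rw [hq.map_combination] at h
  linarith

/-- If the trace of an element of norm `p > 4` is divisible by `p`, it vanishes. -/
lemma polar_eq_zero_of_dvd {p : ℕ} (hp : 4 < p) {π : R} (hπ : q π = p)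
    (hdvd : (p : ℤ) ∣ hq.polar π 1) : hq.polar π 1 = 0 := by
  obtain ⟨s, hs⟩ := hdvd
  have h := hq.polar_sq_le π
  rw [hπ, hs] at h
  rw [hs]
  have hp' : (4 : ℤ) < p := by exact_mod_cast hp
  -- The trace is ps, so p²s² ≤ 4p.
  have h5 : (p : ℤ) * s ^ 2 ≤ 4 := by nlinarith
  have hs0 : s = 0 := by
    by_contra hs0
    have := sq_pos_of_ne_zero hs0
    nlinarith
  rw [hs0, mul_zero]

section commuting

variable {p : ℕ} {π : R}

lemma mul_self_eq_neg (hπ : q π = p) (ht : hq.polar π 1 = 0) : π * π = -((p : ℤ) • (1 : R)) := by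
  rw [hq.mul_self, ht, hπ, zero_smul, zero_sub]

lemma combination_eq_zero (hπ : q π = p) (ht : hq.polar π 1 = 0)
    (hp : p ≠ 0) {a k : ℤ} (h : a • (1 : R) + k • π = 0) :
    a = 0 ∧ k = 0 := by
  have := hq.map_combination a k π
  rw [h, hq.map_zero, ht, hπ] at this
  have hp' : (0 : ℤ) < p := by exact_mod_cast Nat.pos_of_ne_zero hp
  have h1 : a ^ 2 = 0 := by nlinarith [sq_nonneg a, mul_nonneg (sq_nonneg k) hp'.le]
  have h2 : k ^ 2 = 0 := by nlinarith [sq_nonneg a, sq_nonneg k]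
  exact ⟨pow_eq_zero_iff two_ne_zero |>.mp h1, pow_eq_zero_iff two_ne_zero |>.mp h2⟩

/-- The commutant of `π` is contained in `(ℤ + ℤ π) / 2`. -/
lemma exists_two_smul_eq (hπ : q π = p) (ht : hq.polar π 1 = 0)
    (hp : p.Prime) (f : R) (hf : π * f = f * π) :
    ∃ a k : ℤ, (2 : ℤ) • f = a • (1 : R) + k • π := by
  set T := hq.polar f 1 with hT
  -- `g` is twice the trace-free part of f, so g² = -D with D its norm. Since g commutes with π,
  -- (πg)² = pD is an integer; this will force πg itself to be one.
  set g := (2 : ℤ) • f - T • (1 : R) with hg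
  set D := 4 * q f - T ^ 2 with hD
  have hgg : g * g = -(D • (1 : R)) := by
    have := hq.mul_self f
    simp only [hg, hD, sub_mul, mul_sub, smul_mul_assoc, mul_smul_comm, this, mul_one, one_mul]
    module
  have hqg : q g = D := by
    have := hq.map_combination (-T) 2 f
    rw [show (-T) • (1 : R) + (2 : ℤ) • f = g by rw [hg]; module] at this
    rw [this, ← hT, hD]
    ring
  have hππ := hq.mul_self_eq_neg hπ ht
  have hcomm : π * g = g * π := by
    simp only [hg, mul_sub, sub_mul, smul_mul_assoc, mul_smul_comm, hf, mul_one, one_mul]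
  have hcc : (π * g) * (π * g) = (p * D) • (1 : R) := by
    calc (π * g) * (π * g) = (π * π) * (g * g) := by
          rw [mul_assoc, ← mul_assoc g, ← hcomm]; simp only [mul_assoc]
      _ = _ := by
        rw [hππ, hgg]
        simp only [neg_mul_neg, mul_smul_comm, mul_one]
        module
  set S := hq.polar (π * g) 1 with hS
  -- Compare (πg)² = pD with the characteristic equation (πg)² = S·πg - pD.
  have h1 : S • (π * g) = (2 * (p * D)) • (1 : R) := by
    have := hq.mul_self (π * g)
    rw [hcc, hq.map_mul, hπ, hqg] at this
    rw [← hS] at this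
    rw [eq_sub_iff_add_eq] at this
    rw [← this]
    module
  have hp0 : (p : ℤ) ≠ 0 := by exact_mod_cast hp.ne_zero
  have h2 : S • g = (-(2 * D)) • π := by
    have h3 := congrArg (π * ·) h1
    simp only [mul_smul_comm, ← mul_assoc, hππ, mul_one, neg_mul, smul_mul_assoc, one_mul] at h3
    have h4 : (p : ℤ) • (S • g - (-(2 * D)) • π) = 0 := by
      have : (p : ℤ) • (S • g - (-(2 * D)) • π) = -(S • -((p : ℤ) • g)) + (2 * (p * D)) • π := by
        module
      rw [this, h3]
      module
    exact sub_eq_zero.mp (hq.zsmul_eq_zero hp0 h4)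
  by_cases hD0 : D = 0
  · refine ⟨T, 0, ?_⟩
    have := hq.eq_zero g (hqg.trans hD0)
    rw [hg, sub_eq_zero] at this
    rw [this, zero_smul, add_zero]
  -- Take norms in S·g = -2D·π and cancel D. Hence S = 2pm and D = pm² for an integer m, so that g =
  -- -mπ.
  have h5 : S ^ 2 = 4 * D * p := by
    have := congrArg q h2
    rw [hq.map_zsmul, hq.map_zsmul, hqg, hπ] at this
    refine mul_right_cancel₀ hD0 ?_
    linear_combination this
  have hp' : Prime (p : ℤ) := Nat.prime_iff_prime_int.mp hp
  have hS2 : (2 : ℤ) ∣ S := Int.prime_two.dvd_of_dvd_pow ⟨2 * D * p, by rw [h5]; ring⟩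
  obtain ⟨s, hs⟩ := hS2
  have h6 : s ^ 2 = D * p := by
    have : (2 * s) ^ 2 = 4 * D * p := by rw [← hs, h5]
    linarith [mul_pow 2 s 2]
  obtain ⟨m, hm⟩ : (p : ℤ) ∣ s := hp'.dvd_of_dvd_pow ⟨D, by rw [h6]; ring⟩
  have h7 : D = p * m ^ 2 := by
    refine mul_right_cancel₀ hp0 ?_
    rw [← h6, hm]; ring
  have hm0 : m ≠ 0 := by rintro rfl; simp at h7; exact hD0 h7
  refine ⟨T, -m, ?_⟩
  have h8 : (2 * (p * m)) • (g - (-m) • π) = 0 := by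
    have : (2 * (p * m)) • (g - (-m) • π) = S • g - (-(2 * D)) • π := by
      rw [hs, hm, h7]
      module
    rw [this, h2, sub_self]
  have h9 := sub_eq_zero.mp (hq.zsmul_eq_zero (mul_ne_zero two_ne_zero (mul_ne_zero hp0 hm0)) h8)
  rw [← h9, hg]
  module

/-- Taking norms gives a² + pk² = 4q(f), which is even while p is odd. -/
lemma even_of_two_smul_eq (hπ : q π = p) (ht : hq.polar π 1 = 0)
    (hp : Odd p) {f : R} {a k : ℤ}
    (h : (2 : ℤ) • f = a • (1 : R) + k • π) : Even (a - k) := by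
  have h1 := hq.map_combination a k π
  rw [← h, hq.map_zsmul, ht, hπ] at h1
  have hp' : ¬ Even (p : ℤ) := by rw [Int.not_even_iff_odd]; exact_mod_cast hp
  have h2 : Even (a ^ 2 + k ^ 2 * p) := ⟨2 * q f, by linarith⟩
  rw [Int.even_add, Int.even_mul, Int.even_pow' two_ne_zero, Int.even_pow' two_ne_zero] at h2
  rw [Int.even_sub]
  tauto

end commuting

end IsNormForm

/-- A commutative ring `R` which contains `ℤ[√-p]` with index at most two. -/
structure IsQuadOrder (p : ℕ) (R : Type*) [CommRing R] (π : R) : Prop where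
  sq : π * π = -(p : R)
  torsion_free : ∀ (n : ℤ) (f : R), n ≠ 0 → (n : R) * f = 0 → f = 0
  indep : ∀ a k : ℤ, (a : R) + k * π = 0 → a = 0 ∧ k = 0
  span : ∀ f : R, ∃ a k : ℤ, 2 * f = a + k * π
  parity : ∀ (f : R) (a k : ℤ), 2 * f = a + k * π → Even (a - k)

namespace IsQuadOrder

variable {p : ℕ} {R R' : Type*} [CommRing R] [CommRing R'] {π : R} {π' : R'}

/-- By parity, f lies in ℤ[π] when k is even, and f differs from (1 + π)/2 by an element of ℤ[π]
when k is odd. The latter requires a half of 1 + π in `R`, which the hypothesis transports to `R'`.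
-/
lemma exists_partner (hR : IsQuadOrder p R π)
    (hh : (∃ f : R, 2 * f = 1 + π) → ∃ f : R', 2 * f = 1 + π') (f : R) :
    ∃ f' : R', ∃ a k : ℤ, 2 * f = a + k * π ∧ 2 * f' = a + k * π' := by
  obtain ⟨a, k, h⟩ := hR.span f
  obtain ⟨m, hm⟩ := hR.parity f a k h
  rcases Int.even_or_odd k with ⟨l, hl⟩ | ⟨l, hl⟩
  · refine ⟨((m + l : ℤ) : R') + l * π', a, k, h, ?_⟩
    obtain rfl : a = 2 * (m + l) := by linarith
    subst hl
    push_cast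
    ring
  · have e : a = 2 * (m + l) + 1 := by linarith
    obtain ⟨g, hg⟩ := hh ⟨f - (m + l : ℤ) - l * π, by
      rw [mul_sub, mul_sub, h, e, hl]; push_cast; ring⟩
    refine ⟨g + (m + l : ℤ) + l * π', a, k, h, ?_⟩
    rw [mul_add, mul_add, hg, e, hl]
    push_cast
    ring

lemma coeff_unique (hR : IsQuadOrder p R π) {a k b l : ℤ}
    (h : (a : R) + k * π = b + l * π) : a = b ∧ k = l := by
  have := hR.indep (a - b) (k - l) (by push_cast; linear_combination h)
  exact ⟨by linarith [this.1], by linarith [this.2]⟩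

lemma two_mul_cancel (hR : IsQuadOrder p R π) {f g : R} (h : 2 * f = 2 * g) : f = g :=
  sub_eq_zero.mp (hR.torsion_free 2 _ two_ne_zero (by push_cast; linear_combination h))

/-- Two such orders are isomorphic if `(1 + √-p) / 2` lies in both or in none. -/
theorem nonempty_ringEquiv (hR : IsQuadOrder p R π) (hR' : IsQuadOrder p R' π')
    (hh : (∃ f : R, 2 * f = 1 + π) ↔ ∃ f : R', 2 * f = 1 + π') : Nonempty (R ≃+* R') := by
  -- The isomorphism preserves the coordinates (a, k) of 2f. These are unique, so the ring laws are
  -- compared coordinatewise: products after multiplication by 4, using π² = -p, and sums after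
  -- multiplication by 2.
  choose F a k hF using hR.exists_partner hh.mp
  choose G b l hG using hR'.exists_partner hh.mpr
  have hFG : ∀ f, G (F f) = f := fun f => by
    obtain ⟨h1, h2⟩ := hR'.coeff_unique ((hG (F f)).1.symm.trans (hF f).2)
    refine hR.two_mul_cancel ?_
    rw [(hG (F f)).2, (hF f).1, h1, h2]
  have hGF : ∀ f, F (G f) = f := fun f => by
    obtain ⟨h1, h2⟩ := hR.coeff_unique ((hF (G f)).1.symm.trans (hG f).2)
    refine hR'.two_mul_cancel ?_
    rw [(hF (G f)).2, (hG f).1, h1, h2]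
  refine ⟨{ toFun := F, invFun := G, left_inv := hFG, right_inv := hGF,
            map_mul' := fun f g => ?_, map_add' := fun f g => ?_ }⟩
  · have e : ((2 * a (f * g) : ℤ) : R) + (2 * k (f * g) : ℤ) * π =
        (a f * a g - p * (k f * k g) : ℤ) + (a f * k g + a g * k f : ℤ) * π := by
      push_cast
      linear_combination (-2) * (hF (f * g)).1 + 2 * g * (hF f).1 + (a f + k f * π) * (hF g).1 +
        (k f * k g) * hR.sq
    obtain ⟨h1, h2⟩ := hR.coeff_unique e
    refine hR'.two_mul_cancel (hR'.two_mul_cancel ?_)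
    have h1' : (2 * a (f * g) : R') = a f * a g - p * (k f * k g) := by
      have := congrArg (Int.cast : ℤ → R') h1
      push_cast at this
      exact this
    have h2' : (2 * k (f * g) : R') = a f * k g + a g * k f := by
      have := congrArg (Int.cast : ℤ → R') h2
      push_cast at this
      exact this
    linear_combination 2 * (hF (f * g)).2 - 2 * F g * (hF f).2 - (a f + k f * π') * (hF g).2 -
        (k f * k g) * hR'.sq + h1' + h2' * π'
  · have e : (a (f + g) : R) + k (f + g) * π = (a f + a g : ℤ) + (k f + k g : ℤ) * π := by
      push_cast
      linear_combination -(hF (f + g)).1 + (hF f).1 + (hF g).1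
    obtain ⟨h1, h2⟩ := hR.coeff_unique e
    refine hR'.two_mul_cancel ?_
    rw [(hF (f + g)).2, h1, h2, mul_add, (hF f).2, (hF g).2]
    push_cast
    ring

end IsQuadOrder

end normForm

end

end IsogenyGraph

namespace IsogenyGraph

noncomputable section

open Polynomial Filter
open scoped Polynomial.Bivariate

universe u

/-! ### Inseparability, detected by vanishing derivatives. -/

section derivatives

variable {k : Type*} [Field k] {ι : Type*}

/-- If the ratios of the members of a primitive tuple have derivative zero, then so do the
members. -/
lemma IsPrim.derivative_eq_zero [IsAlgClosed k] {v : ι → k[X]} {m : ℕ} (hv : IsPrim v m)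
    (h : ∀ i j, v i * derivative (v j) = v j * derivative (v i)) (i : ι) :
    derivative (v i) = 0 := by
  -- Each member divides its own derivative, whose degree is smaller unless the member is constant.
  have h1 := hv.dvd_of_proportional (w := fun i => derivative (v i)) h i
  by_contra h0
  have hdeg := natDegree_le_of_dvd h1 h0
  by_cases hn : (v i).natDegree = 0
  · exact h0 (by rw [eq_C_of_natDegree_eq_zero hn, derivative_C])
  · exact absurd hdeg (not_le.mpr (natDegree_derivative_lt hn))

lemma derivative_aeval_eq_zero {v : ι → k[X]} (hv : ∀ i, derivative (v i) = 0)
    (q : MvPolynomial ι k) : derivative (MvPolynomial.aeval v q) = 0 := by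
  induction q using MvPolynomial.induction_on with
  | C a => simp
  | add p q hp hq => simp [hp, hq]
  | mul_X p i hp => simp [derivative_mul, hp, hv i]

lemma derivative_sym2_eq_zero {v w : Fin 2 → k[X]} (hv : ∀ i, derivative (v i) = 0)
    (hw : ∀ i, derivative (w i) = 0) (i : Fin 3) : derivative (sym2 v w i) = 0 := by
  fin_cases i <;> simp [sym2, derivative_mul, hv, hw]

lemma IsPrim.derivative_eq_zero_of_proportional [IsAlgClosed k] {v w : ι → k[X]} {m m' : ℕ}
    (hv : IsPrim v m) (hw : IsPrim w m') (h : ∀ i j, v i * w j = v j * w i)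
    (h0 : ∀ i, derivative (v i) = 0) (i : ι) : derivative (w i) = 0 := by
  have h1 := hv.dvd_of_proportional h i
  have h2 := hw.dvd_of_proportional (w := v) (fun i j => by rw [mul_comm, h j i, mul_comm]) i
  obtain ⟨u, hu⟩ := associated_of_dvd_dvd h1 h2
  obtain ⟨r, -, hr⟩ := Polynomial.isUnit_iff.mp u.isUnit
  rw [← hu, ← hr, derivative_mul, h0, derivative_C]
  simp

/-- If the symmetric functions of two rational functions have derivative zero, then so have the
functions. -/
lemma IsPrim.derivative_eq_zero_of_sym2 [IsAlgClosed k] (h2 : (2 : k) ≠ 0) {v w : Fin 2 → k[X]}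
    {m m' : ℕ} (hv : IsPrim v m) (hw : IsPrim w m')
    (h : ∀ i, derivative (IsogenyGraph.sym2 v w i) = 0) (i : Fin 2) : derivative (v i) = 0 := by
  have e0 : derivative (v 0 * w 0) = 0 := h 0
  have e1 : derivative (v 0 * w 1 + v 1 * w 0) = 0 := h 1
  have e2 : derivative (v 1 * w 1) = 0 := h 2
  -- If the two functions coincide, then v i * w i is a constant times v i ², and 2 is invertible.
  by_cases hp : w 1 * v 0 = w 0 * v 1
  · have hp' : ∀ i j, v i * w j = v j * w i := fun i j => by
      fin_cases i <;> fin_cases j <;> simp <;>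
        first | linear_combination hp | linear_combination -hp
    have h1 := hv.dvd_of_proportional hp' i
    have h3 := hw.dvd_of_proportional (w := v)
      (fun i j => by rw [mul_comm, hp' j i, mul_comm]) i
    obtain ⟨u, hu⟩ := associated_of_dvd_dvd h1 h3
    obtain ⟨r, hr0, hr⟩ := Polynomial.isUnit_iff.mp u.isUnit
    have h4 : derivative (v i * w i) = 0 := by
      fin_cases i
      · exact e0
      · exact e2
    rw [← hu, ← hr, ← mul_assoc, derivative_mul, derivative_C, mul_zero, add_zero, mul_eq_zero,
      derivative_mul, C_eq_zero] at h4
    have h5 := h4.resolve_right hr0.ne_zero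
    have h6 : C 2 * (v i * derivative (v i)) = 0 := by
      rw [map_ofNat]; linear_combination h5
    rw [mul_eq_zero, C_eq_zero, mul_eq_zero] at h6
    rcases h6.resolve_left h2 with h7 | h7
    · rw [h7, derivative_zero]
    · exact h7
  · refine hv.derivative_eq_zero ?_ i
    -- In v₀²·e2 - v₀v₁·e1 + v₁²·e0 the derivatives of w cancel; up to sign, what remains is the
    -- Wronskian of v times v₀w₁ - v₁w₀, which is nonzero here.
    have hW : derivative (v 0) * v 1 - v 0 * derivative (v 1) = 0 := by
      refine (mul_eq_zero.mp ?_).resolve_right (sub_ne_zero.mpr hp)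
      rw [derivative_add, derivative_mul, derivative_mul] at e1
      rw [derivative_mul] at e0 e2
      linear_combination -(v 0 ^ 2 * e2 - v 0 * v 1 * e1 + v 1 ^ 2 * e0)
    intro i j
    fin_cases i <;> fin_cases j <;> simp <;> first | linear_combination hW | linear_combination -hW

/-- Some member has nonzero coefficient at m, and its derivative has m times that coefficient one
degree lower. -/
lemma IsPrim.dvd_height {p : ℕ} [CharP k p] {v : ι → k[X]} {m : ℕ} (hv : IsPrim v m)
    (h : ∀ i, derivative (v i) = 0) : p ∣ m := by
  obtain ⟨i, hi⟩ := hv.coeff_ne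
  rcases m with _ | m
  · exact dvd_zero p
  have := congrArg (coeff · m) (h i)
  simp only [coeff_derivative, coeff_zero, mul_eq_zero, hi, false_or] at this
  rw [← CharP.cast_eq_zero_iff k p]
  exact_mod_cast this

/-- A rational function of degree at least two with nonzero derivative takes almost every value
at two different points outside a given finite set. -/
lemma IsPrim.exists_ne_of_derivative_ne_zero [IsAlgClosed k] {v : Fin 2 → k[X]} {m : ℕ}
    (hv : IsPrim v m) (hm : 2 ≤ m)
    (hW : derivative (v 0) * v 1 - v 0 * derivative (v 1) ≠ 0) {S : Set k} (hS : S.Finite) :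
    ∃ z₁ z₂ c : k, z₁ ≠ z₂ ∧ z₁ ∉ S ∧ z₂ ∉ S ∧ (v 0).eval z₁ = c * (v 1).eval z₁ ∧
      (v 0).eval z₂ = c * (v 1).eval z₂ := by
  have : Infinite k := IsAlgClosed.instInfinite
  set W := derivative (v 0) * v 1 - v 0 * derivative (v 1) with hWdef
  -- The value c must avoid the value at infinity and the values on S and at the zeros of the
  -- Wronskian. Then v₀ - c·v₁ has degree m and only simple roots, all outside S, so m ≥ 2 gives two
  -- of them. If v₁ vanishes at infinity, the division by zero merely excludes c = 0 as well.
  have hfin : (insert ((v 0).coeff m / (v 1).coeff m) ((fun z => (v 0).eval z / (v 1).eval z) ''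
      (S ∪ W.rootSet k))).Finite :=
    (((hS.union (W.rootSet_finite k)).image _).insert _)
  obtain ⟨c, hc⟩ := hfin.exists_notMem
  rw [Set.mem_insert_iff, not_or] at hc
  obtain ⟨hc1, hc2⟩ := hc
  set r := v 0 - C c * v 1 with hr
  have hroot : ∀ z, r.eval z = 0 → (v 0).eval z = c * (v 1).eval z ∧ z ∉ S ∧
      (derivative r).eval z ≠ 0 := by
    intro z hz
    have e : (v 0).eval z = c * (v 1).eval z := by
      rw [hr, eval_sub, eval_mul, eval_C] at hz
      exact sub_eq_zero.mp hz
    have h1 : (v 1).eval z ≠ 0 := by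
      intro h1
      obtain ⟨i, hi⟩ := hv.eval_ne z
      fin_cases i
      · exact hi (by rw [Fin.zero_eta, e, h1, mul_zero])
      · exact hi h1
    have hdiv : (v 0).eval z / (v 1).eval z = c := by rw [e, mul_div_cancel_right₀ _ h1]
    refine ⟨e, fun hzS => hc2 ⟨z, Or.inl hzS, hdiv⟩, fun h0 => ?_⟩
    refine hc2 ⟨z, Or.inr ?_, hdiv⟩
    rw [mem_rootSet]
    refine ⟨hW, ?_⟩
    rw [hr, derivative_sub, derivative_C_mul, eval_sub, eval_mul, eval_C] at h0
    rw [coe_aeval_eq_eval, hWdef, eval_sub, eval_mul, eval_mul, e]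
    linear_combination (v 1).eval z * h0
  have hcoeff : r.coeff m ≠ 0 := by
    rw [hr, coeff_sub, coeff_C_mul]
    intro h0
    by_cases h1 : (v 1).coeff m = 0
    · rw [h1, mul_zero, sub_zero] at h0
      obtain ⟨i, hi⟩ := hv.coeff_ne
      fin_cases i
      · exact hi h0
      · exact hi h1
    · exact hc1 (by rw [eq_div_iff h1]; linear_combination -h0)
  have hdeg : 2 ≤ r.natDegree := hm.trans (le_natDegree_of_ne_zero hcoeff)
  obtain ⟨z₁, hz₁⟩ := IsAlgClosed.exists_root r (by
    intro h0
    have := natDegree_eq_zero_iff_degree_le_zero.mpr h0.le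
    omega)
  obtain ⟨s, hs⟩ := dvd_iff_isRoot.mpr hz₁
  have hs0 : s ≠ 0 := by rintro rfl; rw [mul_zero] at hs; simp [hs] at hdeg
  have hsdeg : r.natDegree = 1 + s.natDegree := by
    rw [hs, natDegree_mul (X_sub_C_ne_zero _) hs0, natDegree_X_sub_C]
  obtain ⟨z₂, hz₂⟩ := IsAlgClosed.exists_root s (by
    intro h0
    have := natDegree_eq_zero_iff_degree_le_zero.mpr h0.le
    omega)
  have hz₂' : r.eval z₂ = 0 := by rw [hs, eval_mul, hz₂.eq_zero, mul_zero]
  refine ⟨z₁, z₂, c, ?_, (hroot z₁ hz₁).2.1, (hroot z₂ hz₂').2.1, (hroot z₁ hz₁).1,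
    (hroot z₂ hz₂').1⟩
  rintro rfl
  refine (hroot z₁ hz₁).2.2 ?_
  rw [hs, derivative_mul, eval_add, eval_mul, eval_mul, hz₂.eq_zero]
  simp

end derivatives

section injective

variable {F : Type u} [Field F] {E E' : WeierstrassCurve.Affine F}

open WeierstrassCurve.Affine (Point)

/-- An injective homomorphism of degree at least two is inseparable. -/
lemma derivative_eq_zero_of_injective [E.IsElliptic] {f : GeomPoint E →+ GeomPoint E'}
    (hf : Function.Injective f) {v : Fin 2 → (AlgebraicClosure F)[X]} {m : ℕ} (hv : IsPrim v m)
    (hm : 2 ≤ m) (hr : XRep f v) (i : Fin 2) : derivative (v i) = 0 := by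
  refine hv.derivative_eq_zero ?_ i
  have hW : derivative (v 0) * v 1 - v 0 * derivative (v 1) = 0 := by
    -- Otherwise two points with different x-coordinates have images with the same x-coordinate,
    -- that is, images equal up to sign.
    by_contra hW
    have hx : ∀ᶠ x in cofinite, ∃ y, ∃ h : (geom E).Nonsingular x y, ∃ c : AlgebraicClosure F,
        c ≠ 0 ∧ ∀ i, (v i).eval x = c * (f (.some x y h)).xRep i := by
      refine eventually_x (E := E) ?_
      filter_upwards [hr] with P hP
      obtain ⟨x, y, h, rfl, c, hc, e⟩ := hP
      exact ⟨x, y, h, rfl, y, h, c, hc, e⟩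
    obtain ⟨z₁, z₂, c, hne, h1, h2, e1, e2⟩ :=
      hv.exists_ne_of_derivative_ne_zero hm hW (eventually_cofinite.mp hx)
    simp only [Set.mem_ofPred_eq, not_not] at h1 h2
    obtain ⟨y₁, n₁, c₁, hc₁, r₁⟩ := h1
    obtain ⟨y₂, n₂, c₂, hc₂, r₂⟩ := h2
    have d₁ : (v 1).eval z₁ ≠ 0 := fun h => by
      obtain ⟨i, hi⟩ := hv.eval_ne z₁
      fin_cases i
      · exact hi (by rw [Fin.zero_eta, e1, h, mul_zero])
      · exact hi h
    have d₂ : (v 1).eval z₂ ≠ 0 := fun h => by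
      obtain ⟨i, hi⟩ := hv.eval_ne z₂
      fin_cases i
      · exact hi (by rw [Fin.zero_eta, e2, h, mul_zero])
      · exact hi h
    have key := xRep_eq_of_proportional (P := f (.some z₁ y₁ n₁)) (Q := f (.some z₂ y₂ n₂))
      (a := (v 1).eval z₂ * c₁) (b := (v 1).eval z₁ * c₂) (mul_ne_zero d₂ hc₁) (fun i => by
        rw [mul_assoc, mul_assoc, ← r₁, ← r₂]
        fin_cases i
        · simp only [Fin.zero_eta, e1, e2]; ring
        · simp only [Fin.mk_one]; ring)
    rcases Point.eq_or_eq_neg_of_xRep_eq_xRep key with h | h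
    · exact hne (Point.some.inj (hf h)).1
    · rw [← map_neg, Point.neg_some] at h
      exact hne (Point.some.inj (hf h)).1
  intro i j
  fin_cases i <;> fin_cases j <;> simp <;> first | linear_combination hW | linear_combination -hW

/-- The sum of two inseparable homomorphisms is inseparable. -/
lemma derivative_eq_zero_of_add [E.IsElliptic] [E'.IsElliptic] (h2 : (2 : F) ≠ 0)
    {f g : GeomPoint E →+ GeomPoint E'}
    {v₁ v₂ v₃ v₄ : Fin 2 → (AlgebraicClosure F)[X]} {m₁ m₂ m₃ m₄ : ℕ}
    (h₁ : IsPrim v₁ m₁) (h₂ : IsPrim v₂ m₂) (h₃ : IsPrim v₃ m₃) (h₄ : IsPrim v₄ m₄)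
    (hf : XRep f v₁) (hg : XRep g v₂) (hs : XRep (f + g : GeomPoint E →+ GeomPoint E') v₃)
    (hd : XRep (f - g : GeomPoint E →+ GeomPoint E') v₄)
    (hv₁ : ∀ i, derivative (v₁ i) = 0) (hv₂ : ∀ i, derivative (v₂ i) = 0) (i : Fin 2) :
    derivative (v₃ i) = 0 := by
  refine h₃.derivative_eq_zero_of_sym2 ?_ h₄ ?_ i
  · rw [← map_ofNat (algebraMap F (AlgebraicClosure F))]
    exact (_root_.map_ne_zero _).mpr h2
  -- The symmetric functions for f ± g are proportional to polynomials in those for f and g, which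
  -- have derivative zero.
  refine (isPrim_addSubMap (E' := E') h₁ h₂).derivative_eq_zero_of_proportional (h₃.sym2 h₄)
    (fun i j => ?_) (fun i => derivative_aeval_eq_zero (derivative_sym2_eq_zero hv₁ hv₂) _)
  rw [mul_comm, ← sym2_proportional hf hg hs hd, mul_comm]

end injective

end

end IsogenyGraph

namespace IsogenyGraph

noncomputable section

open Polynomial Filter
open scoped Polynomial.Bivariate

universe u

/-! ### Frobenius, its trace, and the structure of the endomorphism ring. -/

section frobenius

open WeierstrassCurve.Affine (Point CoordinateRing)

variable {p : ℕ} [Fact p.Prime] {E E' : WeierstrassCurve.Affine (ZMod p)}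

/-- The Frobenius automorphism of the algebraic closure. -/
def frobAlg (p : ℕ) [Fact p.Prime] :
    AlgebraicClosure (ZMod p) →ₐ[ZMod p] AlgebraicClosure (ZMod p) :=
  FiniteField.frobeniusAlgHom (ZMod p) (AlgebraicClosure (ZMod p))

lemma frobAlg_apply (x : AlgebraicClosure (ZMod p)) : frobAlg p x = x ^ p := by
  rw [frobAlg, FiniteField.coe_frobeniusAlgHom, ZMod.card]

/-- The Frobenius endomorphism on geometric points. -/
def frob (E : WeierstrassCurve.Affine (ZMod p)) : GeomPoint E →+ GeomPoint E :=
  Point.map (W' := E) (frobAlg p)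

lemma frob_some {x y : AlgebraicClosure (ZMod p)} (h : (geom E).Nonsingular x y) :
    ∃ h', frob E (.some x y h) = .some (x ^ p) (y ^ p) h' := by
  have e := Point.map_some (W' := E) (frobAlg p) h
  simp only [frobAlg_apply] at e
  exact ⟨_, e⟩

lemma frob_injective : Function.Injective (frob E) :=
  Point.map_injective (W' := E) (frobAlg p)

/-- Frobenius fixes the coefficients of `a`, which lie in the prime field. -/
lemma evalGeom_frob {x y : AlgebraicClosure (ZMod p)} (h : (geom E).Nonsingular x y)
    (h' : (geom E).Nonsingular (x ^ p) (y ^ p)) (a : E.CoordinateRing) :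
    evalGeom E h' a = evalGeom E h a ^ p := by
  obtain ⟨A, rfl⟩ := AdjoinRoot.mk_surjective a
  refine (evalGeom_mk h' A).trans (Eq.trans ?_ (congrArg (· ^ p) (evalGeom_mk h A).symm))
  rw [← frobAlg_apply, ← frobAlg_apply, ← frobAlg_apply]
  have := map_mapRingHom_evalEval
    (frobAlg p : AlgebraicClosure (ZMod p) →+* AlgebraicClosure (ZMod p))
    (p := A.map (mapRingHom (algebraMap (ZMod p) (AlgebraicClosure (ZMod p))))) x y
  rw [Polynomial.map_map, mapRingHom_comp, AlgHom.comp_algebraMap] at this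
  exact this

lemma HasValueAt.frob {u : E.FunctionField} {P : GeomPoint E} {c : AlgebraicClosure (ZMod p)}
    (h : HasValueAt E u P c) : HasValueAt E u (frob E P) (c ^ p) := by
  rcases P with _ | ⟨x, y, hxy⟩
  · exact h.elim
  obtain ⟨h', e⟩ := frob_some hxy
  rw [e]
  obtain ⟨a, d, hd, h1, h2⟩ := h
  refine ⟨a, d, ?_, h1, ?_⟩
  · rw [evalGeom_frob hxy]
    exact pow_ne_zero _ hd
  · rw [evalGeom_frob hxy, evalGeom_frob hxy, ← mul_pow, h2]

lemma HasValueAt.pow {F : Type u} [Field F] {E : WeierstrassCurve.Affine F} {u : E.FunctionField}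
    {P : GeomPoint E} {c : AlgebraicClosure F} (h : HasValueAt E u P c) (n : ℕ) :
    HasValueAt E (u ^ n) P (c ^ n) := by
  induction n with
  | zero => simpa using hasValueAt_const h 1
  | succ n ih => simpa only [pow_succ] using ih.mul h

lemma isHomOver_frob : IsHomOver E E (frob E) := by
  refine Or.inr ⟨⟨⟨_, ofX E X ^ p, coordY E ^ p⟩, ?_⟩, rfl⟩
  filter_upwards [eventually_affine E] with P hP
  obtain ⟨x, y, h, rfl⟩ := hP
  obtain ⟨h', e⟩ := frob_some h
  refine ⟨_, _, h', e, ?_, (hasValueAt_coordY h).pow p⟩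
  simpa using (hasValueAt_ofX h X).pow p

lemma xRep_frob : XRep (frob E) ![X ^ p, 1] := by
  filter_upwards [eventually_affine E] with P hP
  obtain ⟨x, y, h, rfl⟩ := hP
  obtain ⟨h', e⟩ := frob_some h
  refine ⟨x, y, h, rfl, 1, one_ne_zero, fun i => ?_⟩
  rw [e]
  fin_cases i <;> simp

lemma isPrim_X_pow {k : Type*} [Field k] (n : ℕ) : IsPrim (k := k) ![X ^ n, 1] n where
  natDegree_le i := by fin_cases i <;> simp
  coeff_ne := ⟨0, by simp⟩
  eval_ne z := ⟨1, by simp⟩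

lemma hdeg_frob [E.IsElliptic] : hdeg (frob E) = p :=
  hdeg_eq (isPrim_X_pow p) xRep_frob

/-- Homomorphisms over `𝔽_p` commute with the Frobenius endomorphisms. -/
lemma IsHomOver.frob_comm [E.IsElliptic] {f : GeomPoint E →+ GeomPoint E'}
    (hf : IsHomOver E E' f) (P : GeomPoint E) : f (frob E P) = frob E' (f P) := by
  rcases hf with rfl | ⟨φ, rfl⟩
  · simp
  have key : φ.toHom.comp (frob E) - (frob E').comp φ.toHom = 0 := by
    refine eq_zero_of_eventually_const (Q := 0) ?_
    filter_upwards [φ.eventually_eq,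
      frob_injective.tendsto_cofinite.eventually φ.eventually_eq] with P h1 h2
    obtain ⟨a, b, h, hP, ha, hb⟩ := h1
    obtain ⟨a', b', h', hP', ha', hb'⟩ := h2
    obtain ⟨h'', e⟩ := frob_some h
    rw [AddMonoidHom.sub_apply, AddMonoidHom.comp_apply, AddMonoidHom.comp_apply, hP, hP', e,
      sub_eq_zero]
    obtain rfl := ha'.unique ha.frob
    obtain rfl := hb'.unique hb.frob
    rfl
  have := DFunLike.congr_fun key P
  simpa [sub_eq_zero] using this

variable [E.IsElliptic]

/-- The Frobenius endomorphism as an element of the endomorphism ring. -/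
def frobEnd (E : WeierstrassCurve.Affine (ZMod p)) [E.IsElliptic] : EndOver E :=
  ⟨frob E, isHomOver_frob⟩

/-- The degree as a function on the endomorphism ring. -/
def endDeg {F : Type u} [Field F] (E : WeierstrassCurve.Affine F) [E.IsElliptic]
    (f : EndOver E) : ℤ :=
  hdeg (f.1 : GeomPoint E →+ GeomPoint E)

lemma isNormForm_endDeg {F : Type u} [Field F] (h2 : (2 : F) ≠ 0) (E : WeierstrassCurve.Affine F)
    [E.IsElliptic] : IsNormForm (endDeg E) where
  map_mul a b := by
    have := congrArg (Nat.cast : ℕ → ℤ) (hdeg_comp h2 (f := b.1) (g := a.1) a.2 b.2)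
    push_cast at this
    exact this
  parallelogram a b := by
    have := congrArg (Nat.cast : ℕ → ℤ) (hdeg_add_add_hdeg_sub h2 (f := a.1) (g := b.1) a.2 b.2)
    push_cast at this
    exact this
  map_one := by
    have := congrArg (Nat.cast : ℕ → ℤ) (hdeg_id (E := E))
    push_cast at this
    exact this
  nonneg a := Int.natCast_nonneg _
  eq_zero a h := Subtype.ext (hdeg_eq_zero h2 a.2 (Int.natCast_eq_zero.mp h))

lemma endDeg_frobEnd : endDeg E (frobEnd E) = p :=
  congrArg (Nat.cast : ℕ → ℤ) (hdeg_frob (E := E))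

lemma two_ne_zero_of_lt (hp : 3 < p) : (2 : ZMod p) ≠ 0 := by
  intro h
  have h' : ((2 : ℕ) : ZMod p) = 0 := by exact_mod_cast h
  rw [ZMod.natCast_eq_zero_iff] at h'
  have := Nat.le_of_dvd two_pos h'
  omega

/-- The trace of Frobenius of a supersingular curve is divisible by `p`. -/
lemma dvd_trace (hp : 3 < p) (hE : IsSupersingular p E) :
    (p : ℤ) ∣ (isNormForm_endDeg (two_ne_zero_of_lt hp) E).polar (frobEnd E) 1 := by
  have h2 := two_ne_zero_of_lt hp
  set hq := isNormForm_endDeg h2 E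
  set t := hq.polar (frobEnd E) 1 with ht
  -- The Verschiebung: the characteristic equation of π reads πV = p, so V also has degree p.
  set V : EndOver E := t • (1 : EndOver E) - frobEnd E with hV
  have hpp : (p : ℤ) ≠ 0 := by exact_mod_cast (Fact.out : p.Prime).ne_zero
  have h1 : frobEnd E * V = (p : ℤ) • (1 : EndOver E) := by
    have := hq.mul_self (frobEnd E)
    rw [hV, mul_sub, this, ← ht, endDeg_frobEnd, mul_smul_comm, mul_one]
    abel
  have hdegV : endDeg E V = p := by
    have := congrArg (endDeg E) h1
    rw [hq.map_mul, hq.map_zsmul, hq.map_one, endDeg_frobEnd] at this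
    refine mul_left_cancel₀ hpp ?_
    rw [this]; ring
  -- A point killed by V is killed by p, so it is zero by supersingularity.
  have hinj : Function.Injective (V.1 : GeomPoint E →+ GeomPoint E) := by
    rw [injective_iff_map_eq_zero]
    intro P hP
    refine hE P ?_
    have h3 := DFunLike.congr_fun (congrArg Subtype.val h1) P
    have h4 : frob E (V.1 P) = (p : ℤ) • P := h3
    rw [hP, map_zero] at h4
    rw [← natCast_zsmul]
    exact h4.symm
  obtain ⟨v₁, m₁, p₁, r₁⟩ := IsHomOver.exists_xRep h2 V.2
  have hm₁ : m₁ = p := by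
    have := hdeg_eq p₁ r₁
    have h5 : (hdeg (V.1 : GeomPoint E →+ GeomPoint E) : ℤ) = p := hdegV
    rw [← this]
    exact_mod_cast h5
  have d₁ := derivative_eq_zero_of_injective hinj p₁ (by omega) r₁
  have d₂ : ∀ i, derivative ((![X ^ p, 1] : Fin 2 → (AlgebraicClosure (ZMod p))[X]) i) = 0 := by
    intro i
    fin_cases i <;> simp [derivative_X_pow]
  -- V and π are both inseparable, hence so is their sum t, whose height t² is then divisible by p.
  have hs : V + frobEnd E = t • (1 : EndOver E) := by rw [hV]; abel
  obtain ⟨v₃, m₃, p₃, r₃⟩ := IsHomOver.exists_xRep h2 (V + frobEnd E).2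
  obtain ⟨v₄, m₄, p₄, r₄⟩ := IsHomOver.exists_xRep h2 (V - frobEnd E).2
  have d₃ := derivative_eq_zero_of_add h2 p₁ (isPrim_X_pow p) p₃ p₄ r₁ xRep_frob r₃ r₄ d₁ d₂
  have h6 := p₃.dvd_height (p := p) d₃
  have h7 : (m₃ : ℤ) = t ^ 2 := by
    rw [← hdeg_eq p₃ r₃]
    change endDeg E (V + frobEnd E) = t ^ 2
    rw [hs, hq.map_zsmul, hq.map_one, mul_one]
  have h8 : (p : ℤ) ∣ t ^ 2 := by
    rw [← h7]; exact_mod_cast h6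
  exact (Nat.prime_iff_prime_int.mp Fact.out).dvd_of_dvd_pow h8

/-- The endomorphism ring of a supersingular curve over `𝔽_p` is an order in `ℚ(√-p)` which contains
`ℤ[√-p]` with index at most two. -/
theorem exists_isQuadOrder (hp : 3 < p) (hE : IsSupersingular p E) :
    ∃ inst : CommRing (EndOver E), inst.toRing = (EndOver E).toRing ∧
      IsQuadOrder p (EndOver E) (frobEnd E) := by
  have h2 := two_ne_zero_of_lt hp
  set hq := isNormForm_endDeg h2 E
  have hprime : p.Prime := Fact.out
  have hp4 : 4 < p := by
    rcases Nat.lt_or_ge 4 p with h | h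
    · exact h
    · obtain rfl : p = 4 := by omega
      exact absurd hprime (by norm_num)
  have ht := hq.polar_eq_zero_of_dvd hp4 endDeg_frobEnd (dvd_trace hp hE)
  have hspan : ∀ f : EndOver E, ∃ a k : ℤ, (2 : ℤ) • f = a • (1 : EndOver E) + k • frobEnd E :=
    fun f => hq.exists_two_smul_eq endDeg_frobEnd ht hprime f
      (Subtype.ext (by ext P; exact (IsHomOver.frob_comm f.2 P).symm))
  -- The doubles of f and g lie in ℤ[π], so 4(fg - gf) = 0, and there is no torsion.
  have hcomm : ∀ f g : EndOver E, f * g = g * f := by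
    intro f g
    obtain ⟨a, k, hf⟩ := hspan f
    obtain ⟨b, l, hg⟩ := hspan g
    have h4 : (4 : ℤ) • (f * g - g * f) = 0 := by
      have e1 : ((2 : ℤ) • f) * ((2 : ℤ) • g) = (4 : ℤ) • (f * g) := by
        simp only [smul_mul_assoc, mul_smul_comm]; module
      have e2 : ((2 : ℤ) • g) * ((2 : ℤ) • f) = (4 : ℤ) • (g * f) := by
        simp only [smul_mul_assoc, mul_smul_comm]; module
      rw [smul_sub, ← e1, ← e2, hf, hg]
      simp only [add_mul, mul_add, smul_mul_assoc, mul_smul_comm, mul_one, one_mul]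
      module
    exact sub_eq_zero.mp (hq.zsmul_eq_zero (by norm_num) h4)
  refine ⟨{ (EndOver E).toRing with mul_comm := hcomm }, rfl, ?_⟩
  let inst : CommRing (EndOver E) := { (EndOver E).toRing with mul_comm := hcomm }
  have hodd : Odd p := hprime.odd_of_ne_two (by omega)
  have conv : ∀ (f : EndOver E) (a k : ℤ), 2 * f = (a : EndOver E) + k * frobEnd E ↔
      (2 : ℤ) • f = a • (1 : EndOver E) + k • frobEnd E := by
    intro f a k
    rw [zsmul_eq_mul, zsmul_eq_mul, zsmul_eq_mul, mul_one]
    norm_num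
  constructor
  · have := hq.mul_self_eq_neg endDeg_frobEnd ht
    rw [this, zsmul_eq_mul, mul_one]
    norm_num
  · intro n f hn h
    rw [← zsmul_eq_mul] at h
    exact hq.zsmul_eq_zero hn h
  · intro a k h
    refine hq.combination_eq_zero endDeg_frobEnd ht hprime.ne_zero ?_
    rw [zsmul_eq_mul, zsmul_eq_mul, mul_one]
    exact h
  · intro f
    obtain ⟨a, k, h⟩ := hspan f
    exact ⟨a, k, (conv f a k).mpr h⟩
  · intro f a k h
    exact hq.even_of_two_smul_eq endDeg_frobEnd ht hodd ((conv f a k).mp h)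

end frobenius

end

end IsogenyGraph

namespace IsogenyGraph

noncomputable section

open Polynomial Filter
open scoped Polynomial.Bivariate

universe u

/-! ### Points of order two and the doubling map. -/

section twoTorsion

open WeierstrassCurve WeierstrassCurve.Affine

variable {k : Type*} [Field k]

/-- The `x`-coordinates of the points of order two are `e₁`, `e₂`, `e₃`. -/
structure IsTwoTorsionRoots (W : WeierstrassCurve.Affine k) (e₁ e₂ e₃ : k) : Prop where
  b₂_eq : WeierstrassCurve.b₂ W = -4 * (e₁ + e₂ + e₃)
  b₄_eq : WeierstrassCurve.b₄ W = 2 * (e₁ * e₂ + e₁ * e₃ + e₂ * e₃)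
  b₆_eq : WeierstrassCurve.b₆ W = -4 * (e₁ * e₂ * e₃)

lemma exists_isTwoTorsionRoots [IsAlgClosed k] (h2 : (2 : k) ≠ 0) (W : WeierstrassCurve.Affine k)
    [W.IsElliptic] : ∃ e₁ e₂ e₃, IsTwoTorsionRoots W e₁ e₂ e₃ ∧ e₁ ≠ e₂ ∧ e₁ ≠ e₃ ∧ e₂ ≠ e₃ := by
  have h4 : (4 : k) ≠ 0 := by
    rw [show (4 : k) = 2 * 2 by norm_num]; exact mul_ne_zero h2 h2
  have ha : (twoTorsionPolynomial W).a ≠ 0 := h4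
  obtain ⟨x, y, z, h⟩ := (Cubic.splits_iff_roots_eq_three (φ := RingHom.id k) ha).mp
    (IsAlgClosed.splits _)
  have hb := Cubic.b_eq_three_roots ha h
  have hc := Cubic.c_eq_three_roots ha h
  have hd := Cubic.d_eq_three_roots ha h
  have hdisc := (Cubic.discr_ne_zero_iff_roots_ne ha h).mp
    (twoTorsionPolynomial_discr_ne_zero_of_isElliptic W (isUnit_iff_ne_zero.mpr h2))
  simp only [twoTorsionPolynomial, RingHom.id_apply] at hb hc hd
  refine ⟨x, y, z, ⟨?_, ?_, ?_⟩, hdisc⟩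
  · linear_combination hb
  · refine mul_left_cancel₀ h2 ?_
    linear_combination hc
  · linear_combination hd

variable {W : WeierstrassCurve.Affine k} {e₁ e₂ e₃ : k}

lemma IsTwoTorsionRoots.swap₁₂ (he : IsTwoTorsionRoots W e₁ e₂ e₃) :
    IsTwoTorsionRoots W e₂ e₁ e₃ :=
  ⟨by rw [he.b₂_eq]; ring, by rw [he.b₄_eq]; ring, by rw [he.b₆_eq]; ring⟩

lemma IsTwoTorsionRoots.swap₁₃ (he : IsTwoTorsionRoots W e₁ e₂ e₃) :
    IsTwoTorsionRoots W e₃ e₂ e₁ :=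
  ⟨by rw [he.b₂_eq]; ring, by rw [he.b₄_eq]; ring, by rw [he.b₆_eq]; ring⟩

lemma IsTwoTorsionRoots.sq_eq (he : IsTwoTorsionRoots W e₁ e₂ e₃) {x y : k}
    (h : W.Equation x y) :
    (2 * y + W.a₁ * x + W.a₃) ^ 2 = 4 * ((x - e₁) * (x - e₂) * (x - e₃)) := by
  have h1 := he.b₂_eq
  have h2 := he.b₄_eq
  have h3 := he.b₆_eq
  rw [equation_iff] at h
  rw [WeierstrassCurve.b₂] at h1
  rw [WeierstrassCurve.b₄] at h2
  rw [WeierstrassCurve.b₆] at h3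
  linear_combination 4 * h + x ^ 2 * h1 + 2 * x * h2 + h3

lemma IsTwoTorsionRoots.b₈_eq (he : IsTwoTorsionRoots W e₁ e₂ e₃) (h2 : (2 : k) ≠ 0) :
    WeierstrassCurve.b₈ W = 4 * (e₁ + e₂ + e₃) * (e₁ * e₂ * e₃) -
      (e₁ * e₂ + e₁ * e₃ + e₂ * e₃) ^ 2 := by
  have h := WeierstrassCurve.b_relation W
  rw [he.b₂_eq, he.b₄_eq, he.b₆_eq] at h
  refine mul_left_cancel₀ h2 (mul_left_cancel₀ h2 ?_)
  linear_combination h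

lemma two_mul_Y_eq_zero_iff {x y : k} :
    y = W.negY x y ↔ 2 * y + W.a₁ * x + W.a₃ = 0 := by
  rw [negY]
  constructor <;> intro h <;> linear_combination h

lemma nonsingular_of_isTwoTorsionRoots [W.IsElliptic] (h2 : (2 : k) ≠ 0)
    (he : IsTwoTorsionRoots W e₁ e₂ e₃) :
    W.Nonsingular e₁ (-(W.a₁ * e₁ + W.a₃) / 2) := by
  refine equation_iff_nonsingular.mp ?_
  have h1 := he.b₂_eq
  have h2' := he.b₄_eq
  have h3 := he.b₆_eq
  rw [WeierstrassCurve.b₂] at h1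
  rw [WeierstrassCurve.b₄] at h2'
  rw [WeierstrassCurve.b₆] at h3
  rw [equation_iff]
  refine mul_left_cancel₀ h2 (mul_left_cancel₀ h2 ?_)
  field_simp
  linear_combination -(e₁ ^ 2 * h1 + 2 * e₁ * h2' + h3)

variable [DecidableEq k]

lemma Point.two_nsmul_some_eq_zero_iff {x y : k} {h : W.Nonsingular x y} :
    (Point.some x y h) + (Point.some x y h) = 0 ↔ 2 * y + W.a₁ * x + W.a₃ = 0 := by
  rw [← two_mul_Y_eq_zero_iff]
  constructor
  · intro h0
    by_contra hy
    rw [Point.add_self_of_Y_ne hy] at h0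
    exact Point.some_ne_zero _ h0
  · intro hy
    exact Point.add_self_of_Y_eq hy

/-- The doubling formula in terms of the points of order two. -/
lemma IsTwoTorsionRoots.addX_self_sub (he : IsTwoTorsionRoots W e₁ e₂ e₃) (h2 : (2 : k) ≠ 0)
    {x y : k} (h : W.Equation x y) (hy : y ≠ W.negY x y) :
    (2 * y + W.a₁ * x + W.a₃) ^ 2 * (W.addX x x (W.slope x x y y) - e₁) =
      ((x - e₁) * (x - e₂) + (x - e₁) * (x - e₃) - (x - e₂) * (x - e₃)) ^ 2 := by
  have h1 := addX_self h hy
  rw [he.sq_eq h]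
  rw [he.b₂_eq, he.b₄_eq, he.b₆_eq, he.b₈_eq h2] at h1
  linear_combination h1

/-- In the coordinates Y² = (x - e₁)(x - e₂)(x - e₃), the difference of the cubic and the square of
the chord has roots x₁, x₂ and the x-coordinate of the sum. Evaluate it at e₁. -/
lemma IsTwoTorsionRoots.addX_sub (he : IsTwoTorsionRoots W e₁ e₂ e₃) (h2 : (2 : k) ≠ 0)
    {x₁ y₁ x₂ y₂ : k} (h₁ : W.Equation x₁ y₁) (h₂ : W.Equation x₂ y₂) (hx : x₁ ≠ x₂)
    {Y₁ Y₂ : k} (hY₁ : 2 * Y₁ = 2 * y₁ + W.a₁ * x₁ + W.a₃)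
    (hY₂ : 2 * Y₂ = 2 * y₂ + W.a₁ * x₂ + W.a₃) :
    (W.addX x₁ x₂ (W.slope x₁ x₂ y₁ y₂) - e₁) * ((x₁ - e₁) * (x₂ - e₁)) =
      (Y₁ + (Y₂ - Y₁) / (x₂ - x₁) * (e₁ - x₁)) ^ 2 := by
  have q₁ := he.sq_eq h₁
  have q₂ := he.sq_eq h₂
  rw [← hY₁] at q₁
  rw [← hY₂] at q₂
  have hx' : x₁ - x₂ ≠ 0 := sub_ne_zero.mpr hx
  have hx'' : x₂ - x₁ ≠ 0 := sub_ne_zero.mpr hx.symm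
  have h4 : (4 : k) ≠ 0 := by
    rw [show (4 : k) = 2 * 2 by norm_num]; exact mul_ne_zero h2 h2
  set l := (Y₂ - Y₁) / (x₂ - x₁) with hl
  have hl' : l * (x₂ - x₁) = Y₂ - Y₁ := by rw [hl, div_mul_cancel₀ _ hx'']
  have hs : 2 * W.slope x₁ x₂ y₁ y₂ = 2 * l - W.a₁ := by
    rw [slope_of_X_ne hx]
    refine mul_right_cancel₀ hx'' ?_
    have : (y₁ - y₂) / (x₁ - x₂) * (x₂ - x₁) = y₂ - y₁ := by field_simp; ring
    linear_combination 2 * this - 2 * hl' + hY₁ - hY₂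
  have hX : W.addX x₁ x₂ (W.slope x₁ x₂ y₁ y₂) = l ^ 2 + (e₁ + e₂ + e₃) - x₁ - x₂ := by
    have h1 := he.b₂_eq
    rw [WeierstrassCurve.b₂] at h1
    refine mul_left_cancel₀ h4 ?_
    rw [addX]
    linear_combination (2 * W.slope x₁ x₂ y₁ y₂ + 2 * l + W.a₁) * hs - h1
  rw [hX]
  refine mul_left_cancel₀ (mul_ne_zero h4 hx'') ?_
  have hY : Y₂ = Y₁ + l * (x₂ - x₁) := by rw [hl']; ring
  rw [hY] at q₂
  linear_combination (e₁ - x₂) * q₁ - (e₁ - x₁) * q₂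

/-- The point of order two with `x`-coordinate `e₁`. -/
def twoTorsionPoint [W.IsElliptic] (h2 : (2 : k) ≠ 0) (he : IsTwoTorsionRoots W e₁ e₂ e₃) :
    W.Point :=
  .some _ _ (nonsingular_of_isTwoTorsionRoots h2 he)

lemma twoTorsionPoint_add_self [W.IsElliptic] (h2 : (2 : k) ≠ 0)
    (he : IsTwoTorsionRoots W e₁ e₂ e₃) :
    twoTorsionPoint h2 he + twoTorsionPoint h2 he = 0 := by
  rw [twoTorsionPoint, Point.two_nsmul_some_eq_zero_iff]
  field_simp
  ring

lemma add_self_eq_zero_iff [W.IsElliptic] (h2 : (2 : k) ≠ 0)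
    (he : IsTwoTorsionRoots W e₁ e₂ e₃) (T : W.Point) :
    T + T = 0 ↔ T = 0 ∨ T = twoTorsionPoint h2 he ∨ T = twoTorsionPoint h2 he.swap₁₂ ∨
      T = twoTorsionPoint h2 he.swap₁₃ := by
  constructor
  · rcases T with _ | ⟨x, y, h⟩
    · exact fun _ => Or.inl rfl
    intro h0
    right
    rw [Point.two_nsmul_some_eq_zero_iff] at h0
    have hx := he.sq_eq h.1
    have h4 : (4 : k) ≠ 0 := by
      rw [show (4 : k) = 2 * 2 by norm_num]; exact mul_ne_zero h2 h2
    have hy : y = -(W.a₁ * x + W.a₃) / 2 := by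
      rw [eq_div_iff h2]; linear_combination h0
    subst hy
    rw [h0, zero_pow two_ne_zero, eq_comm, mul_eq_zero, mul_eq_zero, mul_eq_zero] at hx
    rcases hx.resolve_left h4 with (hx | hx) | hx <;> obtain rfl := sub_eq_zero.mp hx
    · exact Or.inl rfl
    · exact Or.inr (Or.inl rfl)
    · exact Or.inr (Or.inr rfl)
  · rintro (rfl | rfl | rfl | rfl)
    · exact add_zero _
    all_goals exact twoTorsionPoint_add_self h2 _

lemma ncard_twoTorsion [IsAlgClosed k] [W.IsElliptic] (h2 : (2 : k) ≠ 0) :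
    {T : W.Point | T + T = 0}.ncard = 4 := by
  obtain ⟨e₁, e₂, e₃, he, h12, h13, h23⟩ := exists_isTwoTorsionRoots h2 W
  have hne : ∀ {a b c a' b' c' : k} (h : IsTwoTorsionRoots W a b c)
      (h' : IsTwoTorsionRoots W a' b' c'), a ≠ a' →
      twoTorsionPoint h2 h ≠ twoTorsionPoint h2 h' :=
    fun h h' hab e => hab (Point.some.inj e).1
  have hne0 : ∀ {a b c : k} (h : IsTwoTorsionRoots W a b c), (0 : W.Point) ≠ twoTorsionPoint h2 h :=
    fun h => (Point.some_ne_zero _).symm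
  have : {T : W.Point | T + T = 0} = (({0, twoTorsionPoint h2 he, twoTorsionPoint h2 he.swap₁₂,
      twoTorsionPoint h2 he.swap₁₃} : Finset W.Point) : Set W.Point) := by
    ext T
    simp [add_self_eq_zero_iff h2 he]
  rw [this, Set.ncard_coe_finset]
  rw [Finset.card_insert_of_notMem, Finset.card_insert_of_notMem, Finset.card_insert_of_notMem,
    Finset.card_singleton]
  · simpa using hne _ _ h23
  · simpa using ⟨hne _ _ h12, hne _ _ h13⟩
  · simpa using ⟨hne0 _, hne0 _, hne0 _⟩

/-- Multiplication by two is surjective on the points over an algebraically closed field. -/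
lemma exists_add_self_eq [IsAlgClosed k] [W.IsElliptic] (P : W.Point) : ∃ Q, Q + Q = P := by
  rcases P with _ | ⟨a, b, hab⟩
  · exact ⟨0, add_zero _⟩
  -- The roots of this quartic are the x-coordinates whose double, by the duplication formula, has
  -- x-coordinate a.
  set r : k[X] := X ^ 4 - C (WeierstrassCurve.b₄ W) * X ^ 2 - C (2 * WeierstrassCurve.b₆ W) * X -
    C (WeierstrassCurve.b₈ W) - C a * (C 4 * X ^ 3 + C (WeierstrassCurve.b₂ W) * X ^ 2 +
      C (2 * WeierstrassCurve.b₄ W) * X + C (WeierstrassCurve.b₆ W)) with hr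
  have hdeg : r.natDegree = 4 := by
    rw [hr]; compute_degree!
  obtain ⟨z, hz⟩ := IsAlgClosed.exists_root r (by
    intro h0
    have := natDegree_eq_zero_iff_degree_le_zero.mpr h0.le
    omega)
  have hz' : z ^ 4 - WeierstrassCurve.b₄ W * z ^ 2 - 2 * WeierstrassCurve.b₆ W * z -
      WeierstrassCurve.b₈ W = a * (4 * z ^ 3 + WeierstrassCurve.b₂ W * z ^ 2 +
        2 * WeierstrassCurve.b₄ W * z + WeierstrassCurve.b₆ W) := by
    rw [IsRoot, hr] at hz
    simp at hz
    linear_combination hz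
  obtain ⟨w, hw⟩ := IsAlgClosed.exists_root (W.polynomial.map (evalRingHom z)) (by
    rw [Monic.degree_map monic_polynomial, degree_polynomial]
    decide)
  have heq : W.Equation z w := by
    rw [Equation, ← hw, eval_map, eval₂_evalRingHom]
  have hns := equation_iff_nonsingular.mp heq
  -- Numerator and denominator of the duplication formula have no common zero, as a special case of
  -- `addSubMap_ne_zero`.
  have hpsi : 4 * z ^ 3 + WeierstrassCurve.b₂ W * z ^ 2 + 2 * WeierstrassCurve.b₄ W * z +
      WeierstrassCurve.b₆ W ≠ 0 := by
    intro h0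
    rw [h0, mul_zero] at hz'
    have hne := addSubMap_ne_zero W (x := ![z * z, z + z, 1]) (by
      intro h
      simpa using congrFun h 2)
    refine hne ?_
    rw [addSubMap_eval_cons]
    ext i
    fin_cases i
    · simp; linear_combination hz'
    · simp; linear_combination h0
    · simp; ring
  have hy : w ≠ W.negY z w := by
    intro hy
    rw [two_mul_Y_eq_zero_iff] at hy
    refine hpsi ?_
    rw [equation_iff] at heq
    simp only [WeierstrassCurve.b₂, WeierstrassCurve.b₄, WeierstrassCurve.b₆]
    linear_combination (2 * w + W.a₁ * z + W.a₃) * hy - 4 * heq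
  have hx : W.addX z z (W.slope z z w w) = a := by
    refine mul_left_cancel₀ hpsi ?_
    rw [addX_self heq hy, hz', mul_comm]
  have hQ := Point.add_self_of_Y_ne (h₁ := hns) hy
  -- The double of the point found is P or -P; in the second case its negative works.
  rcases Point.X_eq_iff (h₁ := hab) (h₂ := (nonsingular_add hns hns fun h => hy h.2)).mp hx.symm
    with h | h
  · exact ⟨_, hQ.trans h.symm⟩
  · refine ⟨-.some z w hns, ?_⟩
    rw [← neg_add, hQ, h]

end twoTorsion

end

end IsogenyGraph

namespace IsogenyGraph

noncomputable section

open Polynomial Filter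
open scoped Polynomial.Bivariate

universe u

/-! ### Pullbacks of rational functions, and the division of 1 + π by two. -/

section pullback

open WeierstrassCurve.Affine (Point)

variable {F : Type u} [Field F] {E E' : WeierstrassCurve.Affine F}

/-- Two rational functions with the same values at almost all points are equal. -/
lemma eq_of_eventually_hasValueAt [E.IsElliptic] {u v : E.FunctionField}
    (h : ∀ᶠ P : GeomPoint E in cofinite, ∃ c, HasValueAt E u P c ∧ HasValueAt E v P c) :
    u = v := by
  by_contra hne
  obtain ⟨P, ⟨c, h1, h2⟩, h3⟩ := (h.and (eventually_ne_zero (sub_ne_zero.mpr hne))).exists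
  exact h3 _ (h1.sub h2) (sub_self c)

/-- The rational function `u` is the pullback of `w` along `φ`. -/
def IsPullback (φ : Isogeny E E') (w : E'.FunctionField) (u : E.FunctionField) : Prop :=
  ∀ᶠ P in cofinite, ∃ c, HasValueAt E' w (φ.toHom P) c ∧ HasValueAt E u P c

lemma exists_isPullback [E.IsElliptic] (φ : Isogeny E E') (w : E'.FunctionField) :
    ∃ u, IsPullback φ w u := by
  obtain ⟨a, d, hd, rfl⟩ := IsFractionRing.div_surjective (A := E'.CoordinateRing) w
  have hd0 := nonZeroDivisors.ne_zero hd
  obtain ⟨A, rfl⟩ := AdjoinRoot.mk_surjective a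
  obtain ⟨D, rfl⟩ := AdjoinRoot.mk_surjective d
  refine ⟨aevalAeval φ.x φ.y A / aevalAeval φ.x φ.y D, ?_⟩
  filter_upwards [φ.eventually_eq,
    φ.tendsto_cofinite.eventually (eventually_affine_ne_zero hd0)] with P hP hD
  obtain ⟨a, b, h, hP, h1, h2⟩ := hP
  obtain ⟨a', b', h', hP', hne⟩ := hD
  rw [hP] at hP' ⊢
  obtain ⟨rfl, rfl⟩ := Point.some.inj hP'
  refine ⟨_, (hasValueAt_coe h _).div (hasValueAt_coe h _) hne, ?_⟩
  rw [evalGeom_mk] at hne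
  rw [evalGeom_mk, evalGeom_mk]
  exact (h1.poly h2 A).div (h1.poly h2 D) hne

lemma IsPullback.neg {φ : Isogeny E E'} {w : E'.FunctionField} {u : E.FunctionField}
    (h : IsPullback φ w u) : IsPullback φ (-w) (-u) := by
  filter_upwards [h] with P hP
  obtain ⟨c, h1, h2⟩ := hP
  exact ⟨-c, h1.neg, h2.neg⟩

end pullback

section halving

open WeierstrassCurve.Affine (Point)

variable {p : ℕ} [Fact p.Prime] {E : WeierstrassCurve.Affine (ZMod p)}

/-- An element of the algebraic closure fixed by Frobenius lies in the prime field. -/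
lemma exists_algebraMap_eq {x : AlgebraicClosure (ZMod p)} (hx : x ^ p = x) :
    ∃ a, algebraMap (ZMod p) (AlgebraicClosure (ZMod p)) a = x := by
  set q : (ZMod p)[X] := X ^ p - X with hq
  have hsplit : q.Splits := by
    have h1 := FiniteField.roots_X_pow_card_sub_X (ZMod p)
    rw [ZMod.card] at h1
    rw [splits_iff_card_roots, hq, h1, FiniteField.X_pow_card_sub_X_natDegree_eq _
      (Fact.out : p.Prime).one_lt]
    exact ZMod.card p
  have hq0 : q ≠ 0 := FiniteField.X_pow_card_sub_X_ne_zero (ZMod p) (Fact.out : p.Prime).one_lt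
  have hroot : x ∈ (q.map (algebraMap (ZMod p) (AlgebraicClosure (ZMod p)))).roots := by
    rw [mem_roots_map hq0, hq]
    simp [hx]
  rw [hsplit.roots_map, Multiset.mem_map] at hroot
  obtain ⟨a, -, ha⟩ := hroot
  exact ⟨a, ha⟩

/-- The rational function `y + (a₁ x + a₃) / 2`, evaluated at two rational functions. -/
def completed (E : WeierstrassCurve.Affine (ZMod p)) (x y : E.FunctionField) : E.FunctionField :=
  y + (algebraMap (ZMod p) _ E.a₁ * x + algebraMap (ZMod p) _ E.a₃) / algebraMap (ZMod p) _ 2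

lemma hasValueAt_completed (h2 : (2 : ZMod p) ≠ 0) {u v : E.FunctionField} {P : GeomPoint E}
    {x y : AlgebraicClosure (ZMod p)} (hu : HasValueAt E u P x) (hv : HasValueAt E v P y) :
    ∃ η, HasValueAt E (completed E u v) P η ∧
      2 * η = 2 * y + (geom E).a₁ * x + (geom E).a₃ := by
  have hk := hasValueAt_const hu
  have h2' : algebraMap (ZMod p) (AlgebraicClosure (ZMod p)) 2 ≠ 0 :=
    (_root_.map_ne_zero _).mpr h2
  refine ⟨_, hv.add ((((hk E.a₁).mul hu).add (hk E.a₃)).div (hk 2) h2'), ?_⟩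
  rw [map_ofNat] at h2' ⊢
  simp only [WeierstrassCurve.map_a₁, WeierstrassCurve.map_a₃]
  field_simp
  ring

/-- If the point of order two with `x`-coordinate `a` is rational, then `x - a` is a square at the
sum of the generic point and its Frobenius conjugate. -/
lemma exists_sqrt [E.IsElliptic] (hp : 3 < p) {a : ZMod p} {e₂ e₃ : AlgebraicClosure (ZMod p)}
    (he : IsTwoTorsionRoots (geom E) (algebraMap _ _ a) e₂ e₃) :
    ∃ r : E.FunctionField, ∀ᶠ P : GeomPoint E in cofinite, ∀ x y h,
      P + frob E P = .some x y h → ∃ ρ, HasValueAt E r P ρ ∧ ρ ^ 2 = x - algebraMap _ _ a := by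
  have h2 := two_ne_zero_of_lt hp
  have h2' : (2 : AlgebraicClosure (ZMod p)) ≠ 0 := by
    rw [← map_ofNat (algebraMap (ZMod p) (AlgebraicClosure (ZMod p)))]
    exact (_root_.map_ne_zero _).mpr h2
  set e := algebraMap (ZMod p) (AlgebraicClosure (ZMod p)) a with he_def
  set Yf := completed E (ofX E X) (coordY E) with hYf
  set l := (Yf ^ p - Yf) / (ofX E X ^ p - ofX E X) with hl
  have hne1 : ofX E X ^ p - ofX E X ≠ 0 := by
    rw [← map_pow, ← map_sub]
    exact (map_ne_zero_iff _ ofX_injective).mpr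
      (FiniteField.X_pow_card_sub_X_ne_zero (ZMod p) (by omega))
  have hne2 : ofX E X - algebraMap (ZMod p) _ a ≠ 0 := by
    have : algebraMap (ZMod p) E.FunctionField a = ofX E (C a) := by
      rw [IsScalarTower.algebraMap_apply (ZMod p) E.CoordinateRing E.FunctionField]; rfl
    rw [this, ← map_sub]
    exact (map_ne_zero_iff _ ofX_injective).mpr (X_sub_C_ne_zero a)
  -- By `addX_sub`, x(P + πP) - a times (x - a)(xᵖ - a) is the square of the chord at a. As a lies
  -- in 𝔽_p and p is odd, (x - a)(xᵖ - a) = (x - a)^(p + 1) is a square.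
  refine ⟨(Yf + l * (algebraMap (ZMod p) _ a - ofX E X)) /
    (ofX E X - algebraMap (ZMod p) _ a) ^ ((p + 1) / 2), ?_⟩
  filter_upwards [eventually_affine E, eventually_ne_zero hne1, eventually_ne_zero hne2] with
    P hP hn1 hn2 x₃ y₃ h₃ hsum
  obtain ⟨x, y, h, rfl⟩ := hP
  obtain ⟨h', hfr⟩ := frob_some h
  have vx : HasValueAt E (ofX E X) (.some x y h) x := by
    simpa using hasValueAt_ofX h X
  have va := hasValueAt_algebraMap h a
  obtain ⟨η, vY, hY⟩ := hasValueAt_completed h2 vx (hasValueAt_coordY h)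
  have hx1 := hn1 _ ((vx.pow p).sub vx)
  have hx2 := hn2 _ (vx.sub va)
  have vr := (vY.add ((((vY.pow p).sub vY).div ((vx.pow p).sub vx) hx1).mul (va.sub vx))).div
    ((vx.sub va).pow ((p + 1) / 2)) (pow_ne_zero _ hx2)
  refine ⟨_, vr, ?_⟩
  have hxne : x ≠ x ^ p := fun h0 => hx1 (by rw [← h0, sub_self])
  have hY' : 2 * η ^ p = 2 * y ^ p + (geom E).a₁ * x ^ p + (geom E).a₃ := by
    have := congrArg (frobAlg p) hY
    simp only [map_mul, map_add, map_ofNat, WeierstrassCurve.map_a₁, WeierstrassCurve.map_a₃,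
      AlgHom.commutes] at this
    simp only [frobAlg_apply] at this
    exact this
  have key := he.addX_sub h2' h.1 h'.1 hxne hY hY'
  rw [hfr, Point.add_of_X_ne hxne] at hsum
  obtain ⟨hx₃, -⟩ := Point.some.inj hsum
  rw [hx₃] at key
  have hxe : x ^ p - e = (x - e) ^ p := by
    rw [← frobAlg_apply, ← frobAlg_apply, map_sub, he_def, AlgHom.commutes]
  have hodd : Odd p := (Fact.out : p.Prime).odd_of_ne_two (by omega)
  have hpow : ((x - e) ^ ((p + 1) / 2)) ^ 2 = (x - e) * (x ^ p - e) := by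
    rw [hxe, ← pow_mul, ← pow_succ']
    congr 1
    obtain ⟨m, rfl⟩ := hodd
    omega
  rw [div_pow, ← key, hpow, mul_div_assoc, div_self, mul_one]
  rw [hxe]
  exact mul_ne_zero hx2 (pow_ne_zero _ hx2)

/-- The square roots at a double are pullbacks under multiplication by two. -/
lemma exists_isPullback_sqrt [E.IsElliptic] (hp : 3 < p) {τ ψ : Isogeny E E}
    (hτ : ∀ P, τ.toHom P = P + P) (hψ : ∀ P, ψ.toHom P = P + frob E P) {a b c : ZMod p}
    (he : IsTwoTorsionRoots (geom E) (algebraMap _ _ a) (algebraMap _ _ b) (algebraMap _ _ c)) :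
    ∃ w s : E.FunctionField, IsPullback τ w s ∧ ∀ᶠ Q : GeomPoint E in cofinite, ∀ x y h,
      ψ.toHom Q = .some x y h → ∃ σ, HasValueAt E s Q σ ∧
        2 * y + (geom E).a₁ * x + (geom E).a₃ ≠ 0 ∧
        σ * (2 * y + (geom E).a₁ * x + (geom E).a₃) =
          (x - algebraMap _ _ a) * (x - algebraMap _ _ b) +
          (x - algebraMap _ _ a) * (x - algebraMap _ _ c) -
          (x - algebraMap _ _ b) * (x - algebraMap _ _ c) := by
  have h2 := two_ne_zero_of_lt hp
  have h2' : (2 : AlgebraicClosure (ZMod p)) ≠ 0 := by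
    rw [← map_ofNat (algebraMap (ZMod p) (AlgebraicClosure (ZMod p)))]
    exact (_root_.map_ne_zero _).mpr h2
  obtain ⟨r, hr⟩ := exists_sqrt hp he
  obtain ⟨r', hr'⟩ := exists_isPullback τ r
  set k := algebraMap (ZMod p) E.FunctionField
  -- The square root of x(2R) - a at R = ψ(Q), taken from the doubling formula `addX_self_sub`.
  set s := ((ψ.x - k a) * (ψ.x - k b) + (ψ.x - k a) * (ψ.x - k c) - (ψ.x - k b) * (ψ.x - k c)) /
    (2 * completed E ψ.x ψ.y) with hs
  have hsv : ∀ᶠ Q : GeomPoint E in cofinite, ∀ x y h,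
      ψ.toHom Q = .some x y h → ∃ σ, HasValueAt E s Q σ ∧
        2 * y + (geom E).a₁ * x + (geom E).a₃ ≠ 0 ∧
        σ * (2 * y + (geom E).a₁ * x + (geom E).a₃) =
          (x - algebraMap _ _ a) * (x - algebraMap _ _ b) +
          (x - algebraMap _ _ a) * (x - algebraMap _ _ c) -
          (x - algebraMap _ _ b) * (x - algebraMap _ _ c) := by
    filter_upwards [ψ.eventually_eq, ψ.tendsto_cofinite.eventually
      (τ.tendsto_cofinite.eventually ((Set.finite_singleton 0).eventually_cofinite_notMem))] with
      Q h1 hne x y h hQ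
    obtain ⟨x', y', h', hQ', vx, vy⟩ := h1
    rw [hQ] at hQ' hne
    obtain ⟨rfl, rfl⟩ := Point.some.inj hQ'
    rw [Set.mem_singleton_iff, hτ, Point.two_nsmul_some_eq_zero_iff] at hne
    have hk := hasValueAt_const vx
    obtain ⟨η, vY, hY⟩ := hasValueAt_completed h2 vx vy
    have v2 : HasValueAt E 2 Q 2 := by simpa only [map_ofNat] using hk 2
    have hA := vx.sub (hk a)
    have hB := vx.sub (hk b)
    have hC := vx.sub (hk c)
    have v2Y := v2.mul vY
    rw [hY] at v2Y
    refine ⟨_, (((hA.mul hB).add (hA.mul hC)).sub (hB.mul hC)).div v2Y hne, hne, ?_⟩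
    rw [div_mul_cancel₀ _ hne]
  -- Since 2ψ(Q) = ψ(2Q), both functions square to x(2ψ(Q)) - a. They agree up to sign, and the sign
  -- is absorbed into `w`.
  have hsq : s * s = r' * r' := by
    refine eq_of_eventually_hasValueAt ?_
    filter_upwards [ψ.eventually_eq, hsv, hr', τ.tendsto_cofinite.eventually hr] with
      Q h1 h2s h3 h4
    obtain ⟨x, y, h, hQ, -, -⟩ := h1
    obtain ⟨σ, vσ, hne, hσ⟩ := h2s x y h hQ
    obtain ⟨ρ, v1, v2⟩ := h3
    have hy : y ≠ (geom E).negY x y := fun hy => hne (two_mul_Y_eq_zero_iff.mp hy)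
    have h5 : τ.toHom Q + frob E (τ.toHom Q) = .some x y h + .some x y h := by
      rw [← hQ, hψ, hτ, map_add]
      abel
    rw [Point.add_self_of_Y_ne hy] at h5
    obtain ⟨ρ', v3, hρ'⟩ := h4 _ _ _ h5
    obtain rfl := v1.unique v3
    refine ⟨σ * σ, vσ.mul vσ, ?_⟩
    have h6 := he.addX_self_sub h2' h.1 hy
    rw [← hρ', ← hσ] at h6
    have h7 : σ * σ = ρ * ρ := by
      refine mul_left_cancel₀ (pow_ne_zero 2 hne) ?_
      linear_combination -h6
    rw [h7]
    exact v2.mul v2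
  rcases mul_self_eq_mul_self_iff.mp hsq with h | h
  · exact ⟨r, s, h ▸ hr', hsv⟩
  · exact ⟨-r, s, h ▸ hr'.neg, hsv⟩

/-- If the points of order two are rational, then `1 + π` is divisible by two. -/
theorem exists_half [E.IsElliptic] (hp : 3 < p)
    (hrat : ∀ T : GeomPoint E, T + T = 0 → frob E T = T) :
    ∃ g : GeomPoint E →+ GeomPoint E, IsHomOver E E g ∧ ∀ Q, g (Q + Q) = Q + frob E Q := by
  have h2 := two_ne_zero_of_lt hp
  have h2' : (2 : AlgebraicClosure (ZMod p)) ≠ 0 := by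
    rw [← map_ofNat (algebraMap (ZMod p) (AlgebraicClosure (ZMod p)))]
    exact (_root_.map_ne_zero _).mpr h2
  have hone := isHomOver_id E
  have hroot : ∀ {e₁ e₂ e₃ : AlgebraicClosure (ZMod p)}, IsTwoTorsionRoots (geom E) e₁ e₂ e₃ →
      ∃ a, algebraMap (ZMod p) (AlgebraicClosure (ZMod p)) a = e₁ := by
    intro e₁ e₂ e₃ he
    have h1 := hrat _ (twoTorsionPoint_add_self h2' he)
    obtain ⟨h', e⟩ := frob_some (E := E) (nonsingular_of_isTwoTorsionRoots h2' he)
    exact exists_algebraMap_eq (Point.some.inj (e.symm.trans h1)).1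
  obtain ⟨e₁, e₂, e₃, he, -⟩ := exists_isTwoTorsionRoots h2' (geom E)
  obtain ⟨a, rfl⟩ := hroot he
  obtain ⟨b, rfl⟩ := hroot he.swap₁₂
  obtain ⟨c, rfl⟩ := hroot he.swap₁₃
  set D : GeomPoint E →+ GeomPoint E := AddMonoidHom.id _ + AddMonoidHom.id _ with hD
  set H : GeomPoint E →+ GeomPoint E := AddMonoidHom.id _ + frob E with hH
  have hDsurj : Function.Surjective D := fun P => exists_add_self_eq P
  have hker : D.ker ≤ H.ker := fun T hT => by
    have hT' : T + T = 0 := hT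
    rw [AddMonoidHom.mem_ker]
    change T + frob E T = 0
    rw [hrat T hT', hT']
  -- As a map of groups, 1 + π factors through the surjective doubling map, because it kills the
  -- rational 2-torsion. It remains to find rational functions describing the quotient.
  set g : GeomPoint E →+ GeomPoint E := D.liftOfSurjective hDsurj ⟨H, hker⟩ with hg
  have hgD : ∀ Q, g (Q + Q) = Q + frob E Q := fun Q =>
    D.liftOfRightInverse_comp_apply _ _ ⟨H, hker⟩ Q
  refine ⟨g, ?_, hgD⟩
  rcases hone.add (isHomOver_frob (E := E)) with hψ0 | ⟨ψ, hψ⟩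
  · left
    ext1 P
    obtain ⟨Q, rfl⟩ := exists_add_self_eq P
    exact (hgD Q).trans (DFunLike.congr_fun hψ0 Q)
  rcases hone.add hone with hτ0 | ⟨τ, hτ⟩
  · have h4 := (isNormForm_endDeg h2 E).map_zsmul 2 1
    have h5 : (2 : ℤ) • (1 : EndOver E) = 0 := by
      rw [two_zsmul]
      exact Subtype.ext hτ0
    rw [h5, (isNormForm_endDeg h2 E).map_zero, (isNormForm_endDeg h2 E).map_one] at h4
    norm_num at h4
  have hτ' : ∀ P, τ.toHom P = P + P := fun P => DFunLike.congr_fun hτ P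
  have hψ' : ∀ P, ψ.toHom P = P + frob E P := fun P => DFunLike.congr_fun hψ P
  obtain ⟨w₁, s₁, hw₁, hs₁⟩ := exists_isPullback_sqrt hp hτ' hψ' he
  obtain ⟨w₂, s₂, hw₂, hs₂⟩ := exists_isPullback_sqrt hp hτ' hψ' he.swap₁₂
  obtain ⟨w₃, s₃, hw₃, hs₃⟩ := exists_isPullback_sqrt hp hτ' hψ' he.swap₁₃
  set k := algebraMap (ZMod p) E.FunctionField
  -- A point R = (x, y) is recovered from 2R and the square roots sᵢ of x(2R) - eᵢ: with η = 2y +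
  -- a₁x + a₃, one has s₁s₂ + s₁s₃ + s₂s₃ = x - x(2R) and (s₁ + s₂)(s₁ + s₃)(s₂ + s₃) = η / 2. For R
  -- = ψ(Q) = g(2Q), both x(2R) = x(ψ(2Q)) and the sᵢ are functions of 2Q.
  set Wx := ψ.x + (w₁ * w₂ + w₁ * w₃ + w₂ * w₃) with hWx
  set Wy := (w₁ + w₂) * (w₁ + w₃) * (w₂ + w₃) - (k E.a₁ * Wx + k E.a₃) / k 2 with hWy
  right
  refine ⟨⟨⟨g, Wx, Wy⟩, ?_⟩, rfl⟩
  have key : ∀ᶠ Q : GeomPoint E in cofinite, ∃ x y, ∃ h, g (Q + Q) = .some x y h ∧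
      HasValueAt E Wx (Q + Q) x ∧ HasValueAt E Wy (Q + Q) y := by
    filter_upwards [ψ.eventually_eq, τ.tendsto_cofinite.eventually ψ.eventually_eq, hw₁, hw₂, hw₃,
      hs₁, hs₂, hs₃] with Q q0 q1 q2 q3 q4 q5 q6 q7
    obtain ⟨x, y, h, hQ, -, -⟩ := q0
    obtain ⟨σ₁, v₁, hne, d₁⟩ := q5 x y h hQ
    obtain ⟨σ₂, v₂, -, d₂⟩ := q6 x y h hQ
    obtain ⟨σ₃, v₃, -, d₃⟩ := q7 x y h hQ
    obtain ⟨σ, u₁, v⟩ := q2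
    rw [v.unique v₁] at u₁
    obtain ⟨σ, u₂, v⟩ := q3
    rw [v.unique v₂] at u₂
    obtain ⟨σ, u₃, v⟩ := q4
    rw [v.unique v₃] at u₃
    obtain ⟨x₂, y₂, h₂, hQ₂, vx, -⟩ := q1
    rw [hτ'] at vx u₁ u₂ u₃
    have hy : y ≠ (geom E).negY x y := fun hy => hne (two_mul_Y_eq_zero_iff.mp hy)
    have h5 : ψ.toHom (τ.toHom Q) = .some x y h + .some x y h := by
      rw [← hQ, hτ', map_add]
    rw [Point.add_self_of_Y_ne hy, hQ₂] at h5
    obtain ⟨hx₂, -⟩ := Point.some.inj h5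
    have h6 := he.addX_self_sub h2' h.1 hy
    rw [← hx₂] at h6
    have hsq := he.sq_eq h.1
    set η := 2 * y + (geom E).a₁ * x + (geom E).a₃ with hη
    set A := x - algebraMap (ZMod p) (AlgebraicClosure (ZMod p)) a with hA
    set B := x - algebraMap (ZMod p) (AlgebraicClosure (ZMod p)) b with hB
    set C' := x - algebraMap (ZMod p) (AlgebraicClosure (ZMod p)) c with hC
    have e₁₂ : (σ₁ + σ₂) * η = 2 * (A * B) := by linear_combination d₁ + d₂
    have e₁₃ : (σ₁ + σ₃) * η = 2 * (A * C') := by linear_combination d₁ + d₃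
    have e₂₃ : (σ₂ + σ₃) * η = 2 * (B * C') := by linear_combination d₂ + d₃
    have hx : x₂ + (σ₁ * σ₂ + σ₁ * σ₃ + σ₂ * σ₃) = x := by
      refine mul_left_cancel₀ (pow_ne_zero 2 hne) ?_
      linear_combination h6 - (σ₁ * η + (A * B + A * C' - B * C')) * d₁ +
        (σ₁ + σ₃) * η * e₁₂ + 2 * (A * B) * e₁₃ - A * hsq
    have hy' : 2 * ((σ₁ + σ₂) * (σ₁ + σ₃) * (σ₂ + σ₃)) = η := by
      refine mul_left_cancel₀ (pow_ne_zero 3 hne) ?_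
      linear_combination 2 * (σ₁ + σ₃) * η * (σ₂ + σ₃) * η * e₁₂ +
        4 * (A * B) * (σ₂ + σ₃) * η * e₁₃ + 8 * (A * B) * (A * C') * e₂₃ -
        (η ^ 2 + 4 * (A * B * C')) * hsq
    have vWx : HasValueAt E Wx (Q + Q) x := by
      rw [← hx]
      exact vx.add (((u₁.mul u₂).add (u₁.mul u₃)).add (u₂.mul u₃))
    refine ⟨x, y, h, by rw [hgD, ← hψ', hQ], vWx, ?_⟩
    have hk := hasValueAt_const vx
    have h2'' : algebraMap (ZMod p) (AlgebraicClosure (ZMod p)) 2 ≠ 0 :=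
      (_root_.map_ne_zero _).mpr h2
    have vWy := (((u₁.add u₂).mul (u₁.add u₃)).mul (u₂.add u₃)).sub
      ((((hk E.a₁).mul vWx).add (hk E.a₃)).div (hk 2) h2'')
    convert vWy using 1
    rw [map_ofNat, eq_sub_iff_add_eq, ← mul_right_inj' h2', hy', hη]
    simp only [WeierstrassCurve.map_a₁, WeierstrassCurve.map_a₃]
    field_simp
    ring
  -- Every point is a double, so the exceptional points lie in the image under doubling of a finite
  -- set.
  refine Set.Finite.subset ((eventually_cofinite.mp key).image D) ?_
  intro P hP
  obtain ⟨Q, rfl⟩ := exists_add_self_eq P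
  exact ⟨Q, hP, rfl⟩

end halving

end

end IsogenyGraph

namespace IsogenyGraph

noncomputable section

open Polynomial Filter
open scoped Polynomial.Bivariate

universe u

/-! ### Even degree from a point of order two in the kernel. -/

section involution

variable {k : Type*} [Field k]

/-- Proportional primitive tuples of the same height differ by a constant. -/
lemma IsPrim.exists_eq_C_mul [IsAlgClosed k] {ι : Type*} {v w : ι → k[X]} {m : ℕ} (hv : IsPrim v m)
    (hw : IsPrim w m) (h : ∀ i j, v i * w j = v j * w i) : ∃ c, ∀ i, w i = C c * v i := by
  obtain ⟨i, hi⟩ := hv.coeff_ne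
  have h2 := hw.dvd_of_proportional (w := v) (fun i j => by rw [mul_comm, h j i, mul_comm]) i
  have hv0 : v i ≠ 0 := by rintro h0; simp [h0] at hi
  have hw0 : w i ≠ 0 := by rintro h0; rw [h0] at h2; exact hv0 (zero_dvd_iff.mp h2)
  obtain ⟨g, hg⟩ := hv.dvd_of_proportional h i
  have hg0 : g ≠ 0 := by rintro rfl; exact hw0 (by rw [hg, mul_zero])
  have hdeg : g.natDegree = 0 := by
    have h3 := hw.natDegree_le i
    have h4 := le_natDegree_of_ne_zero hi
    rw [hg, natDegree_mul hv0 hg0] at h3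
    omega
  obtain ⟨c, rfl⟩ := natDegree_eq_zero.mp hdeg
  refine ⟨c, fun j => mul_left_cancel₀ hv0 ?_⟩
  rw [h i j, hg]
  ring

lemma isPrim_mobius {e r : k} (hr : r ≠ 0) :
    IsPrim (k := k) ![C e * (X - C e) + C r, X - C e] 1 where
  natDegree_le i := by
    fin_cases i
    · refine natDegree_add_le_of_degree_le ((natDegree_C_mul_le _ _).trans ?_) (by simp)
      simp
    · simp
  coeff_ne := ⟨1, by simp⟩
  eval_ne z := by
    by_cases hz : z = e
    · exact ⟨0, by simpa [hz] using hr⟩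
    · exact ⟨1, by simpa using sub_ne_zero.mpr hz⟩

/-- A rational function invariant under the involution `x ↦ e + r / (x - e)` has even height. -/
lemma IsPrim.even_of_proportional [IsAlgClosed k] (h2 : (2 : k) ≠ 0) {v : Fin 2 → k[X]} {m : ℕ}
    {e r : k} (hr : r ≠ 0) (hv : IsPrim v m)
    (h : ∀ i j, v i * MvPolynomial.aeval ![C e * (X - C e) + C r, X - C e] ((v j).homogenize m) =
      v j * MvPolynomial.aeval ![C e * (X - C e) + C r, X - C e] ((v i).homogenize m)) :
    Even m := by
  have hw := hv.homogenize (isPrim_mobius (e := e) hr)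
  rw [mul_one] at hw
  obtain ⟨c, hc⟩ := hv.exists_eq_C_mul hw h
  -- The fixed points of the involution are e ± s with s² = r. There the homogenized tuple is s^m
  -- times `v`, and it is also c times `v`. Using both s and -s gives s^m = (-s)^m.
  have key : ∀ s : k, s ^ 2 = r → s ^ m = c := by
    intro s hs
    have hs0 : s ≠ 0 := by rintro rfl; exact hr (by rw [← hs]; ring)
    obtain ⟨i, hi⟩ := hv.eval_ne (e + s)
    have h1 := congrArg (eval (e + s)) (hc i)
    rw [eval_aeval_form, eval_homogenize (hv.natDegree_le i) _ (by simpa using hs0)] at h1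
    have h3 : (C e * (X - C e) + C r : k[X]).eval (e + s) / (X - C e : k[X]).eval (e + s) =
        e + s := by
      simp only [eval_add, eval_mul, eval_sub, eval_C, eval_X]
      rw [add_sub_cancel_left, div_eq_iff hs0, ← hs]
      ring
    simp only [Matrix.cons_val_zero, Matrix.cons_val_one] at h1
    rw [h3, eval_mul, eval_C, eval_sub, eval_X, eval_C, add_sub_cancel_left, mul_comm] at h1
    exact mul_right_cancel₀ hi h1
  obtain ⟨s, hs⟩ := IsAlgClosed.exists_pow_nat_eq r (n := 2) (by norm_num)
  have hs0 : s ≠ 0 := by rintro rfl; exact hr (by rw [← hs]; ring)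
  by_contra hm
  have h3 := (key s hs).trans (key (-s) (by rw [neg_sq, hs])).symm
  rw [(Nat.not_even_iff_odd.mp hm).neg_pow, eq_neg_iff_add_eq_zero, ← two_mul] at h3
  exact (mul_ne_zero h2 (pow_ne_zero _ hs0)) h3

end involution

section translation

open WeierstrassCurve.Affine (Point)

/-- Translation by a point of order two is an involution of the `x`-coordinates. -/
lemma add_two_torsion {k : Type*} [Field k] [DecidableEq k] {W : WeierstrassCurve.Affine k}
    (h2 : (2 : k) ≠ 0) {e t x y : k} {hT : W.Nonsingular e t} {h : W.Nonsingular x y}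
    (ht : Point.some e t hT + Point.some e t hT = 0) (hx : x ≠ e) :
    ∃ x' y', ∃ h', Point.some x y h + Point.some e t hT = .some x' y' h' ∧
      (x' - e) * (x - e) = (6 * e ^ 2 + WeierstrassCurve.b₂ W * e + WeierstrassCurve.b₄ W) / 2 := by
  rw [Point.two_nsmul_some_eq_zero_iff] at ht
  refine ⟨_, _, _, Point.add_some fun H => hx H.1, ?_⟩
  have h1 := addX_add_addX h.1 hT.1 hx
  rw [← two_mul_Y_eq_zero_iff.mpr ht] at h1
  have h3 := (WeierstrassCurve.Affine.equation_iff _ _).mp hT.1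
  have h4 : 4 * e ^ 3 + WeierstrassCurve.b₂ W * e ^ 2 + 2 * WeierstrassCurve.b₄ W * e +
      WeierstrassCurve.b₆ W = 0 := by
    simp only [WeierstrassCurve.b₂, WeierstrassCurve.b₄, WeierstrassCurve.b₆]
    linear_combination (2 * t + W.a₁ * e + W.a₃) * ht - 4 * h3
  rw [eq_div_iff h2]
  refine mul_left_cancel₀ (sub_ne_zero.mpr hx) ?_
  linear_combination h1 + h4

variable {F : Type u} [Field F] {E E' : WeierstrassCurve.Affine F}

/-- The height of an isogeny with a point of order two in its kernel is even. -/
lemma even_of_two_torsion_mem_ker [E.IsElliptic] (h2 : (2 : F) ≠ 0)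
    {f : GeomPoint E →+ GeomPoint E'} {v : Fin 2 → (AlgebraicClosure F)[X]} {m : ℕ}
    (hv : IsPrim v m) (hf : XRep f v) {T : GeomPoint E} (hT0 : T ≠ 0) (hT : T + T = 0)
    (hfT : f T = 0) : Even m := by
  have h2' : (2 : AlgebraicClosure F) ≠ 0 := by
    simpa only [map_ofNat, _root_.map_zero] using
      (algebraMap F (AlgebraicClosure F)).injective.ne h2
  rcases T with _ | ⟨e, t, hN⟩
  · exact absurd rfl hT0
  set T : GeomPoint E := .some e t hN with hTdef
  set r := (6 * e ^ 2 + WeierstrassCurve.b₂ (geom E) * e + WeierstrassCurve.b₄ (geom E)) / 2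
    with hr
  have htr : Tendsto (fun P : GeomPoint E => P + T) cofinite cofinite :=
    (add_left_injective T).tendsto_cofinite
  have hne : ∀ᶠ P : GeomPoint E in cofinite, ∃ x y, ∃ h, P = .some x y h ∧ x ≠ e := by
    filter_upwards [eventually_affine E, (Set.finite_singleton T).compl_mem_cofinite] with P h1 h3
    obtain ⟨x, y, h, rfl⟩ := h1
    refine ⟨x, y, h, rfl, ?_⟩
    rintro rfl
    rcases Point.eq_or_eq_neg_of_xRep_eq_xRep (P := .some x y h) (Q := T) (by
      rw [hTdef, Point.xRep_some, Point.xRep_some]) with h4 | h4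
    · exact h3 h4
    · exact h3 (h4.trans (neg_eq_of_add_eq_zero_left hT))
  -- If r = 0, then P or P + T would have x-coordinate e for almost all P.
  have hr0 : r ≠ 0 := by
    intro h0
    obtain ⟨P, ⟨x, y, h, hP, hx⟩, ⟨x', y', h', hP', hx'⟩⟩ := (hne.and (htr.eventually hne)).exists
    obtain ⟨a, b, hab, hs, ha⟩ := add_two_torsion h2' (h := h) hT hx
    rw [hP, hTdef, hs] at hP'
    obtain ⟨rfl, rfl⟩ := Point.some.inj hP'
    rw [← hr, h0, mul_eq_zero, sub_eq_zero, sub_eq_zero] at ha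
    tauto
  -- As f(P + T) = f(P), composing `v` with the involution represents f again, so the two tuples are
  -- proportional.
  refine hv.even_of_proportional h2' (e := e) hr0 fun i j => ?_
  refine hf.proportional (w := fun j => MvPolynomial.aeval ![C e * (X - C e) + C r, X - C e]
    ((v j).homogenize m)) ?_ i j
  filter_upwards [hne, htr.eventually hf] with P h1 h3
  obtain ⟨x, y, h, rfl, hx⟩ := h1
  obtain ⟨x', y', h', hP', c, hc, e'⟩ := h3
  refine ⟨x, y, h, rfl, (x - e) ^ m * c, mul_ne_zero (pow_ne_zero _ (sub_ne_zero.mpr hx)) hc,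
    fun i => ?_⟩
  obtain ⟨a, b, hab, hs, ha⟩ := add_two_torsion h2' (h := h) hT hx
  rw [hTdef, hs] at hP'
  obtain ⟨rfl, rfl⟩ := Point.some.inj hP'
  rw [map_add, hfT, add_zero] at e'
  rw [mul_assoc, ← e', eval_aeval_form, eval_homogenize (hv.natDegree_le i) _ (by
    simpa using sub_ne_zero.mpr hx)]
  have h3 : (C e * (X - C e) + C r : (AlgebraicClosure F)[X]).eval x /
      (X - C e : (AlgebraicClosure F)[X]).eval x = a := by
    simp only [eval_add, eval_mul, eval_sub, eval_C, eval_X]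
    rw [div_eq_iff (sub_ne_zero.mpr hx), hr, ← ha]
    ring
  simp only [Matrix.cons_val_zero, Matrix.cons_val_one]
  rw [h3, mul_comm]
  simp

end translation

section degree

open scoped IntermediateField RatFunc
open WeierstrassCurve.Affine (CoordinateRing)

variable {F : Type u} [Field F] {E E' : WeierstrassCurve.Affine F}

/-- A rational function of `x` as a rational function on `E`. -/
def ofRatFunc (E : WeierstrassCurve.Affine F) : RatFunc F →ₐ[F] E.FunctionField :=
  RatFunc.liftAlgHom
    { ofX E with
      commutes' := fun r => by
        rw [IsScalarTower.algebraMap_apply F E.CoordinateRing E.FunctionField]; rfl }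
    fun p hp => by
      rw [Submonoid.mem_comap, mem_nonZeroDivisors_iff_ne_zero]
      exact (map_ne_zero_iff _ ofX_injective).mpr (nonZeroDivisors.ne_zero hp)

lemma ofRatFunc_algebraMap (p : F[X]) : ofRatFunc E (algebraMap F[X] (RatFunc F) p) = ofX E p := by
  rw [ofRatFunc, RatFunc.liftAlgHom_apply]
  simp

lemma ofRatFunc_mul_denom (f : RatFunc F) : ofRatFunc E f * ofX E f.denom = ofX E f.num := by
  rw [← ofRatFunc_algebraMap, ← ofRatFunc_algebraMap, ← map_mul]
  congr 1
  rw [← eq_div_iff (RatFunc.algebraMap_ne_zero f.denom_ne_zero), RatFunc.num_div_denom]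

/-- The function field has degree two over the rational functions in `x`. -/
lemma finrank_ofRatFunc (E : WeierstrassCurve.Affine F) :
    letI := (ofRatFunc E).toRingHom.toAlgebra
    Module.finrank (RatFunc F) E.FunctionField = 2 := by
  let _ := (ofRatFunc E).toRingHom.toAlgebra
  have hsmul : ∀ (f : RatFunc F) (u : E.FunctionField), f • u = ofRatFunc E f * u :=
    fun f u => Algebra.smul_def _ _
  have hpoly : ∀ p q : F[X], ofX E p + ofX E q * coordY E = 0 → p = 0 ∧ q = 0 := by
    intro p q h
    refine CoordinateRing.smul_basis_eq_zero (W' := E) ?_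
    rw [← IsFractionRing.to_map_eq_zero_iff (K := E.FunctionField), ← h, CoordinateRing.smul,
      CoordinateRing.smul, mul_one, map_add, map_mul]
    rfl
  have hli : LinearIndependent (RatFunc F) ![(1 : E.FunctionField), coordY E] := by
    rw [LinearIndependent.pair_iff]
    intro f g h
    rw [hsmul, hsmul, mul_one] at h
    have h1 := hpoly (f.num * g.denom) (g.num * f.denom) (by
      rw [map_mul, map_mul, ← ofRatFunc_mul_denom, ← ofRatFunc_mul_denom]
      linear_combination ofX E f.denom * ofX E g.denom * h)
    simpa [f.denom_ne_zero, g.denom_ne_zero] using h1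
  have hsp : ⊤ ≤ Submodule.span (RatFunc F) (Set.range ![(1 : E.FunctionField), coordY E]) := by
    intro u _
    obtain ⟨p, q, N, hN, h⟩ := exists_ofX_mul_eq u
    have hN' := (map_ne_zero_iff _ (ofX_injective (E := E))).mpr hN
    have : u = (algebraMap F[X] (RatFunc F) p / algebraMap F[X] (RatFunc F) N) •
        (1 : E.FunctionField) +
        (algebraMap F[X] (RatFunc F) q / algebraMap F[X] (RatFunc F) N) • coordY E := by
      rw [hsmul, hsmul, map_div₀, map_div₀, ofRatFunc_algebraMap, ofRatFunc_algebraMap,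
        ofRatFunc_algebraMap]
      field_simp
      linear_combination h
    rw [this]
    refine Submodule.add_mem _ (Submodule.smul_mem _ _ (Submodule.subset_span ⟨0, rfl⟩))
      (Submodule.smul_mem _ _ (Submodule.subset_span ⟨1, rfl⟩))
  rw [Module.finrank_eq_card_basis (Module.Basis.mk hli hsp), Fintype.card_fin]

/-- Multiply degrees in the tower F(f) ⊆ F(x) ⊆ F(E). -/
lemma finrank_adjoin_ofRatFunc (f : RatFunc F) :
    Module.finrank (IntermediateField.adjoin F {ofRatFunc E f}) E.FunctionField =
      max f.num.natDegree f.denom.natDegree * 2 := by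
  let _ := (ofRatFunc E).toRingHom.toAlgebra
  have : IsScalarTower F (RatFunc F) E.FunctionField := .of_algebraMap_eq fun x =>
    ((ofRatFunc E).commutes x).symm
  let A := IntermediateField.adjoin F {f}
  have h1 : Module.finrank A (RatFunc F) * Module.finrank (RatFunc F) E.FunctionField =
      Module.finrank A E.FunctionField := Module.finrank_mul_finrank _ _ _
  rw [finrank_ofRatFunc, RatFunc.finrank_eq_max_natDegree] at h1
  rw [h1]
  have hB : A.map (ofRatFunc E) = IntermediateField.adjoin F {ofRatFunc E f} := by
    rw [IntermediateField.adjoin_map, Set.image_singleton]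
  rw [← hB]
  refine (Algebra.finrank_eq_of_equiv_equiv (A.equivMap (ofRatFunc E)).toRingEquiv
    (RingEquiv.refl _) ?_).symm
  ext x
  rfl

lemma Isogeny.weierstrass_eq [E.IsElliptic] (φ : Isogeny E E') :
    φ.y ^ 2 + (algebraMap F _ E'.a₁ * φ.x + algebraMap F _ E'.a₃) * φ.y =
      φ.x ^ 3 + algebraMap F _ E'.a₂ * φ.x ^ 2 + algebraMap F _ E'.a₄ * φ.x +
        algebraMap F _ E'.a₆ := by
  refine eq_of_eventually_hasValueAt ?_
  filter_upwards [φ.eventually_eq] with P hP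
  obtain ⟨a, b, h, -, hx, hy⟩ := hP
  have hk := hasValueAt_const hx
  have h1 := (WeierstrassCurve.Affine.equation_iff _ _).mp h.1
  refine ⟨_, (hy.pow 2).add ((((hk _).mul hx).add (hk _)).mul hy), ?_⟩
  convert (((hx.pow 3).add ((hk _).mul (hx.pow 2))).add ((hk _).mul hx)).add (hk _) using 1
  simp only [WeierstrassCurve.map_a₁, WeierstrassCurve.map_a₂, WeierstrassCurve.map_a₃,
    WeierstrassCurve.map_a₄, WeierstrassCurve.map_a₆] at h1
  linear_combination h1

/-- The pullback of `y` generates an extension of degree one or two. -/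
lemma Isogeny.exists_mul_degree_eq [E.IsElliptic] (φ : Isogeny E E') :
    ∃ m, (m = 1 ∨ m = 2) ∧
      Module.finrank (IntermediateField.adjoin F {φ.x}) E.FunctionField = m * φ.degree := by
  let A := IntermediateField.adjoin F {φ.x}
  let gx : A := IntermediateField.AdjoinSimple.gen F φ.x
  let q : A[X] := X ^ 2 + C (algebraMap F A E'.a₁ * gx + algebraMap F A E'.a₃) * X -
    C (gx ^ 3 + algebraMap F A E'.a₂ * gx ^ 2 + algebraMap F A E'.a₄ * gx + algebraMap F A E'.a₆)
  have hq : q.Monic := by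
    simp only [q]
    monicity!
  have hqd : q.natDegree = 2 := by
    simp only [q]
    compute_degree!
  have hroot : aeval φ.y q = 0 := by
    simp only [q, map_sub, map_add, map_mul, map_pow, aeval_X, aeval_C,
      ← IsScalarTower.algebraMap_apply]
    have : algebraMap A E.FunctionField gx = φ.x := rfl
    rw [this]
    linear_combination φ.weierstrass_eq
  have hyi : IsIntegral A φ.y := ⟨q, hq, hroot⟩
  have h1 := Module.finrank_mul_finrank A (IntermediateField.adjoin A {φ.y}) E.FunctionField
  have h2 := IntermediateField.adjoin.finrank hyi
  have h3 : (minpoly A φ.y).natDegree ≤ 2 := by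
    rw [← hqd]
    exact natDegree_le_natDegree (minpoly.min A φ.y hq hroot)
  have h4 := minpoly.natDegree_pos hyi
  refine ⟨(minpoly A φ.y).natDegree, by omega, ?_⟩
  rw [← h2, ← h1, Isogeny.degree]
  congr 1
  have : IntermediateField.adjoin F {φ.x, φ.y} =
      (IntermediateField.adjoin A {φ.y}).restrictScalars F := by
    rw [IntermediateField.adjoin_simple_adjoin_simple]
  rw [this]
  rfl

/-- The degree of an isogeny with a point of order two in its kernel is even. -/
theorem Isogeny.two_dvd_degree [E.IsElliptic] (h2 : (2 : F) ≠ 0) (φ : Isogeny E E')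
    {T : GeomPoint E} (hT0 : T ≠ 0) (hT : T + T = 0) (hφ : φ.toHom T = 0) : 2 ∣ φ.degree := by
  obtain ⟨n, d, -, hd, h⟩ := φ.exists_fraction h2
  have hd' := (map_ne_zero_iff _ (ofX_injective (E := E))).mpr hd
  set f : RatFunc F := algebraMap F[X] (RatFunc F) n / algebraMap F[X] (RatFunc F) d
  have hf : ofRatFunc E f = φ.x := by
    rw [map_div₀, ofRatFunc_algebraMap, ofRatFunc_algebraMap, div_eq_iff hd', h]
  have heven := even_of_two_torsion_mem_ker h2 (isPrim_of_isCoprime f.isCoprime_num_denom)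
    (φ.xRep_of_fraction f.denom_ne_zero (by rw [← hf, ofRatFunc_mul_denom])) hT0 hT hφ
  -- Twice the even height equals m times the degree with m ≤ 2, so the degree is even in both
  -- cases.
  obtain ⟨m, hm, hdeg⟩ := φ.exists_mul_degree_eq
  rw [← hf, finrank_adjoin_ofRatFunc] at hdeg
  obtain ⟨r, hr⟩ := heven
  rw [hr] at hdeg
  rcases hm with rfl | rfl <;> omega

end degree

end

end IsogenyGraph

namespace IsogenyGraph

noncomputable section

open Polynomial Filter
open scoped Polynomial.Bivariate

universe u

/-! ### Comparison of the two endomorphism rings. -/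

section horizontal

/-- Commutativity is known only as a theorem; the equations on ring structures ensure that the
isomorphism concerns the given rings. -/
lemma nonempty_ringEquiv_of_exists_isQuadOrder {R R' : Type*} [r : Ring R] [r' : Ring R']
    {p : ℕ} {π : R} {π' : R'} (hR : ∃ i : CommRing R, i.toRing = r ∧ IsQuadOrder p R π)
    (hR' : ∃ i : CommRing R', i.toRing = r' ∧ IsQuadOrder p R' π')
    (h : (∃ f : R, 2 * f = 1 + π) ↔ ∃ f : R', 2 * f = 1 + π') : Nonempty (R ≃+* R') := by
  obtain ⟨i, rfl, hQ⟩ := hR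
  obtain ⟨i', rfl, hQ'⟩ := hR'
  exact hQ.nonempty_ringEquiv hQ' h

variable {p : ℕ} [Fact p.Prime] {E E' : WeierstrassCurve.Affine (ZMod p)} [E.IsElliptic]
  [E'.IsElliptic]

/-- The element `(1 + π) / 2` is an endomorphism if and only if the `2`-torsion is rational. -/
lemma exists_two_mul_eq_iff (hp : 3 < p) :
    (∃ f : EndOver E, 2 * f = 1 + frobEnd E) ↔
      ∀ T : GeomPoint E, T + T = 0 → frob E T = T := by
  constructor
  · rintro ⟨f, hf⟩ T hT
    have h1 := DFunLike.congr_fun (congrArg Subtype.val hf) T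
    rw [two_mul] at h1
    have h2 : f.1 T + f.1 T = T + frob E T := h1
    rw [← map_add, hT, map_zero] at h2
    exact add_left_cancel (h2.symm.trans hT.symm)
  · intro h
    obtain ⟨g, hg, hg'⟩ := exists_half hp h
    refine ⟨⟨g, hg⟩, Subtype.ext (AddMonoidHom.ext fun Q => ?_)⟩
    rw [two_mul]
    change g Q + g Q = Q + frob E Q
    rw [← map_add, hg']

/-- f is injective on 2-torsion and commutes with Frobenius. Both groups have four elements, so f is
also onto the 2-torsion of `E'`, which gives the forward direction; the converse needs injectivity
alone, applied to πT - T. -/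
lemma rational_twoTorsion_iff (hp : 3 < p) {f : GeomPoint E →+ GeomPoint E'}
    (hf : IsHomOver E E' f) (hker : ∀ T, T + T = 0 → f T = 0 → T = 0) :
    (∀ T : GeomPoint E, T + T = 0 → frob E T = T) ↔
      ∀ T : GeomPoint E', T + T = 0 → frob E' T = T := by
  constructor
  · intro h T hT
    have h2 : (2 : AlgebraicClosure (ZMod p)) ≠ 0 := by
      simpa only [map_ofNat, _root_.map_zero] using
        (algebraMap (ZMod p) (AlgebraicClosure (ZMod p))).injective.ne (two_ne_zero_of_lt hp)
    have hinj : Set.InjOn f {T | T + T = 0} := fun A hA B hB hAB => by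
      rw [Set.mem_ofPred_eq] at hA hB
      refine sub_eq_zero.mp (hker _ ?_ (by rw [map_sub, hAB, sub_self]))
      rw [sub_add_sub_comm, hA, hB, sub_zero]
    have hsub : f '' {T | T + T = 0} ⊆ {T | T + T = 0} := by
      rintro _ ⟨A, hA, rfl⟩
      rw [Set.mem_ofPred_eq] at hA ⊢
      rw [← map_add, hA, map_zero]
    have hcard := ncard_twoTorsion (W := geom E') h2
    have heq := Set.eq_of_subset_of_ncard_le hsub (by
      rw [hinj.ncard_image, hcard, ncard_twoTorsion h2])
      (Set.finite_of_ncard_ne_zero (by rw [hcard]; norm_num))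
    have hmem : T ∈ f '' {T | T + T = 0} := by rw [heq]; exact hT
    obtain ⟨A, hA, rfl⟩ := hmem
    rw [← hf.frob_comm, h A hA]
  · intro h T hT
    refine sub_eq_zero.mp (hker _ ?_ ?_)
    · rw [sub_add_sub_comm, ← map_add, hT, map_zero, sub_zero]
    · rw [map_sub, hf.frob_comm, h (f T) (by rw [← map_add, hT, map_zero]), sub_self]

/-- Isogenies without a point of order two in the kernel are horizontal. -/
theorem Isogeny.isHorizontal_of_ker (hp : 3 < p) (hE : IsSupersingular p E)
    (hE' : IsSupersingular p E') (φ : Isogeny E E')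
    (hker : ∀ T, T + T = 0 → φ.toHom T = 0 → T = 0) : φ.IsHorizontal := by
  refine nonempty_ringEquiv_of_exists_isQuadOrder (exists_isQuadOrder hp hE)
    (exists_isQuadOrder hp hE') ((exists_two_mul_eq_iff (E := E) hp).trans
    ((rational_twoTorsion_iff hp (Or.inr ⟨φ, rfl⟩) hker).trans (exists_two_mul_eq_iff hp).symm))

end horizontal

end

end IsogenyGraph

theorem mainTheorem5 (p : ℕ) [Fact p.Prime] (hp : 3 < p)
    (E E' : WeierstrassCurve (ZMod p)) [E.IsElliptic] [E'.IsElliptic]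
    (hE : IsogenyGraph.IsSupersingular p E) (hE' : IsogenyGraph.IsSupersingular p E')
    (φ : IsogenyGraph.Isogeny E E') (hφ : ¬ φ.IsHorizontal) :
    2 ∣ φ.degree := by
  by_contra hdeg
  refine hφ (φ.isHorizontal_of_ker hp hE hE' fun T hT hT' => ?_)
  by_contra hT0
  exact hdeg (φ.two_dvd_degree (IsogenyGraph.two_ne_zero_of_lt hp) hT0 hT hT')
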